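/- **Setting.** Let $n\ge 1$, $k\ge 1$, $d,R\ge 0$ and $M=2^k$. Client $p\in[n]$ holds as private input its model updates $x_p=(x_p^{(r)})_{r\le R}$, $x_p^{(r)}\in\mathbb Z_M^d$, one for each global iteration (they are arbitrary, so they may be whatever local training produced). Public are two iteration numbers $T_{\rm inv},T_{\rm sqrt}$ and ring elements $c^{-1}$, $x_0$, $\tfrac12$, $\tfrac1n$, $\tau\in\mathbb Z_M$, which are arbitrary encodings of the corresponding real constants. $[\![x]\!]$ denotes $n$-out-of-$n$ additive sharing over $\mathbb Z_M$ (over $\mathbb Z_2$ for bits). **Functionality $f$** (all arithmetic in $\mathbb Z_M$). $\mathrm{inv}(X)=B_{T_{\rm inv}}$, where $B_0=c^{-1}$, $M_0=c^{-1}X$, $B_{s+1}=2B_s-B_sM_s$, $M_{s+1}=2M_s-M_s^2$; $\mathrm{sqrt}(Y)=y_{T_{\rm sqrt}}$, where $y_0=x_0$, $y_{s+1}=\tfrac12(y_s+Y\cdot\mathrm{inv}(y_s))$; $\|v\|=\mathrm{sqrt}(\sum_t v_t^2)$; $\cos(v,w)=\langle v,w\rangle\cdot\mathrm{inv}(\|v\|\|w\|)$;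 $\mathrm{Norm}(v,w)=v\cdot(\|w\|\cdot\mathrm{inv}(\|v\|))$. In every iteration, with updates $w_1,\dots,w_n$ and for $i\neq j$, the bit $\beta_{ij}$ is $1$ iff $\cos(w_i,w_j)<\tau$ as signed (two's complement) numbers; $\overline w_j=0$ if $\beta_{ij}=1$ and $\overline w_j=\mathrm{Norm}(w_j,w_i)$ otherwise; and $\hat w_i=\tfrac1n\big(\sum_{j\ne i}\overline w_j+w_i\big)$. The output $f_p(\bar x)$ of client $p$ consists of $\hat w_p$ and all the bits $\beta_{ij}$, for all $R$ iterations. **Protocol $\Pi$ (SecureDL, online phase).** In every iteration all clients additively share their updates with fresh coins. For every receiver $i$ and every $j\ne i$ the parties compute $[\![\cos(w_i,w_j)]\!]$, each multiplication being a Beaver multiplication with a fresh random triple $(a,b,ab)$: $\delta=x-a$ and $\epsilon=y-b$ are opened to all parties and $[\![xy]\!]=[\![c]\!]+\epsilon[\![a]\!]+\delta[\![b]\!]+\epsilon\delta$. They compare with $\tau$ by Rabbit's comparison: with a fresh edaBit (a uniform $r\in\mathbb Z_M$ shared over $\mathbb Z_M$, and its bits shared over $\mathbb Z_2$), for a shared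 $x$ and a public $c$ they open $a=x+r$, put $b=a-c$, compute $[\![a<r]\!]$ and $[\![b<r]\!]$ by Boolean circuits with Beaver multiplications over $\mathbb Z_2$, and disclose the bit $(x<c)=1-(a<r)+(b<r)-(b<M-c)$ to all parties; signed numbers are first shifted by $2^{k-1}$. If the update is not discarded, they compute $[\![\mathrm{Norm}(w_j,w_i)]\!]$. Finally $[\![\hat w_i]\!]$ is computed locally and opened to client $i$ only. Triples and edaBits are handed out by the trusted preprocessing phase. For $I\subseteq[n]$, the view $\mathrm{View}_I^\Pi(\bar x)$ consists of the inputs $x_I$, all coin tosses of the parties in $I$, the preprocessing shares they get, and all messages they receive. **Theorem (privacy w.r.t. semi-honest behaviour).** $\Pi$ privately computes $f$ in the presence of up to $n-1$ colluding semi-honest parties: 1. in every execution of $\Pi$ on inputs $\bar x$, every client $p$ obtains $f_p(\bar x)$; 2. there is a probabilistic polynomial-time simulator $S$ — one program of a probabilistic random access machine with logarithmic cost, and one polynomial $T$ — such that for all $n,k,d,R$, all public parameters and every $I\subsetneq[n]$, writing $S_I$ for $S$ run on the public parameters and $I$: $S_I$ always halts within $T(n+k+d+R+T_{\rm inv}+T_{\rm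 sqrt})$ steps, and its output is perfectly indistinguishable from the real view, $$S_I\big(x_I,f_I(\bar x)\big)\ \stackrel{\rm perf}{\equiv}\ \mathrm{View}_I^{\Pi}(\bar x)\qquad\text{for all inputs }\bar x,$$ that is, both have the same probability distribution (with views written as lists of numbers). -/

import Mathlib

noncomputable section

namespace SecureDL

/-! ## Executions of an `n`-party protocol and what each party sees -/

/-- Where a value seen by a party comes from: its own coin tosses, the trusted preprocessing
phase, or a message of party `j`. -/
inductive Source (n : ℕ) where
  | coins
  | dealer
  | party (j : Fin n)

/-- One value that becomes known to the party `owner` during an execution. The value is the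
representative in `{0, …, q - 1}` of an element of `ZMod q`. -/
structure Event (n : ℕ) where
  owner : Fin n
  source : Source n
  value : ℕ

/-- Randomized computations that append to a log the values seen by the individual parties. -/
abbrev Prot (n : ℕ) : Type → Type := StateT (List (Event n)) PMF

/-- Append events to the log. -/
def record {n : ℕ} (es : List (Event n)) : Prot n Unit :=
  modify fun log => log ++ es

/-- Draw a uniformly random element. -/
def sample {n : ℕ} (α : Type) [Fintype α] [Nonempty α] : Prot n α :=
  StateT.lift (PMF.uniformOfFintype α)

/-- Run the computations `f 0, f 1, …, f (m - 1)` one after the other. -/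
def forFin {n : ℕ} {α : Type} : {m : ℕ} → (Fin m → Prot n α) → Prot n (Fin m → α)
  | 0, _ => pure Fin.elim0
  | _ + 1, f => do
      let a ← f 0
      let as ← forFin fun i => f i.succ
      pure (Fin.cons a as)

/-! ## Additive secret sharing -/

/-- An additive sharing: party `i` holds `s i`, the shared value is `∑ i, s i` in `ZMod q`. -/
abbrev Sharing (n q : ℕ) : Type := Fin n → ZMod q

section Sharing

variable {n q : ℕ} [NeZero n] [NeZero q]

/-- The sharing of `x` in which every party `j ≠ i` holds `u j` and party `i` holds the rest.
For uniformly random `u` it is uniformly distributed among all sharings of `x`. -/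
def complete (i : Fin n) (x : ZMod q) (u : Sharing n q) : Sharing n q :=
  Function.update u i (x - ∑ j ∈ Finset.univ.erase i, u j)

/-- The trivial sharing of a public constant. -/
def pub (c : ZMod q) : Sharing n q := fun i => if i = 0 then c else 0

/-- The preprocessing phase hands out the shares `s`. -/
def deal (s : Sharing n q) : Prot n Unit :=
  record ((List.finRange n).map fun j => ⟨j, .dealer, (s j).val⟩)

/-- Client `i` shares its private value `x`: it tosses coins to obtain the shares of all other
clients, keeps the rest, and sends the shares out. -/
def shareInput (i : Fin n) (x : ZMod q) : Prot n (Sharing n q) := do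
  let u ← sample (Sharing n q)
  record (((List.finRange n).filter (· ≠ i)).flatMap fun j =>
    [⟨i, .coins, (u j).val⟩, ⟨j, .party i, (u j).val⟩])
  pure (complete i x u)

/-- All other parties send their shares to party `i`, who learns the shared value. -/
def revealTo (i : Fin n) (s : Sharing n q) : Prot n (ZMod q) := do
  record (((List.finRange n).filter (· ≠ i)).map fun j => ⟨i, .party j, (s j).val⟩)
  pure (∑ j, s j)

/-- Every party sends its share to every other party; everybody learns the shared value. -/
def reveal (s : Sharing n q) : Prot n (ZMod q) := do
  record ((List.finRange n).flatMap fun i =>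
    ((List.finRange n).filter (· ≠ i)).map fun j => ⟨i, .party j, (s j).val⟩)
  pure (∑ j, s j)

/-- Beaver multiplication with a fresh random triple `(a, b, c)`, `c = a * b`, from the
preprocessing phase. -/
def mulShares (x y : Sharing n q) : Prot n (Sharing n q) := do
  let a ← sample (Sharing n q)
  let b ← sample (Sharing n q)
  let u ← sample (Sharing n q)
  let c := complete 0 ((∑ i, a i) * ∑ i, b i) u
  deal a
  deal b
  deal c
  let δ ← reveal (x - a)
  let ε ← reveal (y - b)
  pure fun i => c i + ε * a i + δ * b i + if i = 0 then ε * δ else 0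

end Sharing

/-! ## Public parameters -/

/-- The public constants of the protocol, with the real constants given as ring elements.
`cInv` is the initial value `c⁻¹` of the inversion, `guess` the initial guess of the square root,
`half` encodes `1/2`, `invN` encodes `1/n`, and `tau` is the threshold. -/
structure Params (k : ℕ) where
  invIters : ℕ
  sqrtIters : ℕ
  cInv : ZMod (2 ^ k)
  guess : ZMod (2 ^ k)
  half : ZMod (2 ^ k)
  invN : ZMod (2 ^ k)
  tau : ZMod (2 ^ k)

/-! ## The subprotocols on shared values -/

section Subprotocols

variable {n k d : ℕ} [NeZero n]

/-- `B ↦ 2 B - B M`, `M ↦ 2 M - M ^ 2`, repeated; the result is the final `B`. -/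
def invLoop : ℕ → Sharing n (2 ^ k) → Sharing n (2 ^ k) → Prot n (Sharing n (2 ^ k))
  | 0, B, _ => pure B
  | t + 1, B, M => do
      let BM ← mulShares B M
      let MM ← mulShares M M
      invLoop t (2 • B - BM) (2 • M - MM)

/-- Newton iteration for the inverse of `X`. -/
def invShares (P : Params k) (X : Sharing n (2 ^ k)) : Prot n (Sharing n (2 ^ k)) :=
  invLoop P.invIters (pub P.cInv) (P.cInv • X)

/-- `x ↦ (x + Y / x) / 2`, repeated. -/
def sqrtLoop (P : Params k) (Y : Sharing n (2 ^ k)) :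
    ℕ → Sharing n (2 ^ k) → Prot n (Sharing n (2 ^ k))
  | 0, x => pure x
  | t + 1, x => do
      let z ← invShares P x
      let y ← mulShares Y z
      sqrtLoop P Y t (P.half • (x + y))

/-- Newton iteration for the square root of `Y`. -/
def sqrtShares (P : Params k) (Y : Sharing n (2 ^ k)) : Prot n (Sharing n (2 ^ k)) :=
  sqrtLoop P Y P.sqrtIters (pub P.guess)

/-- Inner product of two shared vectors. -/
def dotShares (v w : Fin d → Sharing n (2 ^ k)) : Prot n (Sharing n (2 ^ k)) := do
  let z ← forFin fun t => mulShares (v t) (w t)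
  pure (∑ t, z t)

/-- Norm of a shared vector. -/
def normShares (P : Params k) (v : Fin d → Sharing n (2 ^ k)) : Prot n (Sharing n (2 ^ k)) := do
  let s ← dotShares v v
  sqrtShares P s

/-- Cosine similarity of two shared vectors. -/
def cosineShares (P : Params k) (v w : Fin d → Sharing n (2 ^ k)) :
    Prot n (Sharing n (2 ^ k)) := do
  let dot ← dotShares v w
  let nv ← normShares P v
  let nw ← normShares P w
  let m ← mulShares nv nw
  let denom ← invShares P m
  mulShares dot denom

/-- L2-normalization: rescale `v` to the norm of `w`. -/
def normalizeShares (P : Params k) (v w : Fin d → Sharing n (2 ^ k)) :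
    Prot n (Fin d → Sharing n (2 ^ k)) := do
  let nv ← normShares P v
  let nw ← normShares P w
  let z ← invShares P nv
  let r ← mulShares nw z
  forFin fun t => mulShares (v t) r

/-- Sharing of the bit `a mod 2 ^ m < r`, where `a` is public and `r < 2 ^ m` is given by sharings
modulo 2 of its bits (least significant first), with one Beaver multiplication modulo 2 per bit. -/
def ltBits (a : ℕ) : (m : ℕ) → (Fin m → Sharing n 2) → Prot n (Sharing n 2)
  | 0, _ => pure 0
  | m + 1, r => do
      let l ← ltBits a m fun i => r i.castSucc
      let t ← mulShares (r (Fin.last m)) l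
      pure (if a.testBit m then t else t + r (Fin.last m) + l)

/-- An edaBit from the preprocessing phase: a sharing modulo `2 ^ k` of a uniformly random `r`,
together with sharings modulo 2 of the `k` bits of `r`. -/
def edaBits (n k : ℕ) [NeZero n] : Prot n (Sharing n (2 ^ k) × (Fin k → Sharing n 2)) := do
  let r ← sample (Sharing n (2 ^ k))
  let u ← sample (Fin k → Sharing n 2)
  let bits : Fin k → Sharing n 2 := fun m =>
    complete 0 (if (∑ i, r i).val.testBit m then 1 else 0) (u m)
  deal r
  let _ ← forFin fun m => deal (bits m)
  pure (r, bits)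

/-- Rabbit comparison of a shared value with a public constant, both taken in `[0, 2 ^ k)`: with
`a = x + r` and `b = a - c` modulo `M = 2 ^ k`, the bit `x < c` equals
`1 - (a < r) + (b < r) - (b < M - c)`. It is disclosed to all parties. -/
def rabbit (x : Sharing n (2 ^ k)) (c : ZMod (2 ^ k)) : Prot n Bool := do
  let (r, bits) ← edaBits n k
  let a ← reveal (x + r)
  let b := a - c
  let w₁ ← ltBits a.val k bits
  let w₂ ← ltBits b.val k bits
  let w₃ : ZMod 2 := if b.val < 2 ^ k - c.val then 1 else 0
  let w ← reveal (w₁ + w₂ + pub (1 + w₃))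
  pure (decide (w = 1))

/-- Secure comparison `x < τ` of signed (two's complement) numbers: shift both by `2 ^ (k - 1)`. -/
def compareShares (x : Sharing n (2 ^ k)) (τ : ZMod (2 ^ k)) : Prot n Bool :=
  rabbit (x + pub (2 ^ (k - 1))) (τ + 2 ^ (k - 1))

end Subprotocols

/-! ## The protocol -/

/-- What a client obtains over `R` global iterations: its aggregated model in each iteration, and
the outcomes of the comparisons in each iteration: `rejected r i j` says that the update of
client `j` was discarded for client `i`. -/
@[ext] structure Output (n k d R : ℕ) where
  model : Fin R → Fin d → ZMod (2 ^ k)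
  rejected : Fin R → Fin n → Fin n → Bool

section Protocol

variable {n k d : ℕ} [NeZero n]

/-- Aggregation for client `i`, given the shared updates `w` of all clients. The result is the
aggregated model, which is revealed to client `i` alone, and the outcomes of the comparisons. -/
def aggregate (P : Params k) (w : Fin n → Fin d → Sharing n (2 ^ k)) (i : Fin n) :
    Prot n ((Fin d → ZMod (2 ^ k)) × (Fin n → Bool)) := do
  let res ← forFin fun j : Fin n =>
    (if j = i then pure (false, 0)
    else do
      let cosine ← cosineShares P (w i) (w j)
      let rej ← compareShares cosine P.tau
      if rej then pure (true, 0)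
      else do
        let v ← normalizeShares P (w j) (w i)
        pure (false, v) : Prot n (Bool × (Fin d → Sharing n (2 ^ k))))
  let agg : Fin d → Sharing n (2 ^ k) := fun t =>
    P.invN • ((∑ j ∈ Finset.univ.erase i, (res j).2 t) + w i t)
  let model ← forFin fun t => revealTo i (agg t)
  pure (model, fun j => (res j).1)

/-- One global iteration: the clients share their updates, then aggregate for every client. -/
def iteration (P : Params k) (x : Fin n → Fin d → ZMod (2 ^ k)) :
    Prot n (Fin n → (Fin d → ZMod (2 ^ k)) × (Fin n → Bool)) := do
  let w ← forFin fun i => forFin fun t => shareInput i (x i t)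
  forFin fun i => aggregate P w i

variable {R : ℕ}

/-- The whole protocol, where `x i r` is the update of client `i` in global iteration `r`:
the joint distribution of the outputs of all clients and of the log. -/
def protocol (P : Params k) (x : Fin n → Fin R → Fin d → ZMod (2 ^ k)) :
    PMF ((Fin n → Output n k d R) × List (Event n)) :=
  StateT.run (do
    let res ← forFin fun r => iteration P fun i => x i r
    pure fun p => ⟨fun r => (res r p).1, fun r i => (res r i).2⟩ : Prot n _) []

end Protocol

/-! ## The functionality, in the clear -/

section Functionality

variable {n k d : ℕ}

/-- `t` steps of the iteration for the inverse. -/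
def invLoopClear : ℕ → ZMod (2 ^ k) → ZMod (2 ^ k) → ZMod (2 ^ k)
  | 0, B, _ => B
  | t + 1, B, M => invLoopClear t (2 * B - B * M) (2 * M - M * M)

/-- Approximate inverse. -/
def invClear (P : Params k) (X : ZMod (2 ^ k)) : ZMod (2 ^ k) :=
  invLoopClear P.invIters P.cInv (P.cInv * X)

/-- `t` steps of the iteration for the square root. -/
def sqrtLoopClear (P : Params k) (Y : ZMod (2 ^ k)) : ℕ → ZMod (2 ^ k) → ZMod (2 ^ k)
  | 0, x => x
  | t + 1, x => sqrtLoopClear P Y t (P.half * (x + Y * invClear P x))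

/-- Approximate norm. -/
def normClear (P : Params k) (v : Fin d → ZMod (2 ^ k)) : ZMod (2 ^ k) :=
  sqrtLoopClear P (∑ t, v t * v t) P.sqrtIters P.guess

/-- Approximate cosine similarity. -/
def cosineClear (P : Params k) (v w : Fin d → ZMod (2 ^ k)) : ZMod (2 ^ k) :=
  (∑ t, v t * w t) * invClear P (normClear P v * normClear P w)

/-- Approximate rescaling of `v` to the norm of `w`. -/
def normalizeClear (P : Params k) (v w : Fin d → ZMod (2 ^ k)) : Fin d → ZMod (2 ^ k) :=
  fun t => v t * (normClear P w * invClear P (normClear P v))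

/-- `x < τ` for two's complement numbers, `0, …, 2 ^ (k-1) - 1, -2 ^ (k-1), …, -1`. -/
def signedLT (x τ : ZMod (2 ^ k)) : Bool :=
  decide ((x + 2 ^ (k - 1)).val < (τ + 2 ^ (k - 1)).val)

/-- Whether the update of client `j` is discarded for client `i`. -/
def rejectedClear (P : Params k) (x : Fin n → Fin d → ZMod (2 ^ k)) (i j : Fin n) : Bool :=
  if j = i then false else signedLT (cosineClear P (x i) (x j)) P.tau

/-- The aggregated model of client `i`. -/
def modelClear (P : Params k) (x : Fin n → Fin d → ZMod (2 ^ k)) (i : Fin n) :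
    Fin d → ZMod (2 ^ k) := fun t =>
  P.invN * ((∑ j ∈ Finset.univ.erase i,
    if rejectedClear P x i j then 0 else normalizeClear P (x j) (x i) t) + x i t)

/-- The function computed by the protocol; `functionality P x p` is the output of client `p`. -/
def functionality {R : ℕ} (P : Params k) (x : Fin n → Fin R → Fin d → ZMod (2 ^ k)) (p : Fin n) :
    Output n k d R where
  model r := modelClear P (fun i => x i r) p
  rejected r := rejectedClear P fun i => x i r

end Functionality

/-! ## Views -/

/-- Joint view of the coalition `I`: the private inputs of its members, and all their coin tosses,
preprocessing data and received messages. -/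
structure View (n k d R : ℕ) (I : Finset (Fin n)) where
  inputs : I → Fin R → Fin d → ZMod (2 ^ k)
  seen : List (Event n)

/-- Distribution of the joint view of `I` in an execution on the inputs `x`. -/
def viewDist {n k d R : ℕ} [NeZero n] (P : Params k) (I : Finset (Fin n))
    (x : Fin n → Fin R → Fin d → ZMod (2 ^ k)) : PMF (View n k d R I) :=
  (protocol P x).map fun o => ⟨fun p => x p, o.2.filter fun e => e.owner ∈ I⟩

/-- Numerical code of a source. -/
def Source.code {n : ℕ} : Source n → ℕ
  | .coins => 0
  | .dealer => 1
  | .party j => j + 2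

/-- A view written as a list of numbers: first the inputs, then three numbers for every event. -/
def View.encode {n k d R : ℕ} {I : Finset (Fin n)} (V : View n k d R I) : List ℕ :=
  ((List.finRange n).flatMap fun p => (List.finRange R).flatMap fun r =>
    (List.finRange d).flatMap fun t =>
      if h : p ∈ I then [(V.inputs ⟨p, h⟩ r t).val] else []) ++
  V.seen.flatMap fun e => [(e.owner : ℕ), e.source.code, e.value]

theorem Source.code_injective {n : ℕ} : Function.Injective (Source.code (n := n)) := by
  intro a b h
  cases a with
  | coins => cases b <;> simp [Source.code] at h ⊢
  | dealer => cases b <;> simp [Source.code] at h ⊢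
  | party i =>
    cases b with
    | coins => simp [Source.code] at h
    | dealer => simp [Source.code] at h
    | party j => simpa [Source.code, Fin.ext_iff] using h

/-- No information is lost by writing views as lists of numbers. -/
theorem View.encode_injective {n k d R : ℕ} {I : Finset (Fin n)} :
    Function.Injective (View.encode (n := n) (k := k) (d := d) (R := R) (I := I)) := by
  rintro ⟨x, e⟩ ⟨y, f⟩ h
  have key : ∀ {α : Type} (l : List α) (F G : α → List ℕ),
      (∀ a, (F a).length = (G a).length) →
      (l.flatMap F).length = (l.flatMap G).length ∧
      (l.flatMap F = l.flatMap G → ∀ a ∈ l, F a = G a) := by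
    intro α l F G hl
    induction l with
    | nil => simp
    | cons a l ih =>
      refine ⟨by simp only [List.flatMap_cons, List.length_append, hl, ih.1], fun hh => ?_⟩
      simp only [List.flatMap_cons] at hh
      have := List.append_inj hh (hl a)
      simpa [this.1] using ih.2 this.2
  simp only [View.encode] at h
  have l1 : ∀ (p : Fin n) (r : Fin R) (t : Fin d),
      (if h : p ∈ I then [(x ⟨p, h⟩ r t).val] else []).length =
        (if h : p ∈ I then [(y ⟨p, h⟩ r t).val] else []).length := by
    intros
    split_ifs <;> rfl
  have l2 := fun (p : Fin n) (r : Fin R) => key (List.finRange d) _ _ (l1 p r)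
  have l3 := fun (p : Fin n) => key (List.finRange R) _ _ fun r => (l2 p r).1
  have l4 := key (List.finRange n) _ _ fun p => (l3 p).1
  obtain ⟨h1, h2⟩ := List.append_inj h l4.1
  have hxy : x = y := by
    funext ⟨p, hp⟩ r t
    have := (l2 p r).2 ((l3 p).2 (l4.2 h1 p (by simp)) r (by simp)) t (by simp)
    simp only [hp, dite_true, List.cons.injEq, and_true] at this
    exact ZMod.val_injective _ this
  have hef : e = f := by
    clear h h1 l1 l2 l3 l4 hxy
    induction e generalizing f with
    | nil => cases f <;> simp_all
    | cons a e ih =>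
      cases f with
      | nil => simp at h2
      | cons b f =>
        simp only [List.flatMap_cons, List.cons_append, List.nil_append, List.cons.injEq] at h2
        obtain ⟨ha, hb, hc, hd⟩ := h2
        rw [ih f hd]
        congr 1
        obtain ⟨ao, as, av⟩ := a
        obtain ⟨bo, bs, bv⟩ := b
        have h3 : as = bs := Source.code_injective hb
        have h4 : ao = bo := Fin.ext ha
        have h5 : av = bv := hc
        rw [h3, h4, h5]
  rw [hxy, hef]

/-! ## Probabilistic programs with a step count

A random access machine with structured programs. The memory consists of arrays of natural numbers
(named by numbers, with any number of indices). Steps are counted with logarithmic cost. All loops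
are `for` loops, whose number of iterations is computed on entry, so every program halts; whatever
runs in time `T` on a machine with jumps runs in such a loop with a clock. -/

/-- Memory, output tape and step counter. -/
structure State where
  mem : ℕ → List ℕ → ℕ
  out : List ℕ
  steps : ℕ

/-- Arithmetic operations; `sub` is truncated, `lt` returns `1` or `0`. -/
inductive Op where
  | add | sub | mul | div | mod | lt

/-- The value of an operation. -/
def Op.eval : Op → ℕ → ℕ → ℕ
  | .add, a, b => a + b
  | .sub, a, b => a - b
  | .mul, a, b => a * b
  | .div, a, b => a / b
  | .mod, a, b => a % b
  | .lt, a, b => if a < b then 1 else 0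

/-- Expressions: constants, array entries, operations. -/
inductive Expr where
  | lit (c : ℕ)
  | get (a : ℕ) {m : ℕ} (idx : Fin m → Expr)
  | op (o : Op) (e₁ e₂ : Expr)

/-- Value of an expression. -/
def Expr.eval (s : State) : Expr → ℕ
  | .lit c => c
  | .get a idx => s.mem a (List.ofFn fun i => (idx i).eval s)
  | .op o e₁ e₂ => o.eval (e₁.eval s) (e₂.eval s)

/-- Logarithmic cost of evaluating an expression: one step for each node and one for each binary
digit of its value. -/
def Expr.cost (s : State) : Expr → ℕ
  | .lit c => 1 + c.size
  | .get a idx => 1 + (s.mem a (List.ofFn fun i => (idx i).eval s)).size + ∑ i, (idx i).cost s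
  | .op o e₁ e₂ => 1 + (o.eval (e₁.eval s) (e₂.eval s)).size + e₁.cost s + e₂.cost s

/-- Programs. `draw a idx b` tosses `b` fair coins and stores the resulting `b`-bit number,
`emit v` appends to the output tape, `ite` tests for `≠ 0`, and `loop a b c` runs `c` once for
each of the values `0, 1, …, b - 1` of the variable `a`. -/
inductive Program where
  | skip
  | set (a : ℕ) {m : ℕ} (idx : Fin m → Expr) (v : Expr)
  | draw (a : ℕ) {m : ℕ} (idx : Fin m → Expr) (b : Expr)
  | emit (v : Expr)
  | seq (c₁ c₂ : Program)
  | ite (e : Expr) (c₁ c₂ : Program)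
  | loop (a : ℕ) (b : Expr) (c : Program)

/-- Write to the memory. -/
def State.write (s : State) (a : ℕ) (l : List ℕ) (v : ℕ) : State :=
  { s with mem := Function.update s.mem a (Function.update (s.mem a) l v) }

/-- Count `c` steps. -/
def State.tick (s : State) (c : ℕ) : State := { s with steps := s.steps + c }

/-- Uniformly random number with `b` binary digits. -/
def randomBits (b : ℕ) : PMF ℕ := (PMF.uniformOfFintype (Fin (2 ^ b))).map fun v => (v : ℕ)

/-- Run a program from a given state. -/
def Program.exec : Program → State → PMF State
  | .skip, s => pure (s.tick 1)
  | .set a idx v, s =>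
      pure ((s.write a (List.ofFn fun i => (idx i).eval s) (v.eval s)).tick
        (1 + (∑ i, (idx i).cost s) + v.cost s))
  | .draw a idx b, s => do
      let v ← randomBits (b.eval s)
      pure ((s.write a (List.ofFn fun i => (idx i).eval s) v).tick
        (1 + (∑ i, (idx i).cost s) + b.cost s + b.eval s))
  | .emit v, s => pure ({ s with out := s.out ++ [v.eval s] }.tick (1 + v.cost s))
  | .seq c₁ c₂, s => do
      let s' ← c₁.exec s
      c₂.exec s'
  | .ite e c₁ c₂, s =>
      if e.eval s ≠ 0 then c₁.exec (s.tick (1 + e.cost s)) else c₂.exec (s.tick (1 + e.cost s))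
  | .loop a b c, s =>
      (List.range (b.eval s)).foldlM (fun s' t => c.exec ((s'.write a [] t).tick (1 + t.size)))
        (s.tick (1 + b.cost s))

/-! ## The data given to a simulator -/

/-- Initial state of a simulator for the coalition `I`. The public parameters, the set `I`, the
inputs `xI` and the outputs `fI` of the members of `I` are stored in the arrays `0, …, 14`;
everything else is `0`. -/
def simInput {n k d R : ℕ} (P : Params k) (I : Finset (Fin n))
    (xI : I → Fin R → Fin d → ZMod (2 ^ k)) (fI : I → Output n k d R) : State where
  mem
    | 0, [] => n
    | 1, [] => k
    | 2, [] => d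
    | 3, [] => R
    | 4, [] => P.invIters
    | 5, [] => P.sqrtIters
    | 6, [] => P.cInv.val
    | 7, [] => P.guess.val
    | 8, [] => P.half.val
    | 9, [] => P.invN.val
    | 10, [] => P.tau.val
    | 11, [p] => if ∃ h : p < n, (⟨p, h⟩ : Fin n) ∈ I then 1 else 0
    | 12, [p, r, t] =>
        if h : ((∃ h : p < n, (⟨p, h⟩ : Fin n) ∈ I) ∧ r < R ∧ t < d) then
          (xI ⟨⟨p, h.1.1⟩, h.1.2⟩ ⟨r, h.2.1⟩ ⟨t, h.2.2⟩).val else 0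
    | 13, [p, r, t] =>
        if h : ((∃ h : p < n, (⟨p, h⟩ : Fin n) ∈ I) ∧ r < R ∧ t < d) then
          ((fI ⟨⟨p, h.1.1⟩, h.1.2⟩).model ⟨r, h.2.1⟩ ⟨t, h.2.2⟩).val else 0
    | 14, [p, r, i, j] =>
        if h : ((∃ h : p < n, (⟨p, h⟩ : Fin n) ∈ I) ∧ r < R ∧ i < n ∧ j < n) then
          (if (fI ⟨⟨p, h.1.1⟩, h.1.2⟩).rejected ⟨r, h.2.1⟩ ⟨i, h.2.2.1⟩ ⟨j, h.2.2.2⟩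
            then 1 else 0) else 0
    | _, _ => 0
  out := []
  steps := 0

end SecureDL

end

noncomputable section

namespace SecureDL

/-! ## Couplings -/

/-! Correctness is an invariant: the shares of every intermediate result sum to the cleartext value.
Linear steps preserve it trivially, multiplications by Beaver's identity (`ensures_mulShares`),
comparisons by counting carries (`rabbit_identity`). This gives `protocol_correct`.

For privacy, fix a party `h` outside of the coalition. For every sharing in the execution the
simulator keeps the shares of all parties except `h` (`Holds`) and lets these parties run their own
code. Only two things are then out of its reach: sharings made from secrets that it does not know,
and the share of `h` in a value that is opened.

A fresh additive sharing of any value, restricted to the parties other than `h`, is uniform, so it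
can be drawn without the value (`bijective_complete`). When a value is opened, the share of `h`
equals the value minus the other shares, so it suffices to know the value. Values masked by a triple
or an edaBit are uniform and independent of the mask shares of the parties other than `h`, because
the mask share of `h` is never seen; they are drawn afresh (`bijective_mask`). The comparison bits
and the delivered models are, by correctness, part of the coalition's outputs (`ensures_rabbit`,
`sum_aggregated`). The control flow depends only on the comparison bits, so the simulator follows
the branches of the protocol. An empty coalition has no outputs to read them from, but its view is
empty as well.

Each of these replacements is a bijective change of uniform variables, and all moduli are powers of
two, so coin tosses produce exactly uniform residues. The argument is therefore organized as a
coupling of the real execution with the run of the simulator: `Sim` says that the visible messages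
and the output tape agree and that a relation between protocol results and memory holds. Such
statements compose by `Sim.bind`, and a coupling under which the outputs agree yields equality of
distributions (`Couple.map_eq`).

For the running time, loops are bounded by size parameters and stored results are reduced modulo `2
^ k` or `2`. This is the syntactic property `Program.Tame`, from which
`Program.Tame.exists_steps_le` derives a polynomial by induction on the program. Only the table of
powers of two needs a separate count (`exists_doubling_steps_le`). -/

/-- The two distributions have a coupling under which `R` holds almost surely. -/
def Couple {α β : Type} (p : PMF α) (q : PMF β) (R : α → β → Prop) : Prop :=
  ∃ μ : PMF (α × β), μ.map Prod.fst = p ∧ μ.map Prod.snd = q ∧ ∀ x ∈ μ.support, R x.1 x.2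

section Couple

variable {α β γ δ : Type}

/-- Independent sampling; it serves wherever no relation between the two sides is wanted. -/
theorem Couple.prod (p : PMF α) (q : PMF β) :
    Couple p q fun a b => a ∈ p.support ∧ b ∈ q.support := by
  refine ⟨p.bind fun a => q.map fun b => (a, b), ?_, ?_, ?_⟩
  · rw [PMF.map_bind]
    simp only [PMF.map_comp, Function.comp_def]
    simp [PMF.map, Function.comp_def]
  · rw [PMF.map_bind]
    simp only [PMF.map_comp, Function.comp_def]
    simp [PMF.map, Function.comp_def]
  · rintro ⟨a, b⟩ h
    simp only [PMF.mem_support_bind_iff, PMF.mem_support_map_iff, Prod.mk.injEq] at h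
    obtain ⟨a', ha, b', hb, rfl, rfl⟩ := h
    exact ⟨ha, hb⟩

/-- Properties of one marginal alone hold under every coupling. Correctness of the protocol and
frame conditions of programs enter in this way. -/
theorem Couple.mono_support {p : PMF α} {q : PMF β} {R R' : α → β → Prop} (h : Couple p q R)
    (hR : ∀ a b, a ∈ p.support → b ∈ q.support → R a b → R' a b) : Couple p q R' := by
  obtain ⟨μ, rfl, rfl, h⟩ := h
  refine ⟨μ, rfl, rfl, fun x hx => hR _ _ ?_ ?_ (h x hx)⟩
  · exact (PMF.mem_support_map_iff _ _ _).2 ⟨x, hx, rfl⟩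
  · exact (PMF.mem_support_map_iff _ _ _).2 ⟨x, hx, rfl⟩

theorem Couple.mono {p : PMF α} {q : PMF β} {R R' : α → β → Prop} (h : Couple p q R)
    (hR : ∀ a b, R a b → R' a b) : Couple p q R' :=
  h.mono_support fun a b _ _ => hR a b

theorem Couple.bind {p : PMF α} {q : PMF β} {R : α → β → Prop} {f : α → PMF γ} {g : β → PMF δ}
    {R' : γ → δ → Prop} (h : Couple p q R) (hfg : ∀ a b, R a b → Couple (f a) (g b) R') :
    Couple (p.bind f) (q.bind g) R' := by
  obtain ⟨μ, rfl, rfl, h⟩ := h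
  -- Couplings of the continuations are chosen for all pairs at once. Pairs that violate `R` have no
  -- mass and receive the independent coupling.
  have key : ∀ x : α × β, ∃ ν : PMF (γ × δ), ν.map Prod.fst = f x.1 ∧ ν.map Prod.snd = g x.2 ∧
      (R x.1 x.2 → ∀ y ∈ ν.support, R' y.1 y.2) := by
    intro x
    by_cases hx : R x.1 x.2
    · obtain ⟨ν, h1, h2, h3⟩ := hfg _ _ hx
      exact ⟨ν, h1, h2, fun _ => h3⟩
    · obtain ⟨ν, h1, h2, -⟩ := Couple.prod (f x.1) (g x.2)
      exact ⟨ν, h1, h2, fun h => absurd h hx⟩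
  choose ν h1 h2 h3 using key
  refine ⟨μ.bind ν, ?_, ?_, ?_⟩
  · rw [PMF.map_bind, PMF.bind_map]
    congr 1
    funext x
    exact h1 x
  · rw [PMF.map_bind, PMF.bind_map]
    congr 1
    funext x
    exact h2 x
  · intro y hy
    obtain ⟨x, hx, hy⟩ := (PMF.mem_support_bind_iff _ _ _).1 hy
    exact h3 x (h x hx) y hy

theorem Couple.pure_left {a : α} {q : PMF β} {R : α → β → Prop} (h : ∀ b ∈ q.support, R a b) :
    Couple (PMF.pure a) q R :=
  (Couple.prod _ _).mono fun a' b ⟨ha, hb⟩ => by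
    rw [(PMF.mem_support_pure_iff _ _).1 ha]
    exact h b hb

/-- The two images coincide on the support of the coupling, so they are one distribution. This turns
a simulation into equality of views. -/
theorem Couple.map_eq {p : PMF α} {q : PMF β} {R : α → β → Prop} (h : Couple p q R) {f : α → γ}
    {g : β → γ} (hfg : ∀ a b, R a b → f a = g b) : p.map f = q.map g := by
  obtain ⟨μ, rfl, rfl, h⟩ := h
  rw [PMF.map_comp, PMF.map_comp]
  simp only [PMF.map]
  -- `bindOnSupport` restricts the comparison to pairs of positive mass, where `R` is available.
  rw [← PMF.bindOnSupport_eq_bind, ← PMF.bindOnSupport_eq_bind]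
  have : ∀ x ∈ μ.support, (PMF.pure ((f ∘ Prod.fst) x)) = PMF.pure ((g ∘ Prod.snd) x) :=
    fun x hx => by simp [hfg _ _ (h x hx)]
  congr 1
  funext x hx
  exact this x hx

theorem uniform_map_bijective [Fintype α] [Nonempty α] [Fintype β] [Nonempty β] {φ : α → β}
    (hφ : φ.Bijective) : (PMF.uniformOfFintype α).map φ = PMF.uniformOfFintype β := by
  ext b
  obtain ⟨a, rfl⟩ := hφ.2 b
  rw [PMF.map_apply, tsum_eq_single a]
  · simp [Fintype.card_of_bijective hφ]
  · intro a' h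
    rw [if_neg]
    exact fun h' => h (hφ.1 h'.symm)

/-- A bijection preserves the uniform distribution, so a coupled sample can be pulled back along
`φ`. All masking arguments rest on this change of variables. -/
theorem Couple.uniform_bijective [Fintype α] [Nonempty α] {φ : α → α} (hφ : φ.Bijective)
    {q : PMF β} {R : α → β → Prop} (h : Couple (PMF.uniformOfFintype α) q R) :
    Couple (PMF.uniformOfFintype α) q fun a b => R (φ a) b := by
  obtain ⟨ψ, hψ, hψ'⟩ := Function.bijective_iff_has_inverse.1 hφ
  obtain ⟨μ, h1, h2, h3⟩ := h
  refine ⟨μ.map fun x => (ψ x.1, x.2), ?_, ?_, ?_⟩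
  · rw [PMF.map_comp]
    have : (Prod.fst ∘ fun x : α × β => (ψ x.1, x.2)) = ψ ∘ Prod.fst := rfl
    rw [this, ← PMF.map_comp, h1]
    exact uniform_map_bijective (Function.bijective_iff_has_inverse.2 ⟨φ, hψ', hψ⟩)
  · rw [PMF.map_comp]
    exact h2
  · intro y hy
    obtain ⟨x, hx, rfl⟩ := (PMF.mem_support_map_iff _ _ _).1 hy
    simpa [hψ' x.1] using h3 x hx

end Couple

/-! ## Runs of protocols -/

section Prot

variable {n : ℕ} {α β : Type}

theorem Prot.run_pure (a : α) (log : List (Event n)) :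
    (pure a : Prot n α).run log = PMF.pure (a, log) := rfl

theorem Prot.run_bind (m : Prot n α) (f : α → Prot n β) (log : List (Event n)) :
    (m >>= f).run log = (m.run log).bind fun x => (f x.1).run x.2 := rfl

theorem run_record (es : List (Event n)) (log : List (Event n)) :
    (record es).run log = PMF.pure ((), log ++ es) := rfl

theorem run_sample [Fintype α] [Nonempty α] (log : List (Event n)) :
    (sample α : Prot n α).run log = (PMF.uniformOfFintype α).bind fun a => PMF.pure (a, log) := rfl

/-- Every possible result of the computation satisfies `Q`. -/
def Ensures (m : Prot n α) (Q : α → Prop) : Prop :=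
  ∀ log, ∀ x ∈ (m.run log).support, Q x.1

theorem Ensures.pure {a : α} {Q : α → Prop} (h : Q a) : Ensures (pure a : Prot n α) Q := by
  intro log x hx
  rw [Prot.run_pure, PMF.mem_support_pure_iff] at hx
  rwa [hx]

theorem Ensures.bind {m : Prot n α} {f : α → Prot n β} {P : α → Prop} {Q : β → Prop}
    (hm : Ensures m P) (hf : ∀ a, P a → Ensures (f a) Q) : Ensures (m >>= f) Q := by
  intro log x hx
  rw [Prot.run_bind, PMF.mem_support_bind_iff] at hx
  obtain ⟨y, hy, hx⟩ := hx
  exact hf _ (hm _ _ hy) _ _ hx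

theorem Ensures.mono {m : Prot n α} {P Q : α → Prop} (hm : Ensures m P) (h : ∀ a, P a → Q a) :
    Ensures m Q :=
  fun log x hx => h _ (hm log x hx)

theorem Ensures.trivial (m : Prot n α) : Ensures m fun _ => True := fun _ _ _ => True.intro

theorem Ensures.forFin {m : ℕ} {f : Fin m → Prot n α} {Q : Fin m → α → Prop}
    (h : ∀ i, Ensures (f i) (Q i)) : Ensures (forFin f) fun as => ∀ i, Q i (as i) := by
  induction m with
  | zero => exact Ensures.pure fun i => i.elim0
  | succ m ih =>
    refine Ensures.bind (h 0) fun a ha => Ensures.bind (ih fun i => h i.succ) fun as has => ?_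
    exact Ensures.pure fun i => Fin.cases ha has i

end Prot

/-! ## Runs of programs -/

/-- Every possible final state of the program satisfies `Q`. -/
def Program.wp (c : Program) (s : State) (Q : State → Prop) : Prop :=
  ∀ s' ∈ (c.exec s).support, Q s'

@[simp] theorem State.mem_tick (s : State) (c : ℕ) : (s.tick c).mem = s.mem := rfl

@[simp] theorem State.out_tick (s : State) (c : ℕ) : (s.tick c).out = s.out := rfl

@[simp] theorem State.out_write (s : State) (a : ℕ) (l : List ℕ) (v : ℕ) :
    (s.write a l v).out = s.out := rfl

theorem State.mem_write (s : State) (a : ℕ) (l : List ℕ) (v : ℕ) (a' : ℕ) (l' : List ℕ) :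
    (s.write a l v).mem a' l' = if a' = a ∧ l' = l then v else s.mem a' l' := by
  by_cases ha : a' = a
  · subst ha
    by_cases hl : l' = l
    · subst hl
      simp [State.write]
    · simp [State.write, hl]
  · simp [State.write, ha]

theorem State.mem_write_of_ne (s : State) {a : ℕ} (l : List ℕ) (v : ℕ) {a' : ℕ} (h : a' ≠ a) :
    (s.write a l v).mem a' = s.mem a' := by
  simp [State.write, h]

theorem foldlM_succ {α : Type} (m : ℕ) (f : α → ℕ → PMF α) (a : α) :
    (List.range (m + 1)).foldlM f a = ((List.range m).foldlM f a).bind fun b => f b m := by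
  rw [List.range_succ, List.foldlM_append]
  change PMF.bind _ _ = _
  congr 1
  funext b
  simp

namespace Program

variable {s : State} {Q R : State → Prop} {c c₁ c₂ : Program}

theorem wp.mono (h : c.wp s R) (hQ : ∀ s', R s' → Q s') : c.wp s Q := fun s' hs' => hQ _ (h s' hs')

theorem wp_skip (h : Q (s.tick 1)) : skip.wp s Q := by
  intro s' hs'
  rw [(PMF.mem_support_pure_iff _ _).1 hs']
  exact h

theorem wp_set {a m : ℕ} {idx : Fin m → Expr} {v : Expr}
    (h : ∀ t, Q ((s.write a (List.ofFn fun i => (idx i).eval s) (v.eval s)).tick t)) :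
    (set a idx v).wp s Q := by
  intro s' hs'
  rw [(PMF.mem_support_pure_iff _ _).1 hs']
  exact h _

theorem wp_emit {v : Expr} (h : ∀ t, Q ({ s with out := s.out ++ [v.eval s] }.tick t)) :
    (emit v).wp s Q := by
  intro s' hs'
  rw [(PMF.mem_support_pure_iff _ _).1 hs']
  exact h _

theorem wp_seq (h : c₁.wp s fun s' => c₂.wp s' Q) : (seq c₁ c₂).wp s Q := by
  intro s' hs'
  obtain ⟨t, ht, hs'⟩ := (PMF.mem_support_bind_iff _ _ _).1 hs'
  exact h t ht s' hs'

theorem wp_ite {e : Expr} (h₁ : e.eval s ≠ 0 → ∀ t, c₁.wp (s.tick t) Q)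
    (h₂ : e.eval s = 0 → ∀ t, c₂.wp (s.tick t) Q) : (ite e c₁ c₂).wp s Q := by
  intro s' hs'
  rw [exec] at hs'
  split_ifs at hs' with h
  · exact h₁ h _ s' hs'
  · exact h₂ (not_not.1 h) _ s' hs'

/-- Unlike `wp_loop`, this rule keeps the exact tick of every round; it is needed where steps are
counted by hand. -/
theorem wp_loop_steps {a : ℕ} {b : Expr} (J : ℕ → State → Prop) (h₀ : J 0 (s.tick (1 + b.cost s)))
    (hJ : ∀ i < b.eval s, ∀ s', J i s' →
      c.wp ((s'.write a [] i).tick (1 + i.size)) (J (i + 1)))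
    (hQ : ∀ s', J (b.eval s) s' → Q s') : (loop a b c).wp s Q := by
  have key : ∀ m ≤ b.eval s, ∀ s' ∈ ((List.range m).foldlM
      (fun s' t => c.exec ((s'.write a [] t).tick (1 + t.size)))
      (s.tick (1 + b.cost s)) : PMF State).support, J m s' := by
    intro m
    induction m with
    | zero =>
      intro _ s' hs'
      rw [(PMF.mem_support_pure_iff _ _).1 hs']
      exact h₀
    | succ m ih =>
      intro hm s' hs'
      rw [foldlM_succ] at hs'
      obtain ⟨t, ht, hs'⟩ := (PMF.mem_support_bind_iff _ _ _).1 hs'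
      exact hJ m hm t (ih (by omega) t ht) s' hs'
  exact fun s' hs' => hQ s' (key _ le_rfl s' hs')

theorem wp_loop {a : ℕ} {b : Expr} (J : ℕ → State → Prop) (h₀ : ∀ t, J 0 (s.tick t))
    (hJ : ∀ i < b.eval s, ∀ s', J i s' → ∀ t, c.wp ((s'.write a [] i).tick t) (J (i + 1)))
    (hQ : ∀ s', J (b.eval s) s' → Q s') : (loop a b c).wp s Q :=
  wp_loop_steps J (h₀ _) (fun i hi s' h => hJ i hi s' h _) hQ

end Program

/-! ## Correctness of the subprotocols -/

section Correctness

variable {n q k d : ℕ}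

@[simp] theorem sum_complete [NeZero q] (i : Fin n) (x : ZMod q) (u : Sharing n q) :
    ∑ j, complete i x u j = x := by
  rw [complete, Finset.sum_update_of_mem (Finset.mem_univ i), Finset.sdiff_singleton_eq_erase]
  ring

theorem ensures_reveal [NeZero q] (s : Sharing n q) :
    Ensures (reveal s) fun v => v = ∑ i, s i :=
  (Ensures.trivial _).bind fun _ _ => Ensures.pure rfl

/-- The sharing that is opened to client `i`. -/
def aggregated (P : Params k) (w : Fin n → Fin d → Sharing n (2 ^ k)) (i : Fin n)
    (res : Fin n → Bool × (Fin d → Sharing n (2 ^ k))) (t : Fin d) : Sharing n (2 ^ k) :=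
  P.invN • ((∑ j ∈ Finset.univ.erase i, (res j).2 t) + w i t)

/-- Aggregation is linear, so it commutes with summing the shares. This identifies the value opened
to client `i` with its prescribed output, which lets the simulator know it. -/
theorem sum_aggregated (P : Params k) (w : Fin n → Fin d → Sharing n (2 ^ k)) (i : Fin n)
    (x : Fin n → Fin d → ZMod (2 ^ k)) (hw : ∀ j t, ∑ p, w j t p = x j t)
    (res : Fin n → Bool × (Fin d → Sharing n (2 ^ k)))
    (hres : ∀ j, (res j).1 = rejectedClear P x i j ∧ (j ≠ i → ∀ t, ∑ p, (res j).2 t p =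
      if rejectedClear P x i j then 0 else normalizeClear P (x j) (x i) t)) (t : Fin d) :
    ∑ p, aggregated P w i res t p = modelClear P x i t := by
  simp only [aggregated, Pi.smul_apply, smul_eq_mul, Pi.add_apply, Finset.sum_apply]
  rw [← Finset.mul_sum, Finset.sum_add_distrib, hw, Finset.sum_comm, modelClear]
  congr 2
  exact Finset.sum_congr rfl fun j hj => (hres j).2 (Finset.ne_of_mem_erase hj) t

variable [NeZero n]

@[simp] theorem sum_pub (c : ZMod q) : ∑ j, (pub c : Sharing n q) j = c := by
  simp [pub]

/-- Beaver's identity `ab + εa + δb + εδ = (a + δ)(b + ε)`. The last term is added by party `0`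
alone, so it is counted once. -/
theorem ensures_mulShares [NeZero q] (x y : Sharing n q) :
    Ensures (mulShares x y) fun z => ∑ i, z i = (∑ i, x i) * ∑ i, y i := by
  refine (Ensures.trivial _).bind fun a _ => (Ensures.trivial _).bind fun b _ =>
    (Ensures.trivial _).bind fun u _ => (Ensures.trivial _).bind fun _ _ =>
    (Ensures.trivial _).bind fun _ _ => (Ensures.trivial _).bind fun _ _ => ?_
  refine (ensures_reveal _).bind fun δ hδ => (ensures_reveal _).bind fun ε hε => Ensures.pure ?_
  simp only [Pi.sub_apply, Finset.sum_sub_distrib] at hδ hε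
  rw [Finset.sum_add_distrib, Finset.sum_add_distrib, Finset.sum_add_distrib, ← Finset.mul_sum,
    ← Finset.mul_sum, sum_complete, Finset.sum_ite_eq', if_pos (Finset.mem_univ _), hδ, hε]
  ring

theorem ensures_invLoop (t : ℕ) (B M : Sharing n (2 ^ k)) :
    Ensures (invLoop t B M) fun z => ∑ i, z i = invLoopClear t (∑ i, B i) (∑ i, M i) := by
  induction t generalizing B M with
  | zero => exact Ensures.pure rfl
  | succ t ih =>
    refine (ensures_mulShares _ _).bind fun x hx => (ensures_mulShares _ _).bind fun y hy =>
      (ih _ _).mono fun z hz => ?_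
    rw [hz, invLoopClear]
    congr 1
    · simp [Finset.sum_sub_distrib, hx, ← Finset.mul_sum]
    · simp [Finset.sum_sub_distrib, hy, ← Finset.mul_sum]

theorem ensures_invShares (P : Params k) (X : Sharing n (2 ^ k)) :
    Ensures (invShares P X) fun z => ∑ i, z i = invClear P (∑ i, X i) :=
  (ensures_invLoop _ _ _).mono fun z hz => by
    rw [hz, invClear]
    simp [← Finset.mul_sum]

theorem ensures_sqrtLoop (P : Params k) (Y : Sharing n (2 ^ k)) (t : ℕ) (x : Sharing n (2 ^ k)) :
    Ensures (sqrtLoop P Y t x) fun z => ∑ i, z i = sqrtLoopClear P (∑ i, Y i) t (∑ i, x i) := by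
  induction t generalizing x with
  | zero => exact Ensures.pure rfl
  | succ t ih =>
    refine (ensures_invShares _ _).bind fun z hz => (ensures_mulShares _ _).bind fun y hy =>
      (ih _).mono fun w hw => ?_
    rw [hw, sqrtLoopClear]
    congr 1
    simp [← Finset.mul_sum, Finset.sum_add_distrib, hy, hz]

theorem ensures_dotShares (v w : Fin d → Sharing n (2 ^ k)) :
    Ensures (dotShares v w) fun z => ∑ i, z i = ∑ t, (∑ i, v t i) * ∑ i, w t i := by
  refine (Ensures.forFin fun t => ensures_mulShares _ _).bind fun z hz => Ensures.pure ?_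
  simp only [Finset.sum_apply]
  rw [Finset.sum_comm]
  exact Finset.sum_congr rfl fun t _ => hz t

theorem ensures_normShares (P : Params k) (v : Fin d → Sharing n (2 ^ k)) :
    Ensures (normShares P v) fun z => ∑ i, z i = normClear P fun t => ∑ i, v t i :=
  (ensures_dotShares _ _).bind fun s hs => (ensures_sqrtLoop _ _ _ _).mono fun z hz => by
    rw [hz, hs, sum_pub, normClear]

theorem ensures_cosineShares (P : Params k) (v w : Fin d → Sharing n (2 ^ k)) :
    Ensures (cosineShares P v w) fun z =>
      ∑ i, z i = cosineClear P (fun t => ∑ i, v t i) fun t => ∑ i, w t i :=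
  (ensures_dotShares _ _).bind fun _ h₁ => (ensures_normShares _ _).bind fun _ h₂ =>
    (ensures_normShares _ _).bind fun _ h₃ => (ensures_mulShares _ _).bind fun _ h₄ =>
    (ensures_invShares _ _).bind fun _ h₅ => (ensures_mulShares _ _).mono fun z hz => by
      rw [hz, h₁, h₅, h₄, h₂, h₃, cosineClear]

theorem ensures_normalizeShares (P : Params k) (v w : Fin d → Sharing n (2 ^ k)) :
    Ensures (normalizeShares P v w) fun z =>
      ∀ t, ∑ i, z t i = normalizeClear P (fun t => ∑ i, v t i) (fun t => ∑ i, w t i) t :=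
  (ensures_normShares _ _).bind fun _ h₁ => (ensures_normShares _ _).bind fun _ h₂ =>
    (ensures_invShares _ _).bind fun _ h₃ => (ensures_mulShares _ _).bind fun _ h₄ =>
    Ensures.forFin (Q := fun t z => ∑ i, z i =
      normalizeClear P (fun t => ∑ i, v t i) (fun t => ∑ i, w t i) t) fun t =>
      (ensures_mulShares _ _).mono fun z hz => by
        rw [hz, h₄, h₃, h₂, h₁, normalizeClear]

/-- Lexicographic comparison from the most significant bit. -/
theorem mod_two_pow_succ_lt_iff (a r m : ℕ) :
    a % 2 ^ (m + 1) < r % 2 ^ (m + 1) ↔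
      if a.testBit m then r.testBit m = true ∧ a % 2 ^ m < r % 2 ^ m
      else r.testBit m = true ∨ a % 2 ^ m < r % 2 ^ m := by
  have hs : ∀ b, b % 2 ^ (m + 1) = 2 ^ m * (b.testBit m).toNat + b % 2 ^ m := fun b => by
    rw [Nat.mod_pow_succ, Nat.toNat_testBit, add_comm]
  have ha := hs a
  have hr := hs r
  have ha' := Nat.mod_lt a (Nat.two_pow_pos m)
  have hr' := Nat.mod_lt r (Nat.two_pow_pos m)
  rw [ha, hr]
  cases a.testBit m <;> cases r.testBit m <;> simp <;> omega

/-- The recursion evaluates `mod_two_pow_succ_lt_iff` modulo 2. A top bit `1` of `a` calls for a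
conjunction, which is the product `t`; a top bit `0` calls for a disjunction, which is the sum of
`t` and its two factors. -/
theorem ensures_ltBits (a r m : ℕ) (bits : Fin m → Sharing n 2)
    (h : ∀ i, ∑ j, bits i j = if r.testBit i then 1 else 0) :
    Ensures (ltBits a m bits) fun z =>
      ∑ j, z j = if a % 2 ^ m < r % 2 ^ m then 1 else 0 := by
  induction m with
  | zero => exact Ensures.pure (by simp [Nat.mod_one])
  | succ m ih =>
    refine (ih _ fun i => h i.castSucc).bind fun l hl => (ensures_mulShares _ _).bind fun t ht =>
      Ensures.pure ?_
    have hm := h (Fin.last m)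
    rw [Fin.val_last] at hm
    have hlt := mod_two_pow_succ_lt_iff a r m
    simp only [hlt]
    have h2 : (1 : ZMod 2) + 1 = 0 := rfl
    by_cases hb : a.testBit m
    · simp only [hb, if_true, ht, hl, hm]
      by_cases h3 : r.testBit m <;> by_cases h4 : a % 2 ^ m < r % 2 ^ m <;> simp [h3, h4]
    · simp only [if_neg hb, Pi.add_apply, Finset.sum_add_distrib, ht, hl, hm]
      by_cases h3 : r.testBit m <;> by_cases h4 : a % 2 ^ m < r % 2 ^ m <;> simp [h3, h4, h2]

theorem ensures_edaBits :
    Ensures (edaBits n k) fun rb => ∀ m, ∑ j, rb.2 m j = if (∑ i, rb.1 i).val.testBit m then 1 else 0 :=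
  (Ensures.trivial _).bind fun _ _ => (Ensures.trivial _).bind fun _ _ =>
    (Ensures.trivial _).bind fun _ _ => (Ensures.trivial _).bind fun _ _ =>
    Ensures.pure fun _ => sum_complete _ _ _

/-- Wrapping around subtracts `M > x.val`, and this is the only way in which the sum can drop below
`r.val`. -/
theorem val_add_lt_iff {M : ℕ} [NeZero M] (x r : ZMod M) :
    (x + r).val < r.val ↔ M ≤ x.val + r.val := by
  have h1 := x.val_lt
  have h2 := r.val_lt
  rw [ZMod.val_add]
  constructor
  · intro h
    by_contra! h'
    rw [Nat.mod_eq_of_lt h'] at h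
    omega
  · intro h
    rw [Nat.mod_eq_sub_mod h, Nat.mod_eq_of_lt (by omega)]
    omega

/-- Rabbit's identity for the comparison of `x` and `c` with mask `r`, modulo 2. -/
theorem rabbit_identity {M : ℕ} [NeZero M] (x c r : ZMod M) :
    (if (x + r).val < r.val then 1 else 0) + (if (x + r - c).val < r.val then 1 else 0) +
      (1 + if (x + r - c).val < M - c.val then 1 else 0) =
      (if x.val < c.val then 1 else 0 : ZMod 2) := by
  -- With `x = y + c` every comparison asks for a carry in the sum of `y`, `c` and `r`, the last one
  -- on the left for the absence of a carry. The number of carries does not depend on the order of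
  -- the additions, which is the identity; signs play no role modulo 2.
  obtain ⟨y, rfl⟩ : ∃ y, x = y + c := ⟨x - c, by ring⟩
  have e : y + c + r - c = y + r := by ring
  rw [e]
  simp only [val_add_lt_iff]
  have h1 := y.val_lt
  have h2 := r.val_lt
  have h3 := c.val_lt
  have h4 := (y + c).val_lt
  have h5 := (y + r).val_lt
  have h6 : (y + c).val = if y.val + c.val < M then y.val + c.val else y.val + c.val - M := by
    rw [ZMod.val_add]
    split_ifs with h
    · exact Nat.mod_eq_of_lt h
    · rw [Nat.mod_eq_sub_mod (by omega), Nat.mod_eq_of_lt (by omega)]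
  have h7 : (y + r).val = if y.val + r.val < M then y.val + r.val else y.val + r.val - M := by
    rw [ZMod.val_add]
    split_ifs with h
    · exact Nat.mod_eq_of_lt h
    · rw [Nat.mod_eq_sub_mod (by omega), Nat.mod_eq_of_lt (by omega)]
  have e2 : (1 : ZMod 2) + 1 = 0 := rfl
  split_ifs at h6 h7 <;> split_ifs <;> first | omega | simp [e2]

theorem ensures_rabbit (x : Sharing n (2 ^ k)) (c : ZMod (2 ^ k)) :
    Ensures (rabbit x c) fun b => b = decide ((∑ i, x i).val < c.val) := by
  refine ensures_edaBits.bind fun ⟨r, bits⟩ hb => (ensures_reveal _).bind fun a ha =>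
    (ensures_ltBits _ _ _ _ hb).bind fun w₁ h₁ => (ensures_ltBits _ _ _ _ hb).bind fun w₂ h₂ =>
    (ensures_reveal _).bind fun w hw => Ensures.pure ?_
  simp only [Pi.add_apply, Finset.sum_add_distrib, sum_pub] at ha hw
  simp only [Nat.mod_eq_of_lt (ZMod.val_lt _)] at h₁ h₂
  rw [h₁, h₂, ha, rabbit_identity] at hw
  rw [hw]
  split_ifs with h <;> simp [h]

theorem ensures_compareShares (x : Sharing n (2 ^ k)) (τ : ZMod (2 ^ k)) :
    Ensures (compareShares x τ) fun b => b = signedLT (∑ i, x i) τ :=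
  (ensures_rabbit _ _).mono fun b hb => by
    rw [hb, signedLT]
    simp [Finset.sum_add_distrib]

/-- What client `j` contributes to the aggregated model of client `i`. -/
def contribution (P : Params k) (w : Fin n → Fin d → Sharing n (2 ^ k)) (i j : Fin n) :
    Prot n (Bool × (Fin d → Sharing n (2 ^ k))) :=
  if j = i then pure (false, 0)
  else do
    let cosine ← cosineShares P (w i) (w j)
    let rej ← compareShares cosine P.tau
    if rej then pure (true, 0)
    else do
      let v ← normalizeShares P (w j) (w i)
      pure (false, v)

theorem ensures_contribution (P : Params k) (w : Fin n → Fin d → Sharing n (2 ^ k)) (i j : Fin n)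
    (x : Fin n → Fin d → ZMod (2 ^ k)) (hw : ∀ j t, ∑ p, w j t p = x j t) :
    Ensures (contribution P w i j) fun r => r.1 = rejectedClear P x i j ∧
      (j ≠ i → ∀ t, ∑ p, r.2 t p = if rejectedClear P x i j then 0
        else normalizeClear P (x j) (x i) t) := by
  have hx : ∀ j, (fun t => ∑ p, w j t p) = x j := fun j => funext (hw j)
  rw [contribution]
  by_cases hj : j = i
  · rw [if_pos hj]
    exact Ensures.pure ⟨by simp [rejectedClear, hj], fun h => absurd hj h⟩
  · rw [if_neg hj]
    refine (ensures_cosineShares _ _ _).bind fun c hc => (ensures_compareShares _ _).bind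
      fun b hb => ?_
    rw [hc, hx, hx] at hb
    have hb' : b = rejectedClear P x i j := by rw [hb, rejectedClear, if_neg hj]
    by_cases h : b = true
    · rw [if_pos h]
      exact Ensures.pure ⟨by rw [← hb', h], fun _ t => by rw [← hb', h]; simp⟩
    · rw [if_neg h]
      refine (ensures_normalizeShares _ _ _).bind fun v hv => Ensures.pure ⟨?_, fun _ t => ?_⟩
      · rw [← hb']
        simpa using h
      · rw [← hb', if_neg h, hv, hx, hx]

theorem ensures_aggregate (P : Params k) (w : Fin n → Fin d → Sharing n (2 ^ k)) (i : Fin n)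
    (x : Fin n → Fin d → ZMod (2 ^ k)) (hw : ∀ j t, ∑ p, w j t p = x j t) :
    Ensures (aggregate P w i) fun o => o = (modelClear P x i, rejectedClear P x i) := by
  refine Ensures.bind (m := forFin (contribution P w i))
    (Ensures.forFin fun j => ensures_contribution P w i j x hw) fun res hres => ?_
  refine Ensures.bind (m := forFin fun t => revealTo i (aggregated P w i res t))
    (Ensures.forFin (Q := fun t v => v = modelClear P x i t) fun t => ?_) fun model hmodel => ?_
  · refine Ensures.bind (Ensures.trivial (record _)) fun _ _ => Ensures.pure ?_
    exact sum_aggregated P w i x hw res hres t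
  · exact Ensures.pure (Prod.ext (funext hmodel) (funext fun j => (hres j).1))

theorem ensures_iteration (P : Params k) (x : Fin n → Fin d → ZMod (2 ^ k)) :
    Ensures (iteration P x) fun o => ∀ i, o i = (modelClear P x i, rejectedClear P x i) := by
  refine Ensures.bind (Ensures.forFin fun i => Ensures.forFin (Q := fun t s =>
    ∑ p, s p = x i t) fun t => ?_) fun w hw => Ensures.forFin fun i => ensures_aggregate P w i x hw
  exact (Ensures.trivial _).bind fun u _ => (Ensures.trivial _).bind fun _ _ =>
    Ensures.pure (sum_complete _ _ _)

theorem protocol_correct {R : ℕ} (P : Params k) (x : Fin n → Fin R → Fin d → ZMod (2 ^ k)) :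
    ∀ o ∈ (protocol P x).support, o.1 = functionality P x := by
  unfold protocol
  refine Ensures.bind (Q := fun o => o = functionality P x) (m := forFin fun r => iteration P fun i => x i r)
    (Ensures.forFin fun r => ensures_iteration P fun i => x i r) (fun res hres => ?_) []
  refine Ensures.pure (funext fun p => ?_)
  ext1
  · funext r
    exact congrArg Prod.fst (hres r p)
  · funext r i
    exact congrArg Prod.snd (hres r i)

end Correctness

/-! ## Programs of polynomial cost -/

/-- The memory holds numbers of at most `N + 2` digits, the size parameters are at most `N`, and
the modulus in array `15` is not `0`. -/
structure Bounded (N : ℕ) (s : State) : Prop where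
  pos : 1 ≤ N
  size : ∀ a l, (s.mem a l).size ≤ N + 2
  param : ∀ a < 6, s.mem a [] ≤ N
  modulus : s.mem 15 [] ≠ 0

/-- An expression whose value may be stored. -/
def Expr.Small (e : Expr) : Prop := ∀ N s, Bounded N s → (e.eval s).size ≤ N + 2

/-- An expression whose value may bound a loop. -/
def Expr.Short (e : Expr) : Prop := ∀ N s, Bounded N s → e.eval s ≤ N

/-- The program writes to the arrays `lo, …, hi - 1` only, and stores small values only. -/
def Program.Tame (lo hi : ℕ) : Program → Prop
  | .skip => True
  | .set a _ v => (lo ≤ a ∧ a < hi) ∧ v.Small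
  | .draw a _ b => (lo ≤ a ∧ a < hi) ∧ b.Short
  | .emit _ => True
  | .seq c₁ c₂ => c₁.Tame lo hi ∧ c₂.Tame lo hi
  | .ite _ c₁ c₂ => c₁.Tame lo hi ∧ c₂.Tame lo hi
  | .loop a b c => ((lo ≤ a ∧ a < hi) ∧ b.Short) ∧ c.Tame lo hi

theorem foldlM_invariant {α : Type} {f : α → ℕ → PMF α} {J : α → Prop}
    (hf : ∀ a i, J a → ∀ b ∈ (f a i).support, J b) (l : List ℕ) {a : α} (ha : J a) :
    ∀ b ∈ (l.foldlM f a : PMF α).support, J b := by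
  induction l generalizing a with
  | nil =>
    intro b hb
    rwa [(PMF.mem_support_pure_iff _ _).1 hb]
  | cons i l ih =>
    intro b hb
    rw [List.foldlM_cons] at hb
    obtain ⟨c, hc, hb⟩ := (PMF.mem_support_bind_iff _ _ _).1 hb
    exact ih (hf _ _ ha _ hc) b hb

/-- A tame program changes no other arrays. -/
theorem Program.Tame.frame {lo hi : ℕ} {c : Program} (hc : c.Tame lo hi) (s : State) :
    c.wp s fun s' => ∀ a, a < lo ∨ hi ≤ a → s'.mem a = s.mem a := by
  induction c generalizing s with
  | skip => exact wp_skip fun _ _ => rfl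
  | set a idx v => exact wp_set fun _ b hb => State.mem_write_of_ne _ _ _ (by have := hc.1; omega)
  | draw a idx b =>
    intro s' hs' b hb
    obtain ⟨v, -, hv⟩ := (PMF.mem_support_bind_iff _ _ _).1 hs'
    rw [(PMF.mem_support_pure_iff _ _).1 hv]
    exact State.mem_write_of_ne _ _ _ (by have := hc.1; omega)
  | emit v => exact wp_emit fun _ _ _ => rfl
  | seq c₁ c₂ ih₁ ih₂ =>
    exact wp_seq ((ih₁ hc.1 s).mono fun s₁ h₁ => (ih₂ hc.2 s₁).mono fun s₂ h₂ a ha =>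
      (h₂ a ha).trans (h₁ a ha))
  | ite e c₁ c₂ ih₁ ih₂ => exact wp_ite (fun _ _ => ih₁ hc.1 _) fun _ _ => ih₂ hc.2 _
  | loop a b c ih =>
    refine foldlM_invariant (J := fun s' : State => ∀ a, a < lo ∨ hi ≤ a → s'.mem a = s.mem a)
      (fun s₁ i h₁ s₂ hs₂ a' ha' => ?_) _ (fun _ _ => rfl)
    rw [ih hc.2 _ _ hs₂ a' ha', State.mem_tick,
      State.mem_write_of_ne _ _ _ (by have := hc.1.1; omega), h₁ a' ha']

theorem size_lt_of_lt {a b : ℕ} (h : a < 2 ^ b) : a.size ≤ b := Nat.size_le.2 h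

theorem size_le_self (a : ℕ) : a.size ≤ a := Nat.size_le.2 a.lt_two_pow_self

theorem Op.size_eval_le (o : Op) (a b : ℕ) : (o.eval a b).size ≤ a.size + b.size + 1 := by
  have ha := a.lt_size_self
  have hb := b.lt_size_self
  have h1 : 1 ≤ 2 ^ a.size := Nat.one_le_two_pow
  have h2 : 1 ≤ 2 ^ b.size := Nat.one_le_two_pow
  have hab : 2 ^ a.size ≤ 2 ^ a.size * 2 ^ b.size := Nat.le_mul_of_pos_right _ h2
  have hba : 2 ^ b.size ≤ 2 ^ a.size * 2 ^ b.size := Nat.le_mul_of_pos_left _ h1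
  refine Nat.size_le.2 ?_
  rw [pow_succ, pow_add]
  cases o with
  | add => simp only [eval]; omega
  | sub => simp only [eval]; omega
  | mul =>
    simp only [eval]
    have := Nat.mul_lt_mul'' ha hb
    omega
  | div =>
    simp only [eval]
    have := Nat.div_le_self a b
    omega
  | mod =>
    simp only [eval]
    have := Nat.mod_le a b
    omega
  | lt =>
    simp only [eval]
    split_ifs <;> omega

/-- Intermediate values are not reduced, but each operation at most adds up sizes
(`Op.size_eval_le`). The expression is a fixed tree, so `C` does not depend on the state. -/
theorem Expr.exists_cost_le (e : Expr) :
    ∃ C, ∀ N s, Bounded N s → e.cost s ≤ C * (N + 2) ∧ (e.eval s).size ≤ C * (N + 2) := by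
  induction e with
  | lit c =>
    refine ⟨1 + c.size, fun N s _ => ?_⟩
    simp only [cost, eval]
    constructor <;> nlinarith
  | get a idx ih =>
    choose C hC using ih
    refine ⟨2 + ∑ i, C i, fun N s hs => ?_⟩
    simp only [cost, eval]
    have h1 := hs.size a (List.ofFn fun i => (idx i).eval s)
    have h2 : ∑ i, (idx i).cost s ≤ (∑ i, C i) * (N + 2) := by
      rw [Finset.sum_mul]
      exact Finset.sum_le_sum fun i _ => (hC i N s hs).1
    constructor <;> rw [add_mul] <;> omega
  | op o e₁ e₂ ih₁ ih₂ =>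
    obtain ⟨C₁, h₁⟩ := ih₁
    obtain ⟨C₂, h₂⟩ := ih₂
    refine ⟨2 * (C₁ + C₂) + 2, fun N s hs => ?_⟩
    simp only [cost, eval]
    have := o.size_eval_le (e₁.eval s) (e₂.eval s)
    have := h₁ N s hs
    have := h₂ N s hs
    constructor <;> nlinarith

theorem exists_cost_le_of_index {m : ℕ} (idx : Fin m → Expr) :
    ∃ C, ∀ N s, Bounded N s → ∑ i, (idx i).cost s ≤ C * (N + 2) := by
  choose C hC using fun i => (idx i).exists_cost_le
  refine ⟨∑ i, C i, fun N s hs => ?_⟩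
  rw [Finset.sum_mul]
  exact Finset.sum_le_sum fun i _ => (hC i N s hs).1

theorem Bounded.tick {N : ℕ} {s : State} (h : Bounded N s) (t : ℕ) : Bounded N (s.tick t) :=
  ⟨h.1, h.2, h.3, h.4⟩

/-- The size parameters lie in the arrays below `6` and the modulus in array `15`, so writes from
`16` on touch neither. -/
theorem Bounded.write {N : ℕ} {s : State} (h : Bounded N s) {a : ℕ} (ha : 16 ≤ a) (l : List ℕ)
    {v : ℕ} (hv : v.size ≤ N + 2) : Bounded N (s.write a l v) := by
  refine ⟨h.1, fun a' l' => ?_, fun a' h' => ?_, ?_⟩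
  · rw [State.mem_write]
    split_ifs
    · exact hv
    · exact h.size _ _
  · rw [State.mem_write_of_ne _ _ _ (by omega)]
    exact h.param a' h'
  · rw [State.mem_write_of_ne _ _ _ (by omega)]
    exact h.modulus

theorem randomBits_eq (b : ℕ) :
    randomBits b = (PMF.uniformOfFintype (Fin (2 ^ b))).map Fin.val :=
  -- Unfolded, the left side is the image of the right side under the identity.
  PMF.map_id _

/-- A tame program runs in polynomial time. -/
theorem Program.Tame.exists_steps_le {lo hi : ℕ} (hlo : 16 ≤ lo) {c : Program}
    (hc : c.Tame lo hi) : ∃ T : Polynomial ℕ, ∀ N s, Bounded N s →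
      c.wp s fun s' => Bounded N s' ∧ s'.steps ≤ s.steps + T.eval N := by
  induction c with
  | skip => exact ⟨1, fun N s hs => wp_skip ⟨hs.tick _, by simp [State.tick]⟩⟩
  | set a idx v =>
    obtain ⟨C₁, h₁⟩ := exists_cost_le_of_index idx
    obtain ⟨C₂, h₂⟩ := v.exists_cost_le
    refine ⟨1 + (Polynomial.C (C₁ + C₂)) * (Polynomial.X + 2), fun N s hs s' hs' => ?_⟩
    rw [(PMF.mem_support_pure_iff _ _).1 hs']
    refine ⟨(hs.write (by have := hc.1; omega) _ (hc.2 N s hs)).tick _, ?_⟩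
    have := h₁ N s hs
    have := (h₂ N s hs).1
    simp only [State.tick, State.write, Polynomial.eval_add, Polynomial.eval_mul,
      Polynomial.eval_C, Polynomial.eval_X, Polynomial.eval_one, Polynomial.eval_ofNat]
    linarith
  | draw a idx b =>
    obtain ⟨C₁, h₁⟩ := exists_cost_le_of_index idx
    obtain ⟨C₂, h₂⟩ := b.exists_cost_le
    -- The last summand pays for the coins, at most `N` of them because `b` is `Short`.
    refine ⟨1 + (Polynomial.C (C₁ + C₂)) * (Polynomial.X + 2) + Polynomial.X,
      fun N s hs s' hs' => ?_⟩
    obtain ⟨v, hv, hs'⟩ := (PMF.mem_support_bind_iff _ _ _).1 hs'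
    rw [randomBits_eq] at hv
    obtain ⟨w, -, rfl⟩ := (PMF.mem_support_map_iff _ _ _).1 hv
    rw [(PMF.mem_support_pure_iff _ _).1 hs']
    have hb := hc.2 N s hs
    refine ⟨(hs.write (by have := hc.1; omega) _ ?_).tick _, ?_⟩
    · have := size_lt_of_lt w.2
      omega
    · have := h₁ N s hs
      have := (h₂ N s hs).1
      simp only [State.tick, State.write, Polynomial.eval_add, Polynomial.eval_mul,
        Polynomial.eval_C, Polynomial.eval_X, Polynomial.eval_one, Polynomial.eval_ofNat]
      linarith
  | emit v =>
    obtain ⟨C, h⟩ := v.exists_cost_le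
    refine ⟨1 + Polynomial.C C * (Polynomial.X + 2), fun N s hs s' hs' => ?_⟩
    rw [(PMF.mem_support_pure_iff _ _).1 hs']
    refine ⟨⟨hs.1, hs.2, hs.3, hs.4⟩, ?_⟩
    have := (h N s hs).1
    simp only [State.tick, Polynomial.eval_add, Polynomial.eval_mul,
      Polynomial.eval_C, Polynomial.eval_X, Polynomial.eval_one, Polynomial.eval_ofNat]
    linarith
  | seq c₁ c₂ ih₁ ih₂ =>
    obtain ⟨T₁, h₁⟩ := ih₁ hc.1
    obtain ⟨T₂, h₂⟩ := ih₂ hc.2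
    refine ⟨T₁ + T₂, fun N s hs => wp_seq ((h₁ N s hs).mono fun s₁ ⟨hs₁, e₁⟩ =>
      (h₂ N s₁ hs₁).mono fun s₂ ⟨hs₂, e₂⟩ => ⟨hs₂, ?_⟩)⟩
    rw [Polynomial.eval_add]
    omega
  | ite e c₁ c₂ ih₁ ih₂ =>
    obtain ⟨T₁, h₁⟩ := ih₁ hc.1
    obtain ⟨T₂, h₂⟩ := ih₂ hc.2
    obtain ⟨C, h⟩ := e.exists_cost_le
    refine ⟨1 + Polynomial.C C * (Polynomial.X + 2) + T₁ + T₂, fun N s hs s' hs' => ?_⟩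
    have := (h N s hs).1
    simp only [Polynomial.eval_add, Polynomial.eval_mul,
      Polynomial.eval_C, Polynomial.eval_X, Polynomial.eval_one, Polynomial.eval_ofNat]
    rw [exec] at hs'
    split_ifs at hs'
    · obtain ⟨h3, h4⟩ := h₁ N _ (hs.tick _) s' hs'
      refine ⟨h3, h4.trans ?_⟩
      simp only [State.tick]
      linarith
    · obtain ⟨h3, h4⟩ := h₂ N _ (hs.tick _) s' hs'
      refine ⟨h3, h4.trans ?_⟩
      simp only [State.tick]
      linarith
  | loop a b c ih =>
    obtain ⟨T, h⟩ := ih hc.2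
    obtain ⟨C, hC⟩ := b.exists_cost_le
    -- Each of the at most `N` rounds costs a tick `1 + i.size ≤ 1 + N` and the body. `Bounded`
    -- holds with the same `N` all along, so bounds are added and multiplied but never composed.
    refine ⟨1 + Polynomial.C C * (Polynomial.X + 2) + Polynomial.X * (1 + Polynomial.X + T),
      fun N s hs => ?_⟩
    have hb := hc.1.2 N s hs
    have key : ∀ m ≤ N, ∀ s' ∈ ((List.range m).foldlM
        (fun s' t => c.exec ((s'.write a [] t).tick (1 + t.size)))
        (s.tick (1 + b.cost s)) : PMF State).support,
        Bounded N s' ∧ s'.steps ≤ s.steps + (1 + b.cost s) + m * (1 + N + T.eval N) := by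
      intro m
      induction m with
      | zero =>
        intro _ s' hs'
        rw [(PMF.mem_support_pure_iff _ _).1 hs']
        exact ⟨hs.tick _, by simp [State.tick]⟩
      | succ m ih =>
        intro hm s' hs'
        rw [foldlM_succ] at hs'
        obtain ⟨s₁, h₁, hs'⟩ := (PMF.mem_support_bind_iff _ _ _).1 hs'
        obtain ⟨h3, h4⟩ := ih (by omega) s₁ h₁
        have hms := size_le_self m
        obtain ⟨h5, h6⟩ := h N _ ((h3.write (by have := hc.1.1; omega) _
          (by omega : m.size ≤ N + 2)).tick _) s' hs'
        refine ⟨h5, h6.trans ?_⟩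
        simp only [State.tick, State.write]
        rw [add_mul, one_mul]
        omega
    intro s' hs'
    obtain ⟨h3, h4⟩ := key _ hb s' hs'
    refine ⟨h3, h4.trans ?_⟩
    have := (hC N s hs).1
    have : b.eval s * (1 + N + T.eval N) ≤ N * (1 + N + T.eval N) := Nat.mul_le_mul_right _ hb
    simp only [Polynomial.eval_add, Polynomial.eval_mul,
      Polynomial.eval_C, Polynomial.eval_X, Polynomial.eval_one, Polynomial.eval_ofNat]
    linarith

/-! ## Notation for expressions -/

instance : Add Expr := ⟨.op .add⟩
instance : Sub Expr := ⟨.op .sub⟩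
instance : Mul Expr := ⟨.op .mul⟩
instance : Div Expr := ⟨.op .div⟩
instance : Mod Expr := ⟨.op .mod⟩

/-- The entry of the array `a` at `l`. -/
def entry (a : ℕ) (l : List Expr) : Expr := .get a fun i : Fin l.length => l[i]

/-- The variable `a`. -/
def var (a : ℕ) : Expr := entry a []

/-- Is `1` if `e₁ < e₂`, and `0` otherwise. -/
def less (e₁ e₂ : Expr) : Expr := .op .lt e₁ e₂

/-- Vanishes iff `e₁ = e₂`. -/
def differ (e₁ e₂ : Expr) : Expr := less e₁ e₂ + less e₂ e₁

/-- Assignment. -/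
def assign (a : ℕ) (l : List Expr) (v : Expr) : Program := .set a (fun i : Fin l.length => l[i]) v

/-- Drawing a random number. -/
def toss (a : ℕ) (l : List Expr) (b : Expr) : Program := .draw a (fun i : Fin l.length => l[i]) b

section Eval

variable (s : State) (e₁ e₂ : Expr)

@[simp] theorem eval_add : (e₁ + e₂).eval s = e₁.eval s + e₂.eval s := rfl
@[simp] theorem eval_sub : (e₁ - e₂).eval s = e₁.eval s - e₂.eval s := rfl
@[simp] theorem eval_mul : (e₁ * e₂).eval s = e₁.eval s * e₂.eval s := rfl
@[simp] theorem eval_div : (e₁ / e₂).eval s = e₁.eval s / e₂.eval s := rfl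
@[simp] theorem eval_mod : (e₁ % e₂).eval s = e₁.eval s % e₂.eval s := rfl
@[simp] theorem eval_lit (c : ℕ) : (Expr.lit c).eval s = c := rfl
@[simp] theorem eval_less :
    (less e₁ e₂).eval s = if e₁.eval s < e₂.eval s then 1 else 0 := rfl

theorem ofFn_eval (l : List Expr) :
    (List.ofFn fun i : Fin l.length => (l[i]).eval s) = l.map fun e => e.eval s := by
  conv_rhs => rw [← List.ofFn_getElem (xs := l), List.map_ofFn]
  rfl

@[simp] theorem eval_entry (a : ℕ) (l : List Expr) :
    (entry a l).eval s = s.mem a (l.map fun e => e.eval s) := by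
  rw [entry, Expr.eval, ofFn_eval]

@[simp] theorem eval_var (a : ℕ) : (var a).eval s = s.mem a [] := by simp [var]

theorem eval_differ : (differ e₁ e₂).eval s = 0 ↔ e₁.eval s = e₂.eval s := by
  simp only [differ, eval_add, eval_less]
  split_ifs <;> simp <;> omega

end Eval

theorem Program.wp_assign {s : State} {Q : State → Prop} {a : ℕ} {l : List Expr} {v : Expr}
    (h : ∀ t, Q ((s.write a (l.map fun e => e.eval s) (v.eval s)).tick t)) :
    (assign a l v).wp s Q := by
  refine wp_set fun t => ?_
  rw [ofFn_eval]
  exact h t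

theorem toss_exec (a : ℕ) (l : List Expr) (b : Expr) (s : State) : ∃ t,
    (toss a l b).exec s = (randomBits (b.eval s)).bind fun v =>
      PMF.pure ((s.write a (l.map fun e => e.eval s) v).tick t) := by
  rw [← ofFn_eval]
  exact ⟨_, rfl⟩

@[simp] theorem small_lit_zero : (Expr.lit 0).Small := fun _ _ _ => by simp
@[simp] theorem small_lit_one : (Expr.lit 1).Small := fun _ _ _ => by simp

@[simp] theorem small_entry (a : ℕ) (l : List Expr) : (entry a l).Small := fun _ _ h => h.size _ _

@[simp] theorem small_var (a : ℕ) : (var a).Small := small_entry _ _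

@[simp] theorem short_var_zero : (var 0).Short := fun N s h => by simpa using h.param 0 (by simp)
@[simp] theorem short_var_one : (var 1).Short := fun N s h => by simpa using h.param 1 (by simp)
@[simp] theorem short_var_two : (var 2).Short := fun N s h => by simpa using h.param 2 (by simp)
@[simp] theorem short_var_three : (var 3).Short := fun N s h => by simpa using h.param 3 (by simp)
@[simp] theorem short_var_four : (var 4).Short := fun N s h => by simpa using h.param 4 (by simp)
@[simp] theorem short_var_five : (var 5).Short := fun N s h => by simpa using h.param 5 (by simp)
@[simp] theorem short_lit_one : (Expr.lit 1).Short := fun N s h => by simpa using h.pos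

/-- The two rings in which the protocol computes. -/
inductive Modulus where
  | full
  | bits

/-- Number of binary digits of the elements. -/
def Modulus.digits : Modulus → Expr
  | .full => var 1
  | .bits => .lit 1

/-- Number of elements. -/
def Modulus.order : Modulus → Expr
  | .full => var 15
  | .bits => .lit 2

@[simp] theorem short_digits (q : Modulus) : q.digits.Short := by
  cases q <;> simp [Modulus.digits]

-- A reduced value is below a modulus that is `2` or already stored. The simulator reduces every sum
-- or product before storing it, so that tameness can be checked by `simp`; `doubling` is the
-- exception.
@[simp] theorem small_mod (e : Expr) (q : Modulus) : (e % q.order).Small := by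
  intro N s h
  have h0 : q.order.eval s ≠ 0 ∧ (q.order.eval s).size ≤ N + 2 := by
    cases q with
    | full => simpa [Modulus.order] using ⟨h.modulus, h.size 15 []⟩
    | bits => exact ⟨by simp [Modulus.order], (by decide : Nat.size 2 ≤ 2).trans (by omega)⟩
  exact (Nat.size_le_size (Nat.mod_lt _ (Nat.pos_of_ne_zero h0.1)).le).trans h0.2

@[simp] theorem tame_assign {lo hi a : ℕ} {l : List Expr} {v : Expr} :
    (assign a l v).Tame lo hi ↔ (lo ≤ a ∧ a < hi) ∧ v.Small := Iff.rfl

@[simp] theorem tame_toss {lo hi a : ℕ} {l : List Expr} {b : Expr} :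
    (toss a l b).Tame lo hi ↔ (lo ≤ a ∧ a < hi) ∧ b.Short := Iff.rfl

@[simp] theorem tame_skip {lo hi : ℕ} : Program.skip.Tame lo hi := trivial

@[simp] theorem tame_emit {lo hi : ℕ} {v : Expr} : (Program.emit v).Tame lo hi := trivial

@[simp] theorem tame_seq {lo hi : ℕ} {c₁ c₂ : Program} :
    (Program.seq c₁ c₂).Tame lo hi ↔ c₁.Tame lo hi ∧ c₂.Tame lo hi := Iff.rfl

@[simp] theorem tame_ite {lo hi : ℕ} {e : Expr} {c₁ c₂ : Program} :
    (Program.ite e c₁ c₂).Tame lo hi ↔ c₁.Tame lo hi ∧ c₂.Tame lo hi := Iff.rfl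

@[simp] theorem tame_loop {lo hi a : ℕ} {b : Expr} {c : Program} :
    (Program.loop a b c).Tame lo hi ↔ ((lo ≤ a ∧ a < hi) ∧ b.Short) ∧ c.Tame lo hi := Iff.rfl

/-! ## Simulation of a protocol by a program -/

/-- Numerical code of an event. -/
def Event.code {n : ℕ} (e : Event n) : List ℕ := [(e.owner : ℕ), e.source.code, e.value]

/-- What the coalition `I` sees of a log, written as a list of numbers. -/
def visible {n : ℕ} (I : Finset (Fin n)) (es : List (Event n)) : List ℕ :=
  (es.filter fun e => e.owner ∈ I).flatMap Event.code

/-- The program simulates the messages that the coalition `I` sees during the computation `m`; in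
a suitable coupling, the result of `m` and the final state are related by `Q`. -/
def Sim {n : ℕ} {α : Type} (I : Finset (Fin n)) (m : Prot n α) (c : Program) (s : State)
    (Q : α → State → Prop) : Prop :=
  ∀ base log, s.out = base ++ visible I log →
    Couple (m.run log) (c.exec s) fun x s' => s'.out = base ++ visible I x.2 ∧ Q x.1 s'

/-! ### Rules of the simulation calculus -/

section Sim

variable {n : ℕ} {I : Finset (Fin n)} {α β : Type} {m : Prot n α} {c c₁ c₂ : Program} {s : State}
  {Q R : α → State → Prop}

theorem visible_append (es fs : List (Event n)) :
    visible I (es ++ fs) = visible I es ++ visible I fs := by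
  simp [visible]

theorem visible_flatMap {γ : Type} (l : List γ) (E : γ → List (Event n)) :
    visible I (l.flatMap E) = l.flatMap fun x => visible I (E x) := by
  induction l with
  | nil => rfl
  | cons x l ih => rw [List.flatMap_cons, List.flatMap_cons, visible_append, ih]

theorem visible_singleton (e : Event n) :
    visible I [e] = if e.owner ∈ I then e.code else [] := by
  by_cases h : e.owner ∈ I <;> simp [visible, h]

theorem Sim.mono (h : Sim I m c s R) (hQ : ∀ a s', R a s' → Q a s') : Sim I m c s Q :=
  fun base log hlog => (h base log hlog).mono fun _ _ ⟨h1, h2⟩ => ⟨h1, hQ _ _ h2⟩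

/-- Correctness concerns the protocol side alone, so it can be added to any simulation. -/
theorem Sim.and_ensures {P : α → Prop} (h : Sim I m c s Q) (hP : Ensures m P) :
    Sim I m c s fun a s' => Q a s' ∧ P a :=
  fun base log hlog => (h base log hlog).mono_support fun _ _ hx _ ⟨h1, h2⟩ =>
    ⟨h1, h2, hP _ _ hx⟩

/-- Tameness concerns the program side alone; the arrays left unchanged are read off from the
syntax. -/
theorem Sim.and_frame {lo hi : ℕ} (h : Sim I m c s Q) (hc : c.Tame lo hi) :
    Sim I m c s fun a s' => Q a s' ∧ ∀ b, b < lo ∨ hi ≤ b → s'.mem b = s.mem b :=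
  fun base log hlog => (h base log hlog).mono_support fun _ _ _ hy ⟨h1, h2⟩ =>
    ⟨h1, h2, hc.frame s _ hy⟩

/-- The relation `R` carries all that later messages depend on, so the couplings of consecutive
phases compose. -/
theorem Sim.bind {f : α → Prot n β} {Q : β → State → Prop} (hm : Sim I m c₁ s R)
    (hf : ∀ a s', R a s' → Sim I (f a) c₂ s' Q) : Sim I (m >>= f) (.seq c₁ c₂) s Q := by
  intro base log hlog
  rw [Prot.run_bind]
  exact (hm base log hlog).bind fun x s' ⟨h1, h2⟩ => hf _ _ h2 base _ h1

theorem Sim.record {es : List (Event n)} {Q : Unit → State → Prop}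
    (h : c.wp s fun s' => s'.out = s.out ++ visible I es ∧ Q () s') :
    Sim I (record es) c s Q := by
  intro base log hlog
  rw [run_record]
  refine Couple.pure_left fun s' hs' => ⟨?_, (h s' hs').2⟩
  rw [(h s' hs').1, hlog, visible_append, List.append_assoc]

/-- Work of the simulator without messages in the protocol has to leave the output tape alone. -/
theorem Sim.pure {a : α} (h : c.wp s fun s' => s'.out = s.out ∧ Q a s') :
    Sim I (pure a) c s Q := by
  intro base log hlog
  rw [Prot.run_pure]
  exact Couple.pure_left fun s' hs' => ⟨(h s' hs').1.trans hlog, (h s' hs').2⟩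

theorem Sim.pre {R : State → Prop} (h : c₁.wp s fun s' => s'.out = s.out ∧ R s')
    (hm : ∀ s', R s' → Sim I m c₂ s' Q) : Sim I m (.seq c₁ c₂) s Q := by
  have : m = (Pure.pure () : Prot n Unit) >>= fun _ => m := (pure_bind () fun _ => m).symm
  rw [this]
  exact (Sim.pure (Q := fun _ => R) h).bind fun _ => hm

theorem Sim.post {f : α → β} {Q : β → State → Prop} (hm : Sim I m c₁ s R)
    (h : ∀ a s', R a s' → c₂.wp s' fun s'' => s''.out = s'.out ∧ Q (f a) s'') :
    Sim I (m >>= fun a => Pure.pure (f a)) (.seq c₁ c₂) s Q :=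
  hm.bind fun a s' hs' => Sim.pure (h a s' hs')

theorem Sim.post_self (hm : Sim I m c₁ s R)
    (h : ∀ a s', R a s' → c₂.wp s' fun s'' => s''.out = s'.out ∧ Q a s'') :
    Sim I m (.seq c₁ c₂) s Q := by
  have : m = m >>= Pure.pure := (bind_pure m).symm
  rw [this]
  exact hm.post (f := id) h

theorem Sim.map {f : α → β} {Q : β → State → Prop} (hm : Sim I m c s R)
    (h : ∀ a s', R a s' → Q (f a) s') : Sim I (m >>= fun a => Pure.pure (f a)) c s Q := by
  intro base log hlog
  rw [Prot.run_bind, ← PMF.bind_pure (c.exec s)]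
  exact (hm base log hlog).bind fun x s' ⟨h1, h2⟩ => Couple.pure_left fun y hy => by
    rw [(PMF.mem_support_pure_iff _ _).1 hy]
    exact ⟨h1, h _ _ h2⟩

theorem Sim.ite_pos {e : Expr} (he : e.eval s ≠ 0) (h : ∀ t, Sim I m c₁ (s.tick t) Q) :
    Sim I m (.ite e c₁ c₂) s Q := by
  intro base log hlog
  rw [Program.exec, if_pos he]
  exact h _ base log hlog

theorem Sim.ite_neg {e : Expr} (he : e.eval s = 0) (h : ∀ t, Sim I m c₂ (s.tick t) Q) :
    Sim I m (.ite e c₁ c₂) s Q := by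
  intro base log hlog
  rw [Program.exec, if_neg (not_not.2 he)]
  exact h _ base log hlog

/-- The body of a loop over the variable `v`, as in `Program.exec`. -/
def loopStep (v : ℕ) (c : Program) (s : State) (i : ℕ) : PMF State :=
  c.exec ((s.write v [] i).tick (1 + i.size))

/-- The offset `o` serves the induction, as `forFin` splits off its first round. The last clause of
`hJ` says that a round preserves what earlier rounds have recorded. -/
theorem couple_forFin {m : ℕ} (f : Fin m → Prot n α) (v o : ℕ) (J : State → Prop)
    (R : Fin m → α → State → Prop)
    (hJ : ∀ i s, J s → ∀ t, Sim I (f i) c ((s.write v [] (o + i)).tick t) fun a s' =>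
      J s' ∧ R i a s' ∧ ∀ j b, j < i → R j b s → R j b s')
    {s : State} (hs : J s) {base : List ℕ} {log : List (Event n)}
    (hlog : s.out = base ++ visible I log) :
    Couple ((forFin f).run log) ((List.range' o m).foldlM (loopStep v c) s) fun x s' =>
      s'.out = base ++ visible I x.2 ∧ J s' ∧ ∀ i, R i (x.1 i) s' := by
  induction m generalizing o J s log with
  | zero =>
    refine Couple.pure_left fun s' hs' => ?_
    rw [(PMF.mem_support_pure_iff _ _).1 hs']
    exact ⟨hlog, hs, fun i => i.elim0⟩
  | succ m ih =>
    rw [List.range'_succ, List.foldlM_cons]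
    refine Couple.bind (p := (f 0).run log) (hJ 0 s hs _ base log hlog) fun x s₁ ⟨h1, h2, h3, _⟩ => ?_
    rw [← PMF.bind_pure (List.foldlM _ _ _)]
    -- The record of round `0` joins the invariant of the remaining rounds.
    refine (ih (fun i => f i.succ) (o + 1) (fun s => J s ∧ R 0 x.1 s) (fun i => R i.succ)
      (fun i s₂ hs₂ t => ?_) ⟨h2, h3⟩ h1).bind fun y s₂ ⟨h4, h5, h6⟩ =>
      Couple.pure_left fun s₃ hs₃ => ?_
    · have := hJ i.succ s₂ hs₂.1 t
      rw [Fin.val_succ, show o + ((i : ℕ) + 1) = o + 1 + i by omega] at this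
      exact this.mono fun a s₃ ⟨h4, h5, h6⟩ => ⟨⟨h4, h6 0 _ (Fin.succ_pos i) hs₂.2⟩, h5,
        fun j b hj => h6 j.succ b (Fin.succ_lt_succ_iff.2 hj)⟩
    · rw [(PMF.mem_support_pure_iff _ _).1 hs₃]
      exact ⟨h4, h5.1, fun i => Fin.cases h5.2 h6 i⟩

theorem Sim.forFin {m : ℕ} {f : Fin m → Prot n α} {v : ℕ} {b : Expr} (hb : b.eval s = m)
    (J : State → Prop) (R : Fin m → α → State → Prop) (hs : ∀ t, J (s.tick t))
    (hJ : ∀ i s, J s → ∀ t, Sim I (f i) c ((s.write v [] i).tick t) fun a s' =>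
      J s' ∧ R i a s' ∧ ∀ j b, j < i → R j b s → R j b s') :
    Sim I (forFin f) (.loop v b c) s fun as s' => J s' ∧ ∀ i, R i (as i) s' := by
  intro base log hlog
  rw [Program.exec, hb, List.range_eq_range']
  exact couple_forFin f v 0 J R (by simpa using hJ) (hs _) hlog

/-- A loop whose protocol recurses at the end. -/
theorem Sim.iterate {F : ℕ → α → Prot n β} {g : α → β} {step : α → Prot n α}
    (h₀ : ∀ a, F 0 a = Pure.pure (g a)) (h₁ : ∀ T a, F (T + 1) a = step a >>= F T)
    {v : ℕ} {b : Expr} (J : α → State → Prop) {a : α} (hs : ∀ t, J a (s.tick t))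
    (hJ : ∀ a s, J a s → ∀ i t, Sim I (step a) c ((s.write v [] i).tick t) J) :
    Sim I (F (b.eval s) a) (.loop v b c) s fun z s' => ∃ a', z = g a' ∧ J a' s' := by
  intro base log hlog
  have key : ∀ T o a (s : State) log, J a s → s.out = base ++ visible I log →
      Couple ((F T a).run log) ((List.range' o T).foldlM (loopStep v c) s) fun x s' =>
        s'.out = base ++ visible I x.2 ∧ ∃ a', x.1 = g a' ∧ J a' s' := by
    intro T
    induction T with
    | zero =>
      intro o a s log hs hlog
      rw [h₀]
      refine Couple.pure_left fun s' hs' => ?_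
      rw [(PMF.mem_support_pure_iff _ _).1 hs']
      exact ⟨hlog, a, rfl, hs⟩
    | succ T ih =>
      intro o a s log hs hlog
      rw [h₁, List.range'_succ, List.foldlM_cons]
      exact (hJ a s hs o _ base log hlog).bind fun x s₁ ⟨h1, h2⟩ => ih _ _ _ _ h2 h1
  rw [Program.exec, List.range_eq_range']
  exact key _ _ _ _ _ (hs _) hlog

/-- A loop whose protocol recurses at the beginning. -/
theorem Sim.ascend {G : ℕ → Prot n α} {a₀ : α} {step : ℕ → α → Prot n α}
    (h₀ : G 0 = Pure.pure a₀) (h₁ : ∀ m, G (m + 1) = G m >>= step m) {v : ℕ} {b : Expr}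
    (J : α → State → Prop) (hs : ∀ t, J a₀ (s.tick t))
    (hJ : ∀ i < b.eval s, ∀ a s, J a s → ∀ t, Sim I (step i a) c ((s.write v [] i).tick t) J) :
    Sim I (G (b.eval s)) (.loop v b c) s J := by
  intro base log hlog
  have key : ∀ m ≤ b.eval s, ∀ t, Couple ((G m).run log)
      ((List.range m).foldlM (loopStep v c) (s.tick t)) fun x s' =>
        s'.out = base ++ visible I x.2 ∧ J x.1 s' := by
    intro m hm t
    induction m with
    | zero =>
      rw [h₀]
      refine Couple.pure_left fun s' hs' => ?_
      rw [(PMF.mem_support_pure_iff _ _).1 hs']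
      exact ⟨hlog, hs _⟩
    | succ m ih =>
      rw [h₁, foldlM_succ, Prot.run_bind]
      exact (ih (by omega)).bind fun x s₁ ⟨h1, h2⟩ => hJ m hm _ _ h2 _ base _ h1
  rw [Program.exec]
  exact key _ le_rfl _

/-- Sampling leaves the log unchanged, so the coupling of runs descends to the sampled values, where
`Couple.uniform_bijective` applies. The program may thus draw the visible coordinates of `φ a` in
place of `a`. -/
theorem Sim.sample_bijective [Fintype α] [Nonempty α] {φ : α → α} (hφ : φ.Bijective)
    (h : Sim I (sample α) c s Q) : Sim I (sample α) c s fun a s' => Q (φ a) s' := by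
  intro base log hlog
  have h1 := h base log hlog
  simp only [run_sample] at h1 ⊢
  change Couple (PMF.map (fun a => (a, log)) _) _ _ at h1
  change Couple (PMF.map (fun a => (a, log)) _) _ _
  have h2 : Couple (PMF.uniformOfFintype α) (c.exec s) fun a s' =>
      s'.out = base ++ visible I log ∧ Q a s' := by
    have h3 : (PMF.uniformOfFintype α) =
        ((PMF.uniformOfFintype α).map fun a => (a, log)).bind fun x => PMF.pure x.1 := by
      rw [PMF.bind_map]
      exact (PMF.bind_pure _).symm
    rw [h3, ← PMF.bind_pure (c.exec s)]
    refine (h1.mono_support (R' := fun x s' => x.2 = log ∧ s'.out = base ++ visible I x.2 ∧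
      Q x.1 s') fun x s' hx _ hR => ⟨?_, hR⟩).bind fun x s' hx => Couple.pure_left fun y hy => ?_
    · obtain ⟨a, -, rfl⟩ := (PMF.mem_support_map_iff _ _ _).1 hx
      rfl
    · rw [(PMF.mem_support_pure_iff _ _).1 hy]
      rw [hx.1] at hx
      exact hx.2
  have h3 := h2.uniform_bijective hφ
  rw [← PMF.bind_pure (c.exec s)]
  exact h3.bind fun a s' hs' => Couple.pure_left fun y hy => by
    rw [(PMF.mem_support_pure_iff _ _).1 hy]
    exact hs'

/-- Uniform vectors factor into independent uniform entries, which lets a loop of single draws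
simulate them. -/
theorem sample_pi [Fintype α] [Nonempty α] (m : ℕ) :
    (sample (Fin m → α) : Prot n (Fin m → α)) = SecureDL.forFin fun _ => sample α := by
  induction m with
  | zero =>
    funext log
    change (sample (Fin 0 → α) : Prot n _).run log = PMF.pure (Fin.elim0, log)
    rw [run_sample]
    have : (PMF.uniformOfFintype (Fin 0 → α)) = PMF.pure Fin.elim0 := by
      ext f
      rw [Subsingleton.elim f Fin.elim0]
      simp
    rw [this, PMF.pure_bind]
  | succ m ih =>
    funext log
    rw [SecureDL.forFin, ← ih]
    change (sample (Fin (m + 1) → α) : Prot n _).run log = _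
    change _ = ((sample α : Prot n α).run log).bind fun x =>
      ((sample (Fin m → α) : Prot n _).run x.2).bind fun y => PMF.pure ((Fin.cons x.1 y.1 : Fin (m + 1) → α), y.2)
    simp only [run_sample, PMF.bind_bind, PMF.pure_bind]
    have : (PMF.uniformOfFintype (Fin (m + 1) → α)) = (PMF.uniformOfFintype α).bind fun a =>
        (PMF.uniformOfFintype (Fin m → α)).bind fun as => 
          PMF.pure (Fin.cons a as : Fin (m + 1) → α) := by
      ext f
      -- Only one head and one tail assemble to `f`, so both sums collapse to a single term.
      rw [PMF.bind_apply, tsum_eq_single (f 0), PMF.bind_apply, tsum_eq_single (Fin.tail f)]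
      · simp only [PMF.uniformOfFintype_apply, Fin.cons_self_tail, PMF.pure_apply, if_true, mul_one,
          Fintype.card_pi, Finset.prod_const, Finset.card_univ, Fintype.card_fin]
        rw [pow_succ, mul_comm, Nat.cast_mul, ENNReal.mul_inv] <;> simp
      · intro as has
        rw [PMF.pure_apply, if_neg, mul_zero]
        intro hf
        rw [hf, Fin.tail_cons] at has
        exact has rfl
      · intro a ha
        rw [PMF.bind_apply, ENNReal.tsum_eq_zero.2, mul_zero]
        intro as
        rw [PMF.pure_apply, if_neg, mul_zero]
        intro hf
        rw [hf, Fin.cons_zero] at ha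
        exact ha rfl
    rw [this]
    simp only [PMF.bind_bind, PMF.pure_bind]

end Sim

infixr:60 " ;; " => Program.seq

/-- The public part of the simulator's memory, where `h` is a party outside of the coalition. -/
structure Env {n k : ℕ} (P : Params k) (d : ℕ) (I : Finset (Fin n)) (h : Fin n) (s : State) :
    Prop where
  parties : s.mem 0 [] = n
  digits : s.mem 1 [] = k
  dim : s.mem 2 [] = d
  invIters : s.mem 4 [] = P.invIters
  sqrtIters : s.mem 5 [] = P.sqrtIters
  cInv : s.mem 6 [] = P.cInv.val
  guess : s.mem 7 [] = P.guess.val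
  half : s.mem 8 [] = P.half.val
  invN : s.mem 9 [] = P.invN.val
  tau : s.mem 10 [] = P.tau.val
  corrupt : ∀ p : Fin n, s.mem 11 [p] = if p ∈ I then 1 else 0
  order : s.mem 15 [] = 2 ^ k
  power : ∀ m < k, s.mem 16 [m] = 2 ^ m
  honest : s.mem 17 [] = h
  honest_notMem : h ∉ I

theorem Env.frame {n k d : ℕ} {P : Params k} {I : Finset (Fin n)} {h : Fin n} {s s' : State}
    (hE : Env P d I h s) (hs : ∀ a < 20, s'.mem a = s.mem a) : Env P d I h s' := by
  have e : ∀ a < 20, ∀ l, s'.mem a l = s.mem a l := fun a ha l => congrFun (hs a ha) l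
  exact {
    parties := (e 0 (by decide) _).trans hE.parties
    digits := (e 1 (by decide) _).trans hE.digits
    dim := (e 2 (by decide) _).trans hE.dim
    invIters := (e 4 (by decide) _).trans hE.invIters
    sqrtIters := (e 5 (by decide) _).trans hE.sqrtIters
    cInv := (e 6 (by decide) _).trans hE.cInv
    guess := (e 7 (by decide) _).trans hE.guess
    half := (e 8 (by decide) _).trans hE.half
    invN := (e 9 (by decide) _).trans hE.invN
    tau := (e 10 (by decide) _).trans hE.tau
    corrupt := fun p => (e 11 (by decide) _).trans (hE.corrupt p)
    order := (e 15 (by decide) _).trans hE.order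
    power := fun m hm => (e 16 (by decide) _).trans (hE.power m hm)
    honest := (e 17 (by decide) _).trans hE.honest
    honest_notMem := hE.honest_notMem }

/-- The ring `ZMod q` belongs to the modulus. -/
def Modulus.Has (k : ℕ) : Modulus → ℕ → Prop
  | .full, q => q = 2 ^ k
  | .bits, q => q = 2

/-! ### Storing, announcing, opening and drawing shares -/

section Primitives

variable {n k d : ℕ} {P : Params k} {I : Finset (Fin n)} {h : Fin n} {s : State}

theorem Modulus.Has.order_eval {q : ℕ} {md : Modulus} (hq : md.Has k q) (hE : Env P d I h s) :
    md.order.eval s = q := by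
  cases md with
  | full => exact (by simp [Modulus.order, hE.order] : _ = 2 ^ k).trans (Eq.symm hq)
  | bits => exact Eq.symm hq

theorem Modulus.Has.digits_eval {q : ℕ} {md : Modulus} (hq : md.Has k q) (hE : Env P d I h s) :
    q = 2 ^ md.digits.eval s := by
  cases md with
  | full => exact Eq.trans hq (by simp [Modulus.digits, hE.digits])
  | bits => exact hq

theorem mod_eq_val {q : ℕ} [NeZero q] {v : ℕ} {z : ZMod q} (h : (v : ZMod q) = z) :
    v % q = z.val := by
  rw [← h, ZMod.val_natCast]

/-- The programs have only truncated subtraction and negate residues by `q - z.val`; nothing is cut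
off since `z.val < q`. -/
theorem natCast_sub_val {q : ℕ} [NeZero q] (z : ZMod q) : ((q - z.val : ℕ) : ZMod q) = -z := by
  rw [Nat.cast_sub z.val_lt.le]
  simp

/-- All parties but `h` hold in the array `a` their shares of `x`. -/
def Holds {q : ℕ} (h : Fin n) (s : State) (a : ℕ) (pre : List ℕ) (x : Sharing n q) : Prop :=
  ∀ p : Fin n, p ≠ h → s.mem a (pre ++ [(p : ℕ)]) = (x p).val

/-- The state `s'` agrees with `s`, except for the entries of the array `a` at `pre`, and for the
variable `20`. -/
structure Agree (n : ℕ) (a : ℕ) (pre : List ℕ) (s s' : State) : Prop where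
  other : ∀ l, (∀ p : Fin n, l ≠ pre ++ [(p : ℕ)]) → s'.mem a l = s.mem a l
  frame : ∀ b, b ≠ a → b ≠ 20 → s'.mem b = s.mem b

/-- For every party `p = var 20`, store `e`. -/
def fill (a : ℕ) (l : List Expr) (e : Expr) : Program :=
  .loop 20 (var 0) (assign a (l ++ [var 20]) e)

/-- Each round overwrites only the entry of its own party, so `e` may use the old entry at the same
`p`; updates in place rely on this. The entry of `h` is overwritten too, without any claim about it.
-/
theorem wp_fill {q : ℕ} {a : ℕ} {l : List Expr} {e : Expr} (pre : List ℕ) (x : Sharing n q)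
    (hE : Env P d I h s) (ha : 20 < a)
    (he : ∀ (p : Fin n) (s' : State), Agree n a pre s s' → s'.mem 20 [] = p →
      s'.mem a (pre ++ [(p : ℕ)]) = s.mem a (pre ++ [(p : ℕ)]) → Env P d I h s' →
      (l.map fun e => e.eval s') = pre ∧ (p ≠ h → e.eval s' = (x p).val)) :
    (fill a l e).wp s fun s' => s'.out = s.out ∧ Holds h s' a pre x ∧ Agree n a pre s s' := by
  refine Program.wp_loop (fun i s' => s'.out = s.out ∧ (∀ p : Fin n, (p : ℕ) < i → p ≠ h →
    s'.mem a (pre ++ [(p : ℕ)]) = (x p).val) ∧ (∀ l, (∀ p' : Fin n, (p' : ℕ) < i →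
      l ≠ pre ++ [(p' : ℕ)]) → s'.mem a l = s.mem a l) ∧ Agree n a pre s s') ?_ ?_ ?_
  · exact fun t => ⟨rfl, by simp, fun _ _ => rfl, ⟨fun _ _ => rfl, fun _ _ _ => rfl⟩⟩
  · intro i hi s₁ ⟨h1, h2, h3, h4⟩ t
    rw [eval_var, hE.parties] at hi
    have hag : Agree n a pre s ((s₁.write 20 [] i).tick t) := by
      refine ⟨fun l hl => ?_, fun b hb hb' => ?_⟩
      · rw [State.mem_tick, State.mem_write_of_ne _ _ _ (by omega), h4.other l hl]
      · rw [State.mem_tick, State.mem_write_of_ne _ _ _ hb', h4.frame b hb hb']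
    have hE' := hE.frame fun b hb => hag.frame b (by omega) (by omega)
    obtain ⟨h5, h6⟩ := he ⟨i, hi⟩ _ hag (by simp [State.mem_write]) (by
      rw [State.mem_tick, State.mem_write_of_ne _ _ _ (by omega)]
      exact h3 _ fun p' hp' h => hp'.ne (by simpa using h.symm)) hE'
    refine Program.wp_assign fun t' => ⟨h1, ?_⟩
    have hidx : (List.map (fun e => e.eval ((s₁.write 20 [] i).tick t)) (l ++ [var 20])) =
        pre ++ [i] := by
      rw [List.map_append, h5]
      simp [State.mem_write]
    rw [hidx]
    refine ⟨fun p hp hph => ?_, fun l hl => ?_, fun l hl => ?_, fun b hb hb' => ?_⟩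
    · rw [State.mem_tick, State.mem_write]
      by_cases hpi : (p : ℕ) = i
      · rw [if_pos ⟨rfl, by rw [hpi]⟩]
        have : p = ⟨i, hi⟩ := Fin.ext hpi
        subst this
        exact h6 hph
      · rw [if_neg (by simpa using hpi), State.mem_tick, State.mem_write_of_ne _ _ _ (by omega)]
        exact h2 p (by omega) hph
    · have := hl ⟨i, hi⟩ (by simp)
      rw [State.mem_tick, State.mem_write, if_neg (by simpa using this), State.mem_tick,
        State.mem_write_of_ne _ _ _ (by omega)]
      exact h3 l fun p' hp' => hl p' (by omega)
    · have := hl ⟨i, hi⟩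
      rw [State.mem_tick, State.mem_write, if_neg (by simpa using this), State.mem_tick,
        State.mem_write_of_ne _ _ _ (by omega)]
      exact h4.other l hl
    · rw [State.mem_tick, State.mem_write_of_ne _ _ _ hb, hag.frame b hb hb']
  · intro s₁ ⟨h1, h2, h3, h4⟩
    rw [eval_var, hE.parties] at h2
    exact ⟨h1, fun p => h2 p p.2, h4⟩

/-- Announce an event. -/
def emitEvent (o src v : Expr) : Program := .emit o ;; .emit src ;; .emit v

theorem wp_emitEvent {o src v : Expr} : (emitEvent o src v).wp s fun s' =>
    s'.mem = s.mem ∧ s'.out = s.out ++ [o.eval s, src.eval s, v.eval s] := by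
  -- Emitting changes only the tape and the counter, so all three expressions are evaluated in the
  -- same memory.
  have hev : ∀ (e : Expr) (s s' : State), s'.mem = s.mem → e.eval s' = e.eval s := by
    intro e s s' hs
    induction e with
    | lit c => rfl
    | get a idx ih => simp only [Expr.eval, hs, ih]
    | op o e₁ e₂ ih₁ ih₂ => simp only [Expr.eval, ih₁, ih₂]
  refine Program.wp_seq (Program.wp_emit fun t₁ => Program.wp_seq (Program.wp_emit fun t₂ =>
    Program.wp_emit fun t₃ => ⟨rfl, ?_⟩))
  simp only [State.tick, List.append_assoc, List.cons_append, List.nil_append]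
  refine congrArg (s.out ++ ·) ?_
  rw [List.cons.injEq, List.cons.injEq, List.cons.injEq]
  exact ⟨rfl, hev _ _ _ rfl, hev _ _ _ rfl, rfl⟩

theorem wp_emitLoop {v : ℕ} {b : Expr} {c : Program} (E : Fin n → List ℕ) (J : State → Prop)
    (hb : b.eval s = n) (h₀ : ∀ t, J (s.tick t))
    (hc : ∀ i : Fin n, ∀ s', J s' → ∀ t, c.wp ((s'.write v [] i).tick t) fun s'' =>
      J s'' ∧ s''.out = s'.out ++ E i) :
    (Program.loop v b c).wp s fun s' => J s' ∧ s'.out = s.out ++ (List.finRange n).flatMap E := by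
  refine Program.wp_loop (fun i s' => J s' ∧ s'.out = s.out ++
    ((List.finRange n).take i).flatMap E) (fun t => ⟨h₀ t, by simp⟩) ?_ ?_
  · intro i hi s' ⟨h1, h2⟩ t
    rw [hb] at hi
    refine (hc ⟨i, hi⟩ s' h1 t).mono fun s'' ⟨h3, h4⟩ => ⟨h3, ?_⟩
    rw [h4, h2, List.take_add_one, List.getElem?_eq_getElem (by simpa using hi)]
    simp
  · intro s' ⟨h1, h2⟩
    refine ⟨h1, ?_⟩
    rw [h2, hb, List.take_of_length_le (by simp)]

/-- Announce the shares in the array `a` as data from the preprocessing phase. -/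
def dealing (a : ℕ) (l : List Expr) : Program :=
  .loop 20 (var 0) (.ite (entry 11 [var 20])
    (emitEvent (var 20) (.lit 1) (entry a (l ++ [var 20]))) .skip)

/-- Only shares of corrupt parties are visible and `h` is not corrupt, so the shares in `Holds`
suffice. -/
theorem sim_deal {q : ℕ} {a : ℕ} {l : List Expr} {pre : List ℕ} {x : Sharing n q}
    (hE : Env P d I h s) (ha : 20 < a)
    (hl : ∀ s', (∀ b, b ≠ 20 → s'.mem b = s.mem b) → (l.map fun e => e.eval s') = pre)
    (hx : Holds h s a pre x) :
    Sim I (deal x) (dealing a l) s fun _ s' => ∀ b, b ≠ 20 → s'.mem b = s.mem b := by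
  refine Sim.record ?_
  rw [List.map_eq_flatMap, visible_flatMap]
  refine (wp_emitLoop _ (fun s' => ∀ b, b ≠ 20 → s'.mem b = s.mem b) (by simp [hE.parties])
    (fun _ _ _ => rfl) ?_).mono fun _ h => ⟨h.2, h.1⟩
  intro i s' hs' t
  have h1 : ∀ b, b ≠ 20 → ((s'.write 20 [] i).tick t).mem b = s.mem b := fun b hb => by
    rw [State.mem_tick, State.mem_write_of_ne _ _ _ hb, hs' b hb]
  have hl' := hl _ h1
  have h20 : ((s'.write 20 [] i).tick t).mem 20 [] = i := by simp [State.mem_write]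
  have hc : (entry 11 [var 20]).eval ((s'.write 20 [] i).tick t) = if i ∈ I then 1 else 0 := by
    simp [h20, h1 11 (by decide), hE.corrupt i]
  rw [visible_singleton]
  refine Program.wp_ite (fun hi t' => ?_) fun hi t' => ?_
  · have hi : i ∈ I := by
      by_contra hi'
      simp [hc, hi'] at hi
    rw [if_pos hi]
    refine wp_emitEvent.mono fun s'' ⟨h2, h3⟩ => ⟨fun b hb => ?_, ?_⟩
    · rw [h2]
      exact h1 b hb
    · rw [h3, State.out_tick, State.out_tick, State.out_write]
      congr 1
      have hl'' := hl (((s'.write 20 [] i).tick t).tick t') h1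
      have := hx i (fun hh => hE.honest_notMem (hh ▸ hi))
      simp only [eval_var, eval_entry, List.map_append, hl'', State.mem_tick, List.map_cons,
        List.map_nil, eval_lit, Event.code, Source.code]
      rw [State.mem_tick] at h20
      rw [h20, ← this, State.mem_write_of_ne _ _ _ (by omega), hs' a (by omega)]
  · have hi : i ∉ I := by
      intro hi'
      simp [hc, hi'] at hi
    rw [if_neg hi]
    exact Program.wp_skip ⟨h1, by simp⟩

/-- The array `24` holds the shares of all parties but the one in the variable `v`, the variable
`25` the shared value. Compute the missing share. -/
def closing (md : Modulus) (v : ℕ) : Program :=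
  assign 23 [] (.lit 0) ;;
  .loop 20 (var 0) (.ite (differ (var 20) (var v))
    (assign 23 [] ((var 23 + entry 24 [var 20]) % md.order)) .skip) ;;
  assign 24 [var v] ((var 25 + (md.order - var 23)) % md.order)

/-- The index `i₀` is `h` when a value is opened, and the sender when a corrupt client shares its
input. -/
theorem wp_closing {q : ℕ} [NeZero q] {md : Modulus} (hq : md.Has k q) {x : Sharing n q}
    (hE : Env P d I h s) {v : ℕ} {i₀ : Fin n} (hi₀ : s.mem v [] = i₀)
    (hv' : v ≠ 20 ∧ v ≠ 23 ∧ v ≠ 24) (hx : Holds i₀ s 24 [] x) (hv : s.mem 25 [] = (∑ p, x p).val) :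
    (closing md v).wp s fun s' => s'.out = s.out ∧ (∀ p : Fin n, s'.mem 24 [(p : ℕ)] = (x p).val) ∧
      ∀ b, b ≠ 20 → b ≠ 23 → b ≠ 24 → s'.mem b = s.mem b := by
  -- The shares with the missing one set to `0`, extended by `0` to `ℕ` so that the loop counter can
  -- index partial sums.
  let F : ℕ → ZMod q := fun i => if hi : i < n then if (⟨i, hi⟩ : Fin n) = i₀ then 0 else x ⟨i, hi⟩
    else 0
  refine Program.wp_seq (Program.wp_assign fun t => Program.wp_seq (Program.wp_loop
    (fun i s' => s'.out = s.out ∧ (∀ b, b ≠ 20 → b ≠ 23 → s'.mem b = s.mem b) ∧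
      s'.mem 23 [] = (∑ j ∈ Finset.range i, F j).val) ?_ ?_ ?_))
  · refine fun t' => ⟨rfl, fun b hb hb' => ?_, ?_⟩
    · rw [State.mem_tick, State.mem_tick, State.mem_write_of_ne _ _ _ hb']
    · simp [State.mem_write]
  · intro i hi s' ⟨h1, h2, h3⟩ t'
    have hi' : i < n := by simpa [State.mem_write, hE.parties] using hi
    have h4 : ∀ b, b ≠ 20 → b ≠ 23 → ((s'.write 20 [] i).tick t').mem b = s.mem b :=
      fun b hb hb' => by rw [State.mem_tick, State.mem_write_of_ne _ _ _ hb, h2 b hb hb']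
    have h20 : ((s'.write 20 [] i).tick t').mem 20 [] = i := by simp [State.mem_write]
    have h23 : ((s'.write 20 [] i).tick t').mem 23 [] = (∑ j ∈ Finset.range i, F j).val := by
      simp [State.mem_write, h3]
    have hE' := hE.frame (s' := (s'.write 20 [] i).tick t') fun b hb =>
      h4 b (by omega) (by omega)
    have h5 : ((s'.write 20 [] i).tick t').out = s.out := h1
    generalize (s'.write 20 [] i).tick t' = s₁ at *
    have hd := eval_differ s₁ (var 20) (var v)
    rw [eval_var, eval_var, h20, h4 v hv'.1 hv'.2.1, hi₀] at hd
    have hFi : F i = if i = (i₀ : ℕ) then 0 else x ⟨i, hi'⟩ := by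
      simp [F, hi', Fin.ext_iff]
    refine Program.wp_ite (fun hne t'' => Program.wp_assign fun t₃ => ⟨h5, ?_, ?_⟩)
      fun he t'' => Program.wp_skip ⟨h5, h4, ?_⟩
    · intro b hb hb'
      rw [State.mem_tick, State.mem_write_of_ne _ _ _ hb', State.mem_tick, h4 b hb hb']
    · have hih : i ≠ (i₀ : ℕ) := fun hih => hne (hd.2 hih)
      have hxi := hx ⟨i, hi'⟩ fun hh => hih (congrArg Fin.val hh)
      have ho := hq.order_eval (hE'.frame (s' := s₁.tick t'') fun _ _ => rfl)
      rw [State.mem_tick, State.mem_write, if_pos (by simp), eval_mod, ho, Finset.sum_range_succ,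
        hFi, if_neg hih]
      apply mod_eq_val
      simp only [eval_add, eval_var, eval_entry, State.mem_tick, h23, List.map_cons, List.map_nil,
        h20, h4 24 (by decide) (by decide)]
      simp only [List.nil_append] at hxi
      rw [hxi]
      simp
    · rw [State.mem_tick, State.mem_tick, h23, Finset.sum_range_succ, hFi, if_pos (hd.1 he),
        add_zero]
  · intro s' ⟨h1, h2, h3⟩
    have hE' := hE.frame (s' := s') fun b hb => h2 b (by omega) (by omega)
    refine Program.wp_assign fun t' => ⟨h1, fun p => ?_, fun b _ hb hb' => ?_⟩
    · simp only [List.map_cons, List.map_nil, eval_var, h2 v hv'.1 hv'.2.1, hi₀, State.mem_tick,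
        State.mem_write, true_and]
      by_cases hp : p = i₀
      · subst hp
        rw [if_pos rfl, eval_mod, hq.order_eval hE']
        apply mod_eq_val
        have hn : (var 0).eval ((s.write 23 (([] : List Expr).map fun e => e.eval s)
            ((Expr.lit 0).eval s)).tick t) = n := by
          simp [State.mem_write, hE.parties]
        have hF : ∑ j ∈ Finset.range n, F j = ∑ j, x j - x p := by
          rw [Finset.sum_range, ← Finset.add_sum_erase _ _ (Finset.mem_univ p),
            ← Finset.add_sum_erase _ x (Finset.mem_univ p)]
          have h4 : ∀ j ∈ Finset.univ.erase p, F j = x j := fun j hj => by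
            simp [F, Finset.ne_of_mem_erase hj]
          rw [Finset.sum_congr rfl h4]
          simp [F]
        rw [hn, hF] at h3
        rw [eval_add, eval_sub, hq.order_eval hE', eval_var, eval_var, h3,
          h2 25 (by decide) (by decide), hv, Nat.cast_add, natCast_sub_val]
        simp
      · rw [if_neg (by simpa using fun hh => hp (Fin.ext hh)), h2 24 (by decide) (by decide)]
        simpa using hx p hp
    · rw [State.mem_tick, State.mem_write_of_ne _ _ _ hb', h2 b ‹_› hb]

/-- Open the value whose shares are in the array `24` (without the one of `h`), and which itself is
in the variable `25`. -/
def revealing (md : Modulus) : Program :=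
  closing md 17 ;;
  .loop 21 (var 0) (.ite (entry 11 [var 21])
    (.loop 20 (var 0) (.ite (differ (var 20) (var 21))
      (emitEvent (var 21) (var 20 + .lit 2) (entry 24 [var 20])) .skip)) .skip)

theorem flatMap_filter_ne {γ : Type} (i : Fin n) (l : List (Fin n)) (E : Fin n → List γ) :
    (l.filter (· ≠ i)).flatMap E = l.flatMap fun j => if j ≠ i then E j else [] := by
  induction l with
  | nil => rfl
  | cons j l ih =>
    by_cases hj : j = i
    · simpa [hj] using ih
    · simpa [hj] using ih

/-- The loop in which the party in the variable `v`, if it is corrupt, sees the messages with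
the entries of the array `24`. -/
theorem wp_receive {q v : ℕ} {x : Sharing n q} (hE : Env P d I h s) (hv : v ≠ 20)
    (i : Fin n) (hi : s.mem v [] = i)
    (hx : ∀ p : Fin n, s.mem 24 [(p : ℕ)] = (x p).val) :
    (Program.ite (entry 11 [var v])
    (.loop 20 (var 0) (.ite (differ (var 20) (var v))
      (emitEvent (var v) (var 20 + .lit 2) (entry 24 [var 20])) .skip)) .skip).wp s fun s' =>
      (∀ b, b ≠ 20 → s'.mem b = s.mem b) ∧ s'.out = s.out ++ visible I
        (((List.finRange n).filter (· ≠ i)).map fun j => ⟨i, .party j, (x j).val⟩) := by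
  rw [List.map_eq_flatMap, flatMap_filter_ne, visible_flatMap]
  have hc : (entry 11 [var v]).eval s = if i ∈ I then 1 else 0 := by
    simp [hi, hE.corrupt i]
  refine Program.wp_ite (fun hi' t => ?_) fun hi' t => ?_
  · have hiI : i ∈ I := by
      by_contra hi''
      simp [hc, hi''] at hi'
    refine wp_emitLoop _ (fun s' => ∀ b, b ≠ 20 → s'.mem b = s.mem b) (by simp [hE.parties])
      (fun _ _ _ => rfl) fun j s' hs' t' => ?_
    have h1 : ∀ b, b ≠ 20 → ((s'.write 20 [] j).tick t').mem b = s.mem b := fun b hb => by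
      rw [State.mem_tick, State.mem_write_of_ne _ _ _ hb, hs' b hb]
    have h20 : ((s'.write 20 [] j).tick t').mem 20 [] = j := by simp [State.mem_write]
    have ho : ((s'.write 20 [] j).tick t').out = s'.out := rfl
    generalize (s'.write 20 [] j).tick t' = s₁ at *
    have hd := eval_differ s₁ (var 20) (var v)
    rw [eval_var, eval_var, h20, h1 v hv, hi] at hd
    refine Program.wp_ite (fun hne t'' => ?_) fun he t'' => Program.wp_skip ⟨h1, ?_⟩
    · have hji : j ≠ i := fun hh => hne (hd.2 (congrArg Fin.val hh))
      refine wp_emitEvent.mono fun s'' ⟨h2, h3⟩ => ⟨fun b hb => ?_, ?_⟩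
      · rw [h2]
        exact h1 b hb
      · rw [h3, State.out_tick, ho, if_pos hji, visible_singleton, if_pos hiI]
        congr 1
        simp only [eval_var, State.mem_tick, eval_add, eval_lit, eval_entry, List.map_cons,
          List.map_nil, h20, h1 v hv, hi, h1 24 (by decide), hx j, Event.code, Source.code]
    · have hji : j = i := Fin.ext (hd.1 he)
      simp [hji, ho, visible]
  · have hiI : i ∉ I := by
      intro hi''
      simp [hc, hi''] at hi'
    refine Program.wp_skip ⟨fun _ _ => rfl, ?_⟩
    have : ∀ j : Fin n, visible I (if j ≠ i then [(⟨i, .party j, (x j).val⟩ : Event n)] else []) =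
        [] := fun j => by
      split_ifs
      · rw [visible_singleton, if_neg hiI]
      · rfl
    rw [List.flatMap_eq_nil_iff.2 fun j _ => this j]
    simp

/-- The coalition also receives the share of `h`, which is forced by the value and the other shares.
Knowing the value in variable `25` is therefore all that an opening requires. -/
theorem sim_reveal {q : ℕ} [NeZero q] {md : Modulus} (hq : md.Has k q) {x : Sharing n q}
    (hE : Env P d I h s) (hx : Holds h s 24 [] x) (hv : s.mem 25 [] = (∑ p, x p).val) :
    Sim I (reveal x) (revealing md) s fun v s' => v = ∑ p, x p ∧
      ∀ b, b < 20 ∨ 24 < b → s'.mem b = s.mem b := by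
  refine Sim.pre (wp_closing hq hE hE.honest (by decide) hx hv) fun s₁ ⟨h1, h2⟩ => ?_
  refine Sim.map (m := record _) (R := fun _ s' => ∀ b, b < 20 ∨ 24 < b → s'.mem b = s.mem b)
    (Sim.record ?_) fun _ _ h => ⟨rfl, h⟩
  have hE₁ := hE.frame (s' := s₁) fun b hb => h2 b (by omega) (by omega) (by omega)
  rw [visible_flatMap]
  refine (wp_emitLoop _ (fun s' => ∀ b, b ≠ 20 → b ≠ 21 → s'.mem b = s₁.mem b)
    (by simp [hE₁.parties]) (fun _ _ _ _ => rfl) fun i s' hs' t => ?_).mono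
      fun s' ⟨h3, h4⟩ => ⟨h4, fun b hb => ?_⟩
  · have h3 : ∀ b, b ≠ 20 → b ≠ 21 → ((s'.write 21 [] i).tick t).mem b = s₁.mem b :=
      fun b hb hb' => by rw [State.mem_tick, State.mem_write_of_ne _ _ _ hb', hs' b hb hb']
    refine (wp_receive (hE₁.frame fun b hb => h3 b (by omega) (by omega)) (by decide)
      i (by simp [State.mem_write]) fun p => ?_).mono fun s'' ⟨h4, h5⟩ => ⟨fun b hb hb' => ?_, h5⟩
    · rw [h3 24 (by decide) (by decide), h1]
    · rw [h4 b hb, h3 b hb hb']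
  · rw [h3 b (by omega) (by omega), h2 b (by omega) (by omega) (by omega)]

/-- Draw random numbers, one for every party `p = var 20`. -/
def tossing (a : ℕ) (l : List Expr) (md : Modulus) : Program :=
  .loop 20 (var 0) (toss a (l ++ [var 20]) md.digits)

/-- As `q` is a power of two, fair coins hit every residue with exactly the same probability.
Perfect rather than statistical simulation depends on this. -/
theorem sim_sample_one {q : ℕ} [NeZero q] {md : Modulus} (hq : md.Has k q) {a : ℕ} {l : List Expr}
    (hE : Env P d I h s) : Sim I (sample (ZMod q)) (toss a l md.digits) s fun z s' =>
      ∃ t, s' = (s.write a (l.map fun e => e.eval s) z.val).tick t := by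
  intro base log hlog
  obtain ⟨t, ht⟩ := toss_exec a l md.digits s
  rw [ht, run_sample]
  have h1 : randomBits (md.digits.eval s) = (PMF.uniformOfFintype (ZMod q)).map ZMod.val := by
    have hq' := hq.digits_eval hE
    have hb : Function.Bijective (fun v : Fin (2 ^ md.digits.eval s) => ((v : ℕ) : ZMod q)) := by
      rw [Fintype.bijective_iff_injective_and_card]
      constructor
      · intro v w hvw
        have := congrArg ZMod.val hvw
        simp only at this
        rw [ZMod.val_cast_of_lt (hq' ▸ v.2), ZMod.val_cast_of_lt (hq' ▸ w.2)] at this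
        exact Fin.ext this
      · rw [Fintype.card_fin, ZMod.card, ← hq']
    rw [randomBits_eq, ← uniform_map_bijective hb, PMF.map_comp]
    congr 1
    funext v
    exact (ZMod.val_cast_of_lt (hq' ▸ v.2)).symm
  rw [h1, PMF.bind_map]
  refine ⟨(PMF.uniformOfFintype (ZMod q)).map fun z =>
    ((z, log), (s.write a (l.map fun e => e.eval s) z.val).tick t), ?_, ?_, ?_⟩
  · rw [PMF.map_comp]
    rfl
  · rw [PMF.map_comp]
    rfl
  · intro y hy
    obtain ⟨z, -, rfl⟩ := (PMF.mem_support_map_iff _ _ _).1 hy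
    exact ⟨hlog, t, rfl⟩

theorem sim_sample {q : ℕ} [NeZero q] {md : Modulus} (hq : md.Has k q) {a : ℕ} {l : List Expr}
    {pre : List ℕ} (hE : Env P d I h s) (ha : 20 < a)
    (hl : ∀ s', Agree n a pre s s' → (l.map fun e => e.eval s') = pre) :
    Sim I (sample (Sharing n q)) (tossing a l md) s fun x s' =>
      (∀ p : Fin n, s'.mem a (pre ++ [(p : ℕ)]) = (x p).val) ∧ Agree n a pre s s' := by
  rw [sample_pi]
  refine (Sim.forFin (by simp [hE.parties]) (Agree n a pre s)
    (fun i z s' => s'.mem a (pre ++ [(i : ℕ)]) = z.val) (fun _ => ⟨fun _ _ => rfl, fun _ _ _ => rfl⟩)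
    fun i s₁ h₁ t => ?_).mono fun x s' ⟨h1, h2⟩ => ⟨h2, h1⟩
  have h2 : Agree n a pre s ((s₁.write 20 [] i).tick t) := by
    refine ⟨fun l hl => ?_, fun b hb hb' => ?_⟩
    · rw [State.mem_tick, State.mem_write_of_ne _ _ _ (by omega), h₁.other l hl]
    · rw [State.mem_tick, State.mem_write_of_ne _ _ _ hb', h₁.frame b hb hb']
  have h3 : ((s₁.write 20 [] i).tick t).mem a = s₁.mem a := by
    rw [State.mem_tick, State.mem_write_of_ne _ _ _ (by omega)]
  have h20 : ((s₁.write 20 [] i).tick t).mem 20 [] = i := by simp [State.mem_write]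
  generalize (s₁.write 20 [] i).tick t = s₂ at *
  refine (sim_sample_one hq (hE.frame fun b hb => h2.frame b (by omega) (by omega))).mono ?_
  rintro z _ ⟨t', rfl⟩
  simp only [List.map_append, hl _ h2, List.map_cons, List.map_nil, eval_var, h20, State.mem_tick]
  refine ⟨⟨fun l hl' => ?_, fun b hb hb' => ?_⟩, ?_, fun j z' hj hz' => ?_⟩
  · rw [State.mem_tick, State.mem_write, if_neg (by simpa using hl' i), h2.other l hl']
  · rw [State.mem_tick, State.mem_write_of_ne _ _ _ hb, h2.frame b hb hb']
  · simp [State.mem_write]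
  · rw [State.mem_write, if_neg (by simpa using fun hh => hj.ne (Fin.ext hh)), h3, hz']

/-! ## Changes of variables -/

/-- Once the other shares are fixed, the share of `h` and the masked value determine each other.
Hence the masked value is uniform and independent of all shares but that of `h`, whatever `X` is.
Beaver triples use `e = -1`, edaBits `e = 1`. -/
theorem bijective_mask {q : ℕ} [NeZero q] (h : Fin n) (X : ZMod q) (e : ZMod q) (he : e * e = 1) :
    Function.Bijective fun a : Sharing n q => Function.update a h (X + e * ∑ p, a p) := by
  refine Finite.injective_iff_bijective.1 fun a b hab => ?_
  have h1 : ∀ p, p ≠ h → a p = b p := fun p hp => by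
    simpa [Function.update_of_ne hp] using congrFun hab p
  have h2 : X + e * ∑ p, a p = X + e * ∑ p, b p := by simpa using congrFun hab h
  have h3 : ∑ p, a p = ∑ p, b p := by
    -- Multiplication by `e` is its own inverse.
    have := congrArg (e * ·) (add_left_cancel h2)
    simpa [← mul_assoc, he] using this
  rw [← Finset.add_sum_erase _ _ (Finset.mem_univ h), ← Finset.add_sum_erase _ b (Finset.mem_univ h),
    Finset.sum_congr rfl fun p hp => h1 p (Finset.ne_of_mem_erase hp)] at h3
  funext p
  by_cases hp : p = h
  · subst hp
    exact add_right_cancel h3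
  · exact h1 p hp

/-- `complete` discards `u i`, while the share of `i` determines `u h` once the other shares are
known. Storing the idle `u i` in the place of `h` gives a bijection, so the shares of the parties
other than `h` are uniform for every shared value. -/
theorem bijective_complete {q : ℕ} [NeZero q] {h i : Fin n} (hi : i ≠ h) (x : ZMod q) :
    Function.Bijective fun u : Sharing n q => Function.update (complete i x u) h (u i) := by
  refine Finite.injective_iff_bijective.1 fun u v huv => ?_
  have h1 : ∀ p, p ≠ h → p ≠ i → u p = v p := fun p hp hpi => by
    simpa [Function.update_of_ne hp, complete, Function.update_of_ne hpi] using congrFun huv p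
  have h2 : u i = v i := by simpa using congrFun huv h
  have h3 : ∑ p ∈ Finset.univ.erase i, u p = ∑ p ∈ Finset.univ.erase i, v p := by
    simpa [Function.update_of_ne hi, complete] using congrFun huv i
  have hm : h ∈ Finset.univ.erase i := Finset.mem_erase.2 ⟨hi.symm, Finset.mem_univ _⟩
  rw [← Finset.add_sum_erase _ _ hm, ← Finset.add_sum_erase _ v hm,
    Finset.sum_congr rfl fun p hp => h1 p (Finset.ne_of_mem_erase hp)
      (Finset.ne_of_mem_erase (Finset.mem_of_mem_erase hp))] at h3
  funext p
  by_cases hp : p = h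
  · subst hp
    exact add_right_cancel h3
  · by_cases hpi : p = i
    · subst hpi
      exact h2
    · exact h1 p hp hpi

/-- The masks of the parties and, as entry `h`, the masked value. -/
theorem sim_sample_mask {q : ℕ} [NeZero q] {md : Modulus} (hq : md.Has k q) {a : ℕ}
    (hE : Env P d I h s) (ha : 20 < a) (X e : ZMod q) (he : e * e = 1) :
    Sim I (sample (Sharing n q)) (tossing a [] md) s fun x s' =>
      Holds h s' a [] x ∧ s'.mem a [(h : ℕ)] = (X + e * ∑ p, x p).val ∧ Agree n a [] s s' := by
  refine (Sim.sample_bijective (bijective_mask h X e he) (sim_sample hq (pre := []) hE ha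
    fun _ _ => rfl)).mono fun x s' ⟨h1, h2⟩ => ⟨fun p hp => ?_, ?_, h2⟩
  · rw [h1 p, Function.update_of_ne hp]
  · simpa using h1 h

/-- The shares of `complete i x u` that belong to parties other than `h`. -/
theorem sim_sample_complete {q : ℕ} [NeZero q] {md : Modulus} (hq : md.Has k q) {a : ℕ}
    {l : List Expr} {pre : List ℕ} (hE : Env P d I h s) (ha : 20 < a)
    (hl : ∀ s', Agree n a pre s s' → (l.map fun e => e.eval s') = pre) (i : Fin n) (x : ZMod q) :
    Sim I (sample (Sharing n q)) (tossing a l md) s fun u s' =>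
      Holds h s' a pre (complete i x u) ∧ Agree n a pre s s' := by
  -- If `h` itself holds the completing share, the other shares are entries of `u` and no change of
  -- variables is needed.
  by_cases hi : i = h
  · subst hi
    refine (sim_sample hq hE ha hl).mono fun u s' ⟨h1, h2⟩ => ⟨fun p hp => ?_, h2⟩
    rw [h1 p, complete, Function.update_of_ne hp]
  · refine (Sim.sample_bijective (bijective_complete hi x) (sim_sample hq hE ha hl)).mono
      fun u s' ⟨h1, h2⟩ => ⟨fun p hp => ?_, h2⟩
    rw [h1 p, Function.update_of_ne hp]

end Primitives

/-! ## Simulation of the subprotocols -/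

/-- The states agree, except for the arrays `20, …, hi - 1`. -/
def Same (hi : ℕ) (s s' : State) : Prop := ∀ b, b < 20 ∨ hi ≤ b → s'.mem b = s.mem b

/-- The expressions in `l` have the values `pre`, and do not depend on the arrays
`20, …, hi - 1`. -/
def Fixed (hi : ℕ) (s : State) (l : List Expr) (pre : List ℕ) : Prop :=
  ∀ s', Same hi s s' → (l.map fun e => e.eval s') = pre

/-- The expressions in `l` have the values `pre`, and depend neither on the array `a` nor on the
variable `20`. -/
def Stable (a : ℕ) (s : State) (l : List Expr) (pre : List ℕ) : Prop :=
  ∀ s', (∀ b, b ≠ a → b ≠ 20 → s'.mem b = s.mem b) → (l.map fun e => e.eval s') = pre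

/-! ### Frame conditions for nested scratch ranges -/

section Same

variable {n k d q : ℕ} {P : Params k} {I : Finset (Fin n)} {h : Fin n} {s s' s'' : State}
  {hi hi' : ℕ}

theorem Same.refl (s : State) : Same hi s s := fun _ _ => rfl

theorem Same.trans (h₁ : Same hi s s') (h₂ : Same hi s' s'') : Same hi s s'' :=
  fun b hb => (h₂ b hb).trans (h₁ b hb)

theorem Same.mono (hs : Same hi s s') (h : hi ≤ hi') : Same hi' s s' :=
  fun b hb => hs b (by omega)

theorem Same.env (hs : Same hi s s') (hE : Env P d I h s) : Env P d I h s' :=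
  hE.frame fun b hb => hs b (Or.inl hb)

/-- Scratch ranges are nested: a subprotocol works in the arrays `20, …, hi - 1`, and its caller
keeps from `hi` on what has to survive. -/
theorem Same.holds {a : ℕ} {pre : List ℕ} {x : Sharing n q} (hs : Same hi s s') (ha : hi ≤ a)
    (hx : Holds h s a pre x) : Holds h s' a pre x := fun p hp => by
  rw [hs a (Or.inr ha)]
  exact hx p hp

theorem Same.fixed {l : List Expr} {pre : List ℕ} (hs : Same hi s s') (h : Fixed hi s l pre) :
    Fixed hi s' l pre := fun _ h' => h _ (hs.trans h')

theorem Fixed.mono {l : List Expr} {pre : List ℕ} (hl : Fixed hi s l pre) (h : hi' ≤ hi) :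
    Fixed hi' s l pre := fun _ h' => hl _ (h'.mono h)

theorem Fixed.nil : Fixed hi s [] [] := fun _ _ => rfl

theorem Stable.nil {a : ℕ} : Stable a s [] [] := fun _ _ => rfl

theorem Fixed.stable {l : List Expr} {pre : List ℕ} {a : ℕ} (hl : Fixed hi s l pre)
    (ha : 20 ≤ a ∧ a < hi) : Stable a s l pre :=
  fun s' hs' => hl s' fun b hb => hs' b (by omega) (by omega)

theorem Stable.append_var {l : List Expr} {pre : List ℕ} {a v i : ℕ} (hl : Stable a s l pre)
    (hv : v ≠ a) (hv' : v ≠ 20) (hvi : s.mem v [] = i) :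
    Stable a s (l ++ [SecureDL.var v]) (pre ++ [i]) := fun s' hs' => by
  simp [hl s' hs', hs' v hv hv', hvi]

theorem Stable.var {a v i : ℕ} (hv : v ≠ a) (hv' : v ≠ 20) (hvi : s.mem v [] = i) :
    Stable a s [SecureDL.var v] [i] :=
  Stable.nil.append_var hv hv' hvi

theorem Fixed.append_var {l : List Expr} {pre : List ℕ} {v i : ℕ} (hl : Fixed hi s l pre)
    (hv : hi ≤ v) (hvi : s.mem v [] = i) : Fixed hi s (l ++ [var v]) (pre ++ [i]) := fun s' hs' => by
  simp [hl s' hs', hs' v (Or.inr hv), hvi]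

theorem Fixed.var {v i : ℕ} (hv : hi ≤ v) (hvi : s.mem v [] = i) : Fixed hi s [var v] [i] :=
  Fixed.nil.append_var hv hvi

theorem Same.loop (hs : Same hi s s') {v : ℕ} (hv : 20 ≤ v ∧ v < hi) (i t : ℕ) :
    Same hi s ((s'.write v [] i).tick t) := fun b hb => by
  rw [State.mem_tick, State.mem_write_of_ne _ _ _ (by omega), hs b hb]

theorem Agree.same {a : ℕ} {pre : List ℕ} (hA : Agree n a pre s s') (ha : 20 ≤ a ∧ a < hi) :
    Same hi s s' := fun b hb => hA.frame b (by omega) (by omega)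

theorem Agree.holds {a b : ℕ} {pre pre' : List ℕ} {x : Sharing n q} (hA : Agree n a pre s s')
    (hb : b ≠ a) (hb' : b ≠ 20) (hx : Holds h s b pre' x) : Holds h s' b pre' x := fun p hp => by
  rw [hA.frame b hb hb']
  exact hx p hp

theorem mem_loop (s : State) (v i t : ℕ) : ((s.write v [] i).tick t).mem v [] = i := by
  simp [State.mem_write]

end Same

/-! ### Tameness of the primitive programs -/

section Tame

variable {lo hi : ℕ}

@[simp] theorem tame_fill {a : ℕ} {l : List Expr} {e : Expr} : (fill a l e).Tame lo hi ↔
    (lo ≤ 20 ∧ 20 < hi) ∧ (lo ≤ a ∧ a < hi) ∧ e.Small := by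
  simp [fill]

@[simp] theorem tame_emitEvent {o src v : Expr} : (emitEvent o src v).Tame lo hi := by
  simp [emitEvent]

@[simp] theorem tame_dealing {a : ℕ} {l : List Expr} : (dealing a l).Tame lo hi ↔
    (lo ≤ 20 ∧ 20 < hi) := by
  simp [dealing]

@[simp] theorem tame_tossing {a : ℕ} {l : List Expr} {md : Modulus} : (tossing a l md).Tame lo hi ↔
    (lo ≤ 20 ∧ 20 < hi) ∧ (lo ≤ a ∧ a < hi) := by
  simp [tossing]

@[simp] theorem tame_revealing {md : Modulus} : (revealing md).Tame lo hi ↔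
    (lo ≤ 20 ∧ 24 < hi) := by
  simp [revealing, closing]
  omega

end Tame

/-! ### Multiplication, inversion and square root -/

section Subprotocols

variable {n k d : ℕ} {P : Params k} {I : Finset (Fin n)} {h : Fin n} {s : State}

/-- Copy the shares of all parties. -/
def copy (a : ℕ) (l : List Expr) (src : ℕ) (l' : List Expr) : Program :=
  fill a l (entry src (l' ++ [var 20]))

@[simp] theorem tame_copy {lo hi a src : ℕ} {l l' : List Expr} : (copy a l src l').Tame lo hi ↔
    (lo ≤ 20 ∧ 20 < hi) ∧ (lo ≤ a ∧ a < hi) := by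
  simp [copy]

theorem wp_copy {q a src : ℕ} {l l' : List Expr} {pre pre' : List ℕ} {x : Sharing n q}
    (hE : Env P d I h s) (ha : 20 < a) (hsrc : src ≠ a) (hsrc' : src ≠ 20)
    (hl : Stable a s l pre) (hl' : Stable a s l' pre') (hx : Holds h s src pre' x) :
    (copy a l src l').wp s fun s' => s'.out = s.out ∧ Holds h s' a pre x ∧ Agree n a pre s s' := by
  refine wp_fill pre x hE ha fun p s' hA h20 _ _ => ?_
  refine ⟨hl s' hA.frame, fun hp => ?_⟩
  rw [eval_entry, List.map_append, hl' s' hA.frame, ← hx p hp, hA.frame src hsrc hsrc']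
  simp [h20]

/-- Open a value to all parties: `e` is the share of the party in the variable `20`, and `v` is the
value. -/
def opening (md : Modulus) (e v : Expr) : Program :=
  fill 24 [] (e % md.order) ;; assign 25 [] (v % md.order) ;; revealing md

@[simp] theorem tame_opening {lo hi : ℕ} {md : Modulus} {e v : Expr} :
    (opening md e v).Tame lo hi ↔ lo ≤ 20 ∧ 25 < hi := by
  simp [opening]
  omega

/-- `e` and `v` have to be right only modulo `q`, and `e` only for parties other than `h`. Array
`24` is being filled while `e` is evaluated, so it may not be relied on. -/
theorem sim_opening {q : ℕ} [NeZero q] {md : Modulus} (hq : md.Has k q) {x : Sharing n q}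
    {e v : Expr} (hE : Env P d I h s)
    (he : ∀ (p : Fin n) (s' : State), (∀ b, b ≠ 20 → b ≠ 24 → s'.mem b = s.mem b) →
      s'.mem 20 [] = p → p ≠ h → Env P d I h s' → ((e.eval s' : ℕ) : ZMod q) = x p)
    (hv : ∀ s' : State, (∀ b, b ≠ 20 → b ≠ 24 → s'.mem b = s.mem b) → Env P d I h s' →
      ((v.eval s' : ℕ) : ZMod q) = ∑ p, x p) :
    Sim I (reveal x) (opening md e v) s fun w s' => w = ∑ p, x p ∧ Same 26 s s' := by
  refine Sim.pre (wp_fill [] x hE (by decide) fun p s' hA h20 _ hE' => ⟨rfl, fun hp => ?_⟩)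
    fun s₁ ⟨h1, h2⟩ => ?_
  · rw [eval_mod, hq.order_eval hE']
    exact mod_eq_val (he p s' (fun b hb hb' => hA.frame b hb' hb) h20 hp hE')
  · have hE₁ := (h2.same (hi := 26) (by decide)).env hE
    refine Sim.pre (Program.wp_assign (Q := fun s' => s'.out = s₁.out ∧
      s'.mem 25 [] = (∑ p, x p).val ∧ ∀ b, b ≠ 25 → s'.mem b = s₁.mem b) fun t => ⟨rfl, ?_, ?_⟩)
      fun s₂ ⟨h3, h4⟩ => ?_
    · rw [State.mem_tick, State.mem_write, if_pos ⟨rfl, rfl⟩, eval_mod, hq.order_eval hE₁]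
      exact mod_eq_val (hv s₁ (fun b hb hb' => h2.frame b hb' hb) hE₁)
    · exact fun b hb => by rw [State.mem_tick, State.mem_write_of_ne _ _ _ hb]
    · refine (sim_reveal hq (hE₁.frame fun b hb => h4 b (by omega)) (fun p hp => ?_) h3).mono
        fun w s' ⟨h5, h6⟩ => ⟨h5, fun b hb => ?_⟩
      · rw [h4 24 (by decide)]
        exact h1 p hp
      · rw [h6 b (by omega), h4 b (by omega), h2.frame b (by omega) (by omega)]

/-- Beaver multiplication of the values in the arrays `26` and `27`, with the result in `28`. -/
def multiplying (md : Modulus) : Program :=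
  tossing 29 [] md ;; tossing 30 [] md ;; tossing 31 [] md ;;
  dealing 29 [] ;; dealing 30 [] ;; dealing 31 [] ;;
  opening md (entry 26 [var 20] + (md.order - entry 29 [var 20])) (entry 29 [var 17]) ;;
  opening md (entry 27 [var 20] + (md.order - entry 30 [var 20])) (entry 30 [var 17]) ;;
  fill 28 [] ((entry 31 [var 20] + entry 30 [var 17] * entry 29 [var 20] +
    entry 29 [var 17] * entry 30 [var 20] +
    less (var 20) (.lit 1) * (entry 30 [var 17] * entry 29 [var 17])) % md.order)

@[simp] theorem tame_multiplying {lo hi : ℕ} {md : Modulus} :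
    (multiplying md).Tame lo hi ↔ lo ≤ 20 ∧ 31 < hi := by
  simp [multiplying]
  omega

/-- The entries of `h` in the arrays `29` and `30` are not shares but the values `δ` and `ε`, drawn
uniformly by `sim_sample_mask`. The shares of `c` are uniform by `sim_sample_complete`, although
`ab` is unknown. The rest repeats the computation of the parties other than `h`. -/
theorem sim_multiplying {q : ℕ} [NeZero n] [NeZero q] {md : Modulus} (hq : md.Has k q)
    {x y : Sharing n q} (hE : Env P d I h s) (hx : Holds h s 26 [] x) (hy : Holds h s 27 [] y) :
    Sim I (mulShares x y) (multiplying md) s fun z s' => Holds h s' 28 [] z ∧ Same 32 s s' := by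
  -- Unchanged arrays follow from tameness alone, which leaves only the result to be tracked.
  refine Sim.and_frame (Q := fun z s' => Holds h s' 28 [] z) (lo := 20) (hi := 32) ?_ (by simp)
  have hsum : ∀ x a : Sharing n q, ∑ p, x p + -1 * ∑ p, a p = ∑ p, (x - a) p := fun x a => by
    simp only [Pi.sub_apply, Finset.sum_sub_distrib]
    ring
  refine (sim_sample_mask hq hE (by decide) (∑ p, x p) (-1) (by ring)).bind
    fun a s₁ ⟨ha, hδ, hs₁⟩ => ?_
  rw [hsum x a] at hδ
  have hE₁ := (hs₁.same (hi := 32) (by decide)).env hE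
  refine (sim_sample_mask hq hE₁ (by decide) (∑ p, y p) (-1) (by ring)).bind
    fun b s₂ ⟨hb, hε, hs₂⟩ => ?_
  rw [hsum y b] at hε
  have hE₂ := (hs₂.same (hi := 32) (by decide)).env hE₁
  refine (sim_sample_complete hq (pre := []) hE₂ (by decide) (fun _ _ => rfl) 0
    ((∑ i, a i) * ∑ i, b i)).bind fun u s₃ ⟨hc, hs₃⟩ => ?_
  have hE₃ := (hs₃.same (hi := 32) (by decide)).env hE₂
  replace hx := hs₃.holds (by decide) (by decide) (hs₂.holds (by decide) (by decide)
    (hs₁.holds (by decide) (by decide) hx))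
  replace hy := hs₃.holds (by decide) (by decide) (hs₂.holds (by decide) (by decide)
    (hs₁.holds (by decide) (by decide) hy))
  replace ha := hs₃.holds (by decide) (by decide) (hs₂.holds (by decide) (by decide) ha)
  replace hb := hs₃.holds (by decide) (by decide) hb
  rw [← hs₂.frame 29 (by decide) (by decide), ← hs₃.frame 29 (by decide) (by decide)] at hδ
  rw [← hs₃.frame 30 (by decide) (by decide)] at hε
  clear hs₁ hs₂ hs₃
  refine (sim_deal hE₃ (by decide) (fun _ _ => rfl) ha).bind fun _ s₄ hs₄ => ?_
  have f₄ : Same 26 s₃ s₄ := fun b hb => hs₄ b (by omega)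
  refine (sim_deal (f₄.env hE₃) (by decide) (fun _ _ => rfl) (f₄.holds (by decide) hb)).bind
    fun _ s₅ hs₅ => ?_
  have f₅ : Same 26 s₃ s₅ := f₄.trans fun b hb => hs₅ b (by omega)
  refine (sim_deal (f₅.env hE₃) (by decide) (fun _ _ => rfl) (f₅.holds (by decide) hc)).bind
    fun _ s₆ hs₆ => ?_
  have f₆ : Same 26 s₃ s₆ := f₅.trans fun b hb => hs₆ b (by omega)
  clear f₄ f₅ hs₄ hs₅ hs₆
  refine (sim_opening hq (f₆.env hE₃) (fun p s' hs' h20 hp hE' => ?_) fun s' hs' hE' => ?_).bind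
    fun δ s₇ ⟨hδ', f₇⟩ => ?_
  · have h1 := hx p hp
    have h2 := ha p hp
    rw [List.nil_append, ← f₆ _ (by decide), ← hs' _ (by decide) (by decide)] at h1 h2
    simp [h20, h1, h2, hq.order_eval hE', natCast_sub_val, sub_eq_add_neg]
  · rw [← f₆ _ (by decide), ← hs' _ (by decide) (by decide)] at hδ
    simp [hE'.honest, hδ]
  replace f₇ := f₆.trans f₇
  refine (sim_opening hq (f₇.env hE₃) (fun p s' hs' h20 hp hE' => ?_) fun s' hs' hE' => ?_).bind
    fun ε s₈ ⟨hε', f₈⟩ => ?_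
  · have h1 := hy p hp
    have h2 := hb p hp
    rw [List.nil_append, ← f₇ _ (by decide), ← hs' _ (by decide) (by decide)] at h1 h2
    simp [h20, h1, h2, hq.order_eval hE', natCast_sub_val, sub_eq_add_neg]
  · rw [← f₇ _ (by decide), ← hs' _ (by decide) (by decide)] at hε
    simp [hE'.honest, hε]
  replace f₈ := f₇.trans f₈
  clear f₆ f₇
  refine Sim.pure ((wp_fill [] _ (f₈.env hE₃) (by decide) fun p s' hA h20 _ hE' => ⟨rfl, fun hp =>
    ?_⟩).mono fun s' hs' => ⟨hs'.1, hs'.2.1⟩)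
  have h1 := ha p hp
  have h2 := hb p hp
  have h3 := hc p hp
  rw [← f₈ _ (by decide), ← hA.frame _ (by decide) (by decide)] at h1 h2 h3 hδ hε
  rw [List.nil_append] at h1 h2 h3
  rw [eval_mod, hq.order_eval hE']
  apply mod_eq_val
  -- The factor `less (var 20) (.lit 1)` selects party `0`, which alone adds `εδ`.
  have hp0 : (p : ℕ) < 1 ↔ p = 0 := by rw [Nat.lt_one_iff, Fin.ext_iff, Fin.val_zero]
  simp only [eval_add, eval_mul, eval_less, eval_entry, eval_var, List.map_cons, List.map_nil, h20,
    hE'.honest, h1, h2, h3, hδ, hε, eval_lit, hp0]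
  rw [hδ', hε']
  split_ifs <;> simp

/-- Multiply the values in the arrays `r` and `r'`, with the result in `28`. -/
def times (md : Modulus) (r : ℕ) (l : List Expr) (r' : ℕ) (l' : List Expr) : Program :=
  copy 26 [] r l ;; copy 27 [] r' l' ;; multiplying md

@[simp] theorem tame_times {lo hi : ℕ} {md : Modulus} {r r' : ℕ} {l l' : List Expr} :
    (times md r l r' l').Tame lo hi ↔ lo ≤ 20 ∧ 31 < hi := by
  simp [times]
  omega

theorem sim_times {q : ℕ} [NeZero n] [NeZero q] {md : Modulus} (hq : md.Has k q) {r r' : ℕ}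
    {l l' : List Expr} {pre pre' : List ℕ} {x y : Sharing n q} (hE : Env P d I h s)
    (hr : 27 < r) (hr' : 27 < r') (hl : Fixed 28 s l pre) (hl' : Fixed 28 s l' pre')
    (hx : Holds h s r pre x) (hy : Holds h s r' pre' y) :
    Sim I (mulShares x y) (times md r l r' l') s fun z s' =>
      Holds h s' 28 [] z ∧ Same 32 s s' := by
  refine Sim.pre (wp_copy hE (by decide) (by omega) (by omega) Stable.nil (hl.stable (by decide)) hx)
    fun s₁ ⟨hx₁, hs₁⟩ => ?_
  have f₁ : Same 28 s s₁ := hs₁.same (by decide)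
  refine Sim.pre (wp_copy (f₁.env hE) (by decide) (by omega) (by omega) Stable.nil ((f₁.fixed hl').stable (by decide))
    (f₁.holds (by omega) hy)) fun s₂ ⟨hy₂, hs₂⟩ => ?_
  have f₂ : Same 28 s s₂ := f₁.trans (hs₂.same (by decide))
  exact (sim_multiplying hq (f₂.env hE) (hs₂.holds (by decide) (by decide) hx₁) hy₂).mono
    fun z s₃ ⟨h1, h2⟩ => ⟨h1, (f₂.mono (by decide)).trans h2⟩

/-- One step of the inversion. -/
def inversionStep : Program :=
  times .full 33 [] 34 [] ;; copy 36 [] 28 [] ;; times .full 34 [] 34 [] ;;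
  fill 33 [] ((entry 33 [var 20] + entry 33 [var 20] + (Modulus.full.order - entry 36 [var 20])) %
    Modulus.full.order) ;;
  fill 34 [] ((entry 34 [var 20] + entry 34 [var 20] + (Modulus.full.order - entry 28 [var 20])) %
    Modulus.full.order)

/-- Inversion of the value in the array `32`, with the result in `33`. -/
def inverting : Program :=
  fill 33 [] (less (var 20) (.lit 1) * var 6 % Modulus.full.order) ;;
  fill 34 [] (var 6 * entry 32 [var 20] % Modulus.full.order) ;;
  .loop 35 (var 4) inversionStep

@[simp] theorem tame_inversionStep {lo hi : ℕ} : inversionStep.Tame lo hi ↔ lo ≤ 20 ∧ 36 < hi := by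
  simp [inversionStep]
  omega

@[simp] theorem tame_inverting {lo hi : ℕ} : inverting.Tame lo hi ↔ lo ≤ 20 ∧ 36 < hi := by
  simp [inverting]
  omega

theorem sim_inversionStep [NeZero n] {B M : Sharing n (2 ^ k)} (hE : Env P d I h s)
    (hB : Holds h s 33 [] B) (hM : Holds h s 34 [] M) :
    Sim I (do
      let BM ← mulShares B M
      let MM ← mulShares M M
      pure (2 • B - BM, 2 • M - MM) : Prot n (Sharing n (2 ^ k) × Sharing n (2 ^ k)))
      inversionStep s fun z s' => Holds h s' 33 [] z.1 ∧ Holds h s' 34 [] z.2 := by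
  refine (sim_times (md := .full) rfl hE (by decide) (by decide) Fixed.nil Fixed.nil hB hM).bind
    fun BM s₁ ⟨hBM, f₁⟩ => ?_
  -- The second multiplication overwrites array `28`, so the first product has to move to `36`.
  refine Sim.pre (wp_copy (f₁.env hE) (by decide) (by decide) (by decide) Stable.nil Stable.nil hBM)
    fun s₂ ⟨hBM₂, hs₂⟩ => ?_
  replace hB := hs₂.holds (by decide) (by decide) (f₁.holds (by decide) hB)
  replace hM := hs₂.holds (by decide) (by decide) (f₁.holds (by decide) hM)
  have hE₂ := (hs₂.same (hi := 37) (by decide)).env (f₁.env hE)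
  refine (sim_times (md := .full) rfl hE₂ (by decide) (by decide) Fixed.nil Fixed.nil hM hM).bind
    fun MM s₃ ⟨hMM, f₃⟩ => ?_
  replace hB := f₃.holds (by decide) hB
  replace hM := f₃.holds (by decide) hM
  replace hBM := f₃.holds (by decide) hBM₂
  have hE₃ := f₃.env hE₂
  refine Sim.pure (Program.wp_seq ((wp_fill [] (2 • B - BM) hE₃ (by decide)
    fun p s' hA h20 hself hE' => ⟨rfl, fun hp => ?_⟩).mono fun s₄ ⟨h4, hB₄, hs₄⟩ =>
    (wp_fill [] (2 • M - MM) ((hs₄.same (hi := 37) (by decide)).env hE₃) (by decide)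
      fun p s' hA h20 hself hE' => ⟨rfl, fun hp => ?_⟩).mono fun s₅ ⟨h5, hM₅, hs₅⟩ =>
        ⟨h5.trans h4, hs₅.holds (by decide) (by decide) hB₄, hM₅⟩))
  · have h1 := hself.trans (hB p hp)
    have h2 := hBM p hp
    rw [← hA.frame _ (by decide) (by decide)] at h2
    rw [List.nil_append] at h1 h2
    rw [eval_mod, Modulus.Has.order_eval (md := .full) rfl hE']
    apply mod_eq_val
    simp [h20, h1, h2, Modulus.Has.order_eval (md := .full) rfl hE', natCast_sub_val, two_mul,
      sub_eq_add_neg]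
  · have h1 := hself.trans (hs₄.holds (by decide) (by decide) hM p hp)
    have h2 := hs₄.holds (by decide) (by decide) hMM p hp
    rw [← hA.frame _ (by decide) (by decide)] at h2
    rw [List.nil_append] at h1 h2
    rw [eval_mod, Modulus.Has.order_eval (md := .full) rfl hE']
    apply mod_eq_val
    simp [h20, h1, h2, Modulus.Has.order_eval (md := .full) rfl hE', natCast_sub_val, two_mul,
      sub_eq_add_neg]

theorem pub_apply [NeZero n] {q : ℕ} (c : ZMod q) (p : Fin n) :
    (pub c : Sharing n q) p = if (p : ℕ) < 1 then c else 0 := by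
  have hp0 : (p : ℕ) < 1 ↔ p = 0 := by rw [Nat.lt_one_iff, Fin.ext_iff, Fin.val_zero]
  simp [pub, hp0]

theorem sim_inverting [NeZero n] {X : Sharing n (2 ^ k)} (hE : Env P d I h s)
    (hX : Holds h s 32 [] X) :
    Sim I (invShares P X) inverting s fun z s' => Holds h s' 33 [] z ∧ Same 37 s s' := by
  refine Sim.and_frame (Q := fun z s' => Holds h s' 33 [] z) (lo := 20) (hi := 37) ?_ (by simp)
  refine Sim.pre (wp_fill [] (pub P.cInv) hE (by decide) fun p s' hA h20 _ hE' => ⟨rfl, fun _ => ?_⟩)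
    fun s₁ ⟨hB, hs₁⟩ => ?_
  · rw [eval_mod, Modulus.Has.order_eval (md := .full) rfl hE']
    apply mod_eq_val
    rw [pub_apply]
    simp [h20, hE'.cInv]
  have hE₁ := (hs₁.same (hi := 37) (by decide)).env hE
  refine Sim.pre (wp_fill [] (P.cInv • X) hE₁ (by decide)
    fun p s' hA h20 _ hE' => ⟨rfl, fun hp => ?_⟩) fun s₂ ⟨hM, hs₂⟩ => ?_
  · have h1 := hs₁.holds (by decide) (by decide) hX p hp
    rw [← hA.frame _ (by decide) (by decide), List.nil_append] at h1
    rw [eval_mod, Modulus.Has.order_eval (md := .full) rfl hE']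
    apply mod_eq_val
    simp [h20, hE'.cInv, h1]
  have hE₂ := (hs₂.same (hi := 37) (by decide)).env hE₁
  have hT : P.invIters = (var 4).eval s₂ := by simp [hE₂.invIters]
  rw [invShares, hT]
  -- `invLoop` is tail recursive in the pair `(B, M)` and returns the first component.
  refine (Sim.iterate (F := fun T (a : Sharing n (2 ^ k) × Sharing n (2 ^ k)) =>
    invLoop T a.1 a.2) (g := Prod.fst) (fun _ => rfl) (step := fun a => do
      let BM ← mulShares a.1 a.2
      let MM ← mulShares a.2 a.2
      pure (2 • a.1 - BM, 2 • a.2 - MM)) (fun T a => by simp [invLoop])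
    (fun a s' => Holds h s' 33 [] a.1 ∧ Holds h s' 34 [] a.2 ∧ Same 37 s₂ s')
    (a := (pub P.cInv, P.cInv • X))
    (fun t => ⟨hs₂.holds (by decide) (by decide) hB, hM, fun _ _ => rfl⟩)
    fun a s' ⟨h1, h2, h3⟩ i t => ?_).mono ?_
  · have f := (Same.refl (hi := 37) s').loop (v := 35) (by decide) i t
    exact ((sim_inversionStep (f.env (h3.env hE₂)) h1 h2).and_frame (lo := 20) (hi := 37)
      (by simp)).mono fun z s'' ⟨h4, h5⟩ => ⟨h4.1, h4.2, (h3.trans f).trans h5⟩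
  · rintro z s' ⟨a, rfl, h1, -⟩
    exact h1

/-- Square root of the value in the array `37`, with the result in `38`. -/
def rooting : Program :=
  fill 38 [] (less (var 20) (.lit 1) * var 7 % Modulus.full.order) ;;
  .loop 39 (var 5) (copy 32 [] 38 [] ;; inverting ;; times .full 37 [] 33 [] ;;
    fill 38 [] (var 8 * (entry 38 [var 20] + entry 28 [var 20]) % Modulus.full.order))

@[simp] theorem tame_rooting {lo hi : ℕ} : rooting.Tame lo hi ↔ lo ≤ 20 ∧ 39 < hi := by
  simp [rooting]
  omega

/-- `Y` sits in array `37`, just above the scratch range of `inverting`, so it survives every round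
and need not be part of the iterated value. -/
theorem sim_rooting [NeZero n] {Y : Sharing n (2 ^ k)} (hE : Env P d I h s)
    (hY : Holds h s 37 [] Y) :
    Sim I (sqrtShares P Y) rooting s fun z s' => Holds h s' 38 [] z ∧ Same 40 s s' := by
  refine Sim.and_frame (Q := fun z s' => Holds h s' 38 [] z) (lo := 20) (hi := 40) ?_ (by simp)
  refine Sim.pre (wp_fill [] (pub P.guess) hE (by decide) fun p s' hA h20 _ hE' =>
    ⟨rfl, fun _ => ?_⟩) fun s₁ ⟨hx, hs₁⟩ => ?_
  · rw [eval_mod, Modulus.Has.order_eval (md := .full) rfl hE']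
    apply mod_eq_val
    rw [pub_apply]
    simp [h20, hE'.guess]
  have hE₁ := (hs₁.same (hi := 40) (by decide)).env hE
  have hT : P.sqrtIters = (var 5).eval s₁ := by simp [hE₁.sqrtIters]
  rw [sqrtShares, hT]
  refine (Sim.iterate (F := sqrtLoop P Y) (g := id) (fun _ => rfl) (step := fun x => do
      let z ← invShares P x
      let y ← mulShares Y z
      pure (P.half • (x + y))) (fun T x => by simp [sqrtLoop])
    (fun x s' => Holds h s' 38 [] x ∧ Holds h s' 37 [] Y ∧ Env P d I h s')
    (fun t => ⟨hx, hs₁.holds (by decide) (by decide) hY, hE₁.frame fun _ _ => rfl⟩)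
    fun x s' ⟨h1, h2, h3⟩ i t => ?_).mono ?_
  · have f := (Same.refl (hi := 40) s').loop (v := 39) (by decide) i t
    replace h1 : Holds h ((s'.write 39 [] i).tick t) 38 [] x := h1
    replace h2 : Holds h ((s'.write 39 [] i).tick t) 37 [] Y := h2
    replace h3 := f.env h3
    generalize (s'.write 39 [] i).tick t = s₂ at *
    clear f
    refine Sim.pre (wp_copy h3 (by decide) (by decide) (by decide) Stable.nil Stable.nil h1)
      fun s₃ ⟨h4, hs₃⟩ => ?_
    refine (sim_inverting ((hs₃.same (hi := 37) (by decide)).env h3) h4).bind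
      fun z s₄ ⟨h5, f₄⟩ => ?_
    replace f₄ := (hs₃.same (hi := 37) (by decide)).trans f₄
    refine (sim_times (md := .full) rfl (f₄.env h3) (by decide) (by decide) Fixed.nil Fixed.nil
      (f₄.holds (by decide) h2) h5).bind fun y s₅ ⟨h6, f₅⟩ => ?_
    replace f₅ := f₄.trans (f₅.mono (by decide))
    refine Sim.pure ((wp_fill [] (P.half • (x + y)) (f₅.env h3) (by decide)
      fun p s' hA h20 hself hE' => ⟨rfl, fun hp => ?_⟩).mono fun s₆ ⟨h7, h8, hs₆⟩ => ⟨h7, h8,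
        hs₆.holds (by decide) (by decide) (f₅.holds (by decide) h2),
        (hs₆.same (hi := 40) (by decide)).env (f₅.env h3)⟩)
    have e1 := hself.trans (f₅.holds (by decide) h1 p hp)
    have e2 := h6 p hp
    rw [← hA.frame _ (by decide) (by decide)] at e2
    rw [List.nil_append] at e1 e2
    rw [eval_mod, Modulus.Has.order_eval (md := .full) rfl hE']
    apply mod_eq_val
    simp [h20, hE'.half, e1, e2]
  · rintro z s' ⟨a, rfl, h1, -⟩
    exact h1

end Subprotocols

/-! ### Sums and inner products -/

section Vectors

variable {n k d : ℕ} {P : Params k} {I : Finset (Fin n)} {h : Fin n} {s : State}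

/-- Sum of the values `e`, where the variable `v` runs up to `b`. -/
def summing (v : ℕ) (b : Expr) (a : ℕ) (e : Expr) : Program :=
  fill a [] (.lit 0) ;; .loop v b (fill a [] ((entry a [var 20] + e) % Modulus.full.order))

@[simp] theorem tame_summing {lo hi v a : ℕ} {b e : Expr} : (summing v b a e).Tame lo hi ↔
    (lo ≤ 20 ∧ 20 < hi) ∧ (lo ≤ a ∧ a < hi) ∧ (lo ≤ v ∧ v < hi) ∧ b.Short := by
  simp [summing]
  tauto

theorem wp_summing {m v a : ℕ} {b e : Expr} (x : Fin m → Sharing n (2 ^ k)) (hE : Env P d I h s)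
    (ha : 20 < a) (hv : 20 < v) (hav : a ≠ v)
    (hb : ∀ s', Env P d I h s' → b.eval s' = m)
    (he : ∀ (i : Fin m) (p : Fin n) (s' : State),
      (∀ b, b ≠ 20 → b ≠ a → b ≠ v → s'.mem b = s.mem b) → s'.mem 20 [] = p → s'.mem v [] = i →
      p ≠ h → Env P d I h s' → e.eval s' = (x i p).val) :
    (summing v b a e).wp s fun s' => s'.out = s.out ∧ Holds h s' a [] (∑ i, x i) ∧
      ∀ b, b ≠ 20 → b ≠ a → b ≠ v → s'.mem b = s.mem b := by
  refine Program.wp_seq ((wp_fill [] (0 : Sharing n (2 ^ k)) hE ha fun p s' _ _ _ _ =>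
    ⟨rfl, fun _ => by simp⟩).mono fun s₁ ⟨h1, h2, h3⟩ => ?_)
  -- Extension by `0`, so that the loop counter can index partial sums. The accumulator is updated
  -- in place, as `wp_fill` permits.
  let F : ℕ → Sharing n (2 ^ k) := fun i => if hi : i < m then x ⟨i, hi⟩ else 0
  have hE₁ := hE.frame fun b hb => h3.frame b (by omega) (by omega)
  refine Program.wp_loop (fun i s' => s'.out = s.out ∧ Holds h s' a [] (∑ j ∈ Finset.range i, F j) ∧
    ∀ b, b ≠ 20 → b ≠ a → b ≠ v → s'.mem b = s.mem b) (fun t => ⟨h1, by simpa [Holds] using h2,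
      fun b hb hb' _ => ?_⟩)
    (fun i hi s' ⟨h4, h5, h6⟩ t => ?_) fun s' ⟨h4, h5, h6⟩ => ⟨h4, ?_, h6⟩
  · exact h3.frame b hb' hb
  · rw [hb _ hE₁] at hi
    have h7 : ∀ b, b ≠ v → ((s'.write v [] i).tick t).mem b = s'.mem b := fun b hb => by
      rw [State.mem_tick, State.mem_write_of_ne _ _ _ hb]
    have h8 := mem_loop s' v i t
    have h9 : ((s'.write v [] i).tick t).out = s.out := h4
    generalize (s'.write v [] i).tick t = s₂ at *
    have hE₂ : Env P d I h s₂ := hE.frame fun b hb => by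
      rw [h7 b (by omega), h6 b (by omega) (by omega) (by omega)]
    refine (wp_fill [] (∑ j ∈ Finset.range (i + 1), F j) hE₂ ha fun p s₃ hA h20 hself hE₃ =>
      ⟨rfl, fun hp => ?_⟩).mono fun s₃ ⟨h10, h11, h12⟩ => ⟨h10.trans h9, h11, fun b hb hb' hb'' => ?_⟩
    · rw [eval_mod, Modulus.Has.order_eval (md := .full) rfl hE₃]
      apply mod_eq_val
      have e1 := he ⟨i, hi⟩ p s₃ (fun b hb hb' hb'' => by
        rw [hA.frame b hb' hb, h7 b hb'', h6 b hb hb' hb'']) h20 (by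
          rw [hA.frame v hav.symm (by omega), h8]) hp hE₃
      have e2 := h5 p hp
      rw [← h7 a hav, ← hself, List.nil_append] at e2
      rw [Finset.sum_range_succ]
      simp only [eval_add, eval_entry, List.map_cons, List.map_nil, eval_var, h20, e1, e2,
        Nat.cast_add, ZMod.natCast_zmod_val, Pi.add_apply]
      simp [F, hi]
    · rw [h12.frame b hb' hb, h7 b hb'', h6 b hb hb' hb'']
  · rw [hb _ hE₁, Finset.sum_range] at h5
    simpa [F] using h5

/-- Inner product of two vectors of length `var 2`, with the result in the array `44`. -/
def dotting (r : ℕ) (l : List Expr) (r' : ℕ) (l' : List Expr) : Program :=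
  .loop 42 (var 2) (times .full r (l ++ [var 42]) r' (l' ++ [var 42]) ;; copy 43 [var 42] 28 []) ;;
  summing 45 (var 2) 44 (entry 43 [var 45, var 20])

@[simp] theorem tame_dotting {lo hi r r' : ℕ} {l l' : List Expr} :
    (dotting r l r' l').Tame lo hi ↔ lo ≤ 20 ∧ 45 < hi := by
  simp [dotting]
  omega

/-- A table whose entry at `i` has been replaced. -/
theorem Agree.holds_of_ne {q a : ℕ} {s' : State} {pre : List ℕ} {i j : ℕ} {x : Sharing n q}
    (hA : Agree n a (pre ++ [i]) s s') (hij : j ≠ i) (hx : Holds h s a (pre ++ [j]) x) :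
    Holds h s' a (pre ++ [j]) x := fun p hp => by
  rw [hA.other _ fun p' hp' => hij ?_]
  · exact hx p hp
  · have := (List.append_inj_left' hp' rfl)
    simpa using this

/-- Array `28` is reused by every multiplication, so each product is moved to its own row of table
`43`; later rounds change other rows only. -/
theorem sim_dotting [NeZero n] {r r' : ℕ} {l l' : List Expr} {pre pre' : List ℕ}
    {x y : Fin d → Sharing n (2 ^ k)} (hE : Env P d I h s)
    (hr : 46 ≤ r) (hr' : 46 ≤ r') (hl : Fixed 46 s l pre) (hl' : Fixed 46 s l' pre')
    (hx : ∀ t : Fin d, Holds h s r (pre ++ [(t : ℕ)]) (x t))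
    (hy : ∀ t : Fin d, Holds h s r' (pre' ++ [(t : ℕ)]) (y t)) :
    Sim I (dotShares x y) (dotting r l r' l') s fun z s' => Holds h s' 44 [] z ∧ Same 46 s s' := by
  refine Sim.and_frame (Q := fun z s' => Holds h s' 44 [] z) (lo := 20) (hi := 46) ?_ (by simp)
  refine Sim.bind (Sim.forFin (by simp [hE.dim]) (Same 46 s) (fun t z s' => Holds h s' 43 [(t : ℕ)] z) (fun _ _ _ => rfl)
    fun t s₁ f₁ u => ?_) fun z s₁ ⟨f₁, hz⟩ => ?_
  · have f₂ := f₁.loop (v := 42) (by decide) t u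
    have h43 : ((s₁.write 42 [] t).tick u).mem 43 = s₁.mem 43 := by
      rw [State.mem_tick, State.mem_write_of_ne _ _ _ (by decide)]
    have hv := mem_loop s₁ 42 t u
    generalize (s₁.write 42 [] t).tick u = s₂ at *
    refine Sim.post_self (sim_times (md := .full) rfl (f₂.env hE) (by omega) (by omega)
      (((f₂.fixed hl).mono (by decide)).append_var (by decide) hv)
      (((f₂.fixed hl').mono (by decide)).append_var (by decide) hv)
      (f₂.holds hr (hx t)) (f₂.holds hr' (hy t))) fun z s₃ ⟨hz, f₃⟩ => ?_
    have f₃' : Same 46 s s₃ := f₂.trans (f₃.mono (by decide))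
    refine (wp_copy (f₃'.env hE) (by decide) (by decide) (by decide)
      (Stable.var (v := 42) (i := t) (by decide) (by decide) ((congrFun (f₃ 42 (by decide)) _).trans hv))
      Stable.nil hz).mono fun s₄ ⟨h1, h2, h3⟩ => ⟨h1, f₃'.trans (h3.same (by decide)), h2,
        fun j b hj hb => h3.holds_of_ne (pre := []) (fun hh => hj.ne (Fin.ext hh)) (f₃.holds (by decide) ?_)⟩
    rw [Holds, h43]
    exact hb
  · refine Sim.pure ((wp_summing z (hE.frame fun b hb => f₁ b (Or.inl hb)) (by decide) (by decide)
      (by decide) (fun s' hE' => by simp [hE'.dim])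
      fun t p s' hs' h20 hv hp hE' => ?_).mono fun s' hs' => ⟨hs'.1, hs'.2.1⟩)
    have := hz t p hp
    rw [← hs' _ (by decide) (by decide) (by decide)] at this
    simpa [h20, hv] using this

end Vectors

/-! ### Norms, cosine similarity, rescaling, and the bitwise comparison circuit -/

section Similarity

variable {n k d : ℕ} {P : Params k} {I : Finset (Fin n)} {h : Fin n} {s : State}

/-- Norm of a vector, with the result in the array `38`. -/
def norming (r : ℕ) (l : List Expr) : Program := dotting r l r l ;; copy 37 [] 44 [] ;; rooting

@[simp] theorem tame_norming {lo hi r : ℕ} {l : List Expr} :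
    (norming r l).Tame lo hi ↔ lo ≤ 20 ∧ 45 < hi := by
  simp [norming]
  omega

theorem sim_norming [NeZero n] {r : ℕ} {l : List Expr} {pre : List ℕ}
    {x : Fin d → Sharing n (2 ^ k)} (hE : Env P d I h s) (hr : 46 ≤ r) (hl : Fixed 46 s l pre)
    (hx : ∀ t : Fin d, Holds h s r (pre ++ [(t : ℕ)]) (x t)) :
    Sim I (normShares P x) (norming r l) s fun z s' => Holds h s' 38 [] z ∧ Same 46 s s' := by
  refine (sim_dotting hE hr hr hl hl hx hx).bind fun y s₁ ⟨hy, f₁⟩ => ?_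
  refine Sim.pre (wp_copy (f₁.env hE) (by decide) (by decide) (by decide) Stable.nil Stable.nil hy)
    fun s₂ ⟨hy₂, hs₂⟩ => ?_
  have f₂ : Same 46 s s₂ := f₁.trans (hs₂.same (by decide))
  exact (sim_rooting (f₂.env hE) hy₂).mono fun z s₃ ⟨hz, f₃⟩ => ⟨hz, f₂.trans (f₃.mono (by decide))⟩

/-- Cosine similarity of two vectors, with the result in the array `28`. -/
def cosining (r : ℕ) (l : List Expr) (r' : ℕ) (l' : List Expr) : Program :=
  dotting r l r' l' ;; copy 46 [] 44 [] ;; norming r l ;; copy 47 [] 38 [] ;; norming r' l' ;;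
  times .full 47 [] 38 [] ;; copy 32 [] 28 [] ;; inverting ;; times .full 46 [] 33 []

@[simp] theorem tame_cosining {lo hi r r' : ℕ} {l l' : List Expr} :
    (cosining r l r' l').Tame lo hi ↔ lo ≤ 20 ∧ 47 < hi := by
  simp [cosining]
  omega

/-- The inner product and the first norm wait in the arrays `46` and `47`, above everything that
`norming` and `inverting` write. -/
theorem sim_cosining [NeZero n] {r r' : ℕ} {l l' : List Expr} {pre pre' : List ℕ}
    {x y : Fin d → Sharing n (2 ^ k)} (hE : Env P d I h s) (hr : 48 ≤ r) (hr' : 48 ≤ r')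
    (hl : Fixed 48 s l pre) (hl' : Fixed 48 s l' pre')
    (hx : ∀ t : Fin d, Holds h s r (pre ++ [(t : ℕ)]) (x t))
    (hy : ∀ t : Fin d, Holds h s r' (pre' ++ [(t : ℕ)]) (y t)) :
    Sim I (cosineShares P x y) (cosining r l r' l') s fun z s' =>
      Holds h s' 28 [] z ∧ Same 48 s s' := by
  refine (sim_dotting hE (by omega) (by omega) (hl.mono (by decide)) (hl'.mono (by decide)) hx
    hy).bind fun z₁ s₁ ⟨h₁, f₁⟩ => ?_
  replace f₁ : Same 48 s s₁ := f₁.mono (by decide)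
  refine Sim.pre (wp_copy (f₁.env hE) (by decide) (by decide) (by decide) Stable.nil Stable.nil h₁)
    fun s₂ ⟨h₂, hs₂⟩ => ?_
  have f₂ : Same 48 s s₂ := f₁.trans (hs₂.same (by decide))
  refine (sim_norming (f₂.env hE) (by omega) ((f₂.fixed hl).mono (by decide))
    fun t => f₂.holds hr (hx t)).bind fun z₃ s₃ ⟨h₃, g₃⟩ => ?_
  have f₃ : Same 48 s s₃ := f₂.trans (g₃.mono (by decide))
  replace h₂ := g₃.holds (by decide) h₂
  refine Sim.pre (wp_copy (f₃.env hE) (by decide) (by decide) (by decide) Stable.nil Stable.nil h₃)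
    fun s₄ ⟨h₄, hs₄⟩ => ?_
  have f₄ : Same 48 s s₄ := f₃.trans (hs₄.same (by decide))
  replace h₂ := hs₄.holds (by decide) (by decide) h₂
  refine (sim_norming (f₄.env hE) (by omega) ((f₄.fixed hl').mono (by decide))
    fun t => f₄.holds hr' (hy t)).bind fun z₅ s₅ ⟨h₅, g₅⟩ => ?_
  have f₅ : Same 48 s s₅ := f₄.trans (g₅.mono (by decide))
  replace h₂ := g₅.holds (by decide) h₂
  replace h₄ := g₅.holds (by decide) h₄
  refine (sim_times (md := .full) rfl (f₅.env hE) (by decide) (by decide) Fixed.nil Fixed.nil h₄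
    h₅).bind fun z₆ s₆ ⟨h₆, g₆⟩ => ?_
  have f₆ : Same 48 s s₆ := f₅.trans (g₆.mono (by decide))
  replace h₂ := g₆.holds (by decide) h₂
  refine Sim.pre (wp_copy (f₆.env hE) (by decide) (by decide) (by decide) Stable.nil Stable.nil h₆)
    fun s₇ ⟨h₇, hs₇⟩ => ?_
  have f₇ : Same 48 s s₇ := f₆.trans (hs₇.same (by decide))
  replace h₂ := hs₇.holds (by decide) (by decide) h₂
  refine (sim_inverting (f₇.env hE) h₇).bind fun z₈ s₈ ⟨h₈, g₈⟩ => ?_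
  have f₈ : Same 48 s s₈ := f₇.trans (g₈.mono (by decide))
  exact (sim_times (md := .full) rfl (f₈.env hE) (by decide) (by decide) Fixed.nil Fixed.nil
    (g₈.holds (by decide) h₂) h₈).mono fun z s₉ ⟨h₉, g₉⟩ => ⟨h₉, f₈.trans (g₉.mono (by decide))⟩

/-- Rescaling of a vector, with the result in the array `50`. -/
def normalizing (r : ℕ) (l : List Expr) (r' : ℕ) (l' : List Expr) : Program :=
  norming r l ;; copy 46 [] 38 [] ;; norming r' l' ;; copy 47 [] 38 [] ;; copy 32 [] 46 [] ;;
  inverting ;; times .full 47 [] 33 [] ;; copy 48 [] 28 [] ;;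
  .loop 49 (var 2) (times .full r (l ++ [var 49]) 48 [] ;; copy 50 [var 49] 28 [])

@[simp] theorem tame_normalizing {lo hi r r' : ℕ} {l l' : List Expr} :
    (normalizing r l r' l').Tame lo hi ↔ lo ≤ 20 ∧ 50 < hi := by
  simp [normalizing]
  omega

theorem sim_normalizing [NeZero n] {r r' : ℕ} {l l' : List Expr} {pre pre' : List ℕ}
    {x y : Fin d → Sharing n (2 ^ k)} (hE : Env P d I h s) (hr : 51 ≤ r) (hr' : 51 ≤ r')
    (hl : Fixed 51 s l pre) (hl' : Fixed 51 s l' pre')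
    (hx : ∀ t : Fin d, Holds h s r (pre ++ [(t : ℕ)]) (x t))
    (hy : ∀ t : Fin d, Holds h s r' (pre' ++ [(t : ℕ)]) (y t)) :
    Sim I (normalizeShares P x y) (normalizing r l r' l') s fun z s' =>
      (∀ t : Fin d, Holds h s' 50 [(t : ℕ)] (z t)) ∧ Same 51 s s' := by
  refine (sim_norming hE (by omega) (hl.mono (by decide)) hx).bind fun z₁ s₁ ⟨h₁, f₁⟩ => ?_
  replace f₁ : Same 51 s s₁ := f₁.mono (by decide)
  refine Sim.pre (wp_copy (f₁.env hE) (by decide) (by decide) (by decide) Stable.nil Stable.nil h₁)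
    fun s₂ ⟨h₂, hs₂⟩ => ?_
  have f₂ : Same 51 s s₂ := f₁.trans (hs₂.same (by decide))
  refine (sim_norming (f₂.env hE) (by omega) ((f₂.fixed hl').mono (by decide))
    fun t => f₂.holds hr' (hy t)).bind fun z₃ s₃ ⟨h₃, g₃⟩ => ?_
  have f₃ : Same 51 s s₃ := f₂.trans (g₃.mono (by decide))
  replace h₂ := g₃.holds (by decide) h₂
  refine Sim.pre (wp_copy (f₃.env hE) (by decide) (by decide) (by decide) Stable.nil Stable.nil h₃)
    fun s₄ ⟨h₄, hs₄⟩ => ?_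
  have f₄ : Same 51 s s₄ := f₃.trans (hs₄.same (by decide))
  replace h₂ := hs₄.holds (by decide) (by decide) h₂
  refine Sim.pre (wp_copy (f₄.env hE) (by decide) (by decide) (by decide) Stable.nil Stable.nil h₂)
    fun s₅ ⟨h₅, hs₅⟩ => ?_
  have f₅ : Same 51 s s₅ := f₄.trans (hs₅.same (by decide))
  replace h₄ := hs₅.holds (by decide) (by decide) h₄
  refine (sim_inverting (f₅.env hE) h₅).bind fun z₆ s₆ ⟨h₆, g₆⟩ => ?_
  have f₆ : Same 51 s s₆ := f₅.trans (g₆.mono (by decide))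
  replace h₄ := g₆.holds (by decide) h₄
  refine (sim_times (md := .full) rfl (f₆.env hE) (by decide) (by decide) Fixed.nil Fixed.nil h₄
    h₆).bind fun z₇ s₇ ⟨h₇, g₇⟩ => ?_
  have f₇ : Same 51 s s₇ := f₆.trans (g₇.mono (by decide))
  refine Sim.pre (wp_copy (f₇.env hE) (by decide) (by decide) (by decide) Stable.nil Stable.nil h₇)
    fun s₈ ⟨h₈, hs₈⟩ => ?_
  have f₈ : Same 51 s s₈ := f₇.trans (hs₈.same (by decide))
  have hE₈ := f₈.env hE
  replace hl := f₈.fixed hl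
  replace hx := fun t => f₈.holds hr (hx t)
  -- Array `48` with the scaling factor lies inside the range that `Same 51` leaves open, so the
  -- invariant names it.
  refine (Sim.forFin (by simp [hE₈.dim]) (fun s' => Same 51 s₈ s' ∧ s'.mem 48 = s₈.mem 48)
    (fun t z s' => Holds h s' 50 [(t : ℕ)] z) (fun _ => ⟨fun _ _ => rfl, rfl⟩)
    fun t s' ⟨f, hf⟩ u => ?_).mono fun z s' hs' => ⟨hs'.2, f₈.trans hs'.1.1⟩
  have f' := f.loop (v := 49) (by decide) t u
  have h50 : ((s'.write 49 [] t).tick u).mem 50 = s'.mem 50 := by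
    rw [State.mem_tick, State.mem_write_of_ne _ _ _ (by decide)]
  have h48 : ((s'.write 49 [] t).tick u).mem 48 = s₈.mem 48 := by
    rw [State.mem_tick, State.mem_write_of_ne _ _ _ (by decide), hf]
  have hv := mem_loop s' 49 t u
  generalize (s'.write 49 [] t).tick u = s₉ at *
  refine Sim.post_self (sim_times (md := .full) rfl (f'.env hE₈) (by omega) (by omega)
    (((f'.fixed hl).mono (by decide)).append_var (by decide) hv) Fixed.nil
    (f'.holds hr (hx t)) (pre' := []) (y := z₇) fun p hp => (congrFun h48 _).trans (h₈ p hp))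
    fun z s₁₀ ⟨hz, g⟩ => ?_
  have g' : Same 51 s₈ s₁₀ := f'.trans (g.mono (by decide))
  refine (wp_copy (g'.env hE₈) (by decide) (by decide) (by decide)
    (Stable.var (v := 49) (i := t) (by decide) (by decide) ((congrFun (g 49 (by decide)) _).trans hv))
    Stable.nil hz).mono fun s₁₁ ⟨h1, h2, h3⟩ => ⟨h1, ⟨g'.trans (h3.same (by decide)), ?_⟩, h2,
      fun j b hj hb => h3.holds_of_ne (pre := []) (fun hh => hj.ne (Fin.ext hh))
        (g.holds (by decide) ?_)⟩
  · rw [h3.frame 48 (by decide) (by decide), g 48 (by decide), h48]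
  · rw [Holds, h50]
    exact hb

/-- Comparison of the public number in the variable `58` with the number whose bits are in the
array `55`, with the result in the array `51`. -/
def comparing : Program :=
  fill 51 [] (.lit 0) ;;
  .loop 52 (var 1) (times .bits 55 [var 52] 51 [] ;;
    .ite (var 58 / entry 16 [var 52] % .lit 2) (copy 51 [] 28 [])
      (fill 51 [] ((entry 28 [var 20] + entry 55 [var 52, var 20] + entry 51 [var 20]) %
        Modulus.bits.order)))

@[simp] theorem tame_comparing {lo hi : ℕ} : comparing.Tame lo hi ↔ lo ≤ 20 ∧ 52 < hi := by
  simp [comparing]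
  omega

/-- The circuit branches on bits of the public `a` alone; apart from multiplications, everything is
local. The bits of `r` themselves are never needed, only shares of them. -/
theorem sim_comparing [NeZero n] {a : ℕ} {bits : Fin k → Sharing n 2} (hE : Env P d I h s)
    (ha : s.mem 58 [] = a) (hbits : ∀ m : Fin k, Holds h s 55 [(m : ℕ)] (bits m)) :
    Sim I (ltBits a k bits) comparing s fun z s' => Holds h s' 51 [] z ∧ Same 53 s s' := by
  refine Sim.and_frame (Q := fun z s' => Holds h s' 51 [] z) (lo := 20) (hi := 53) ?_ (by simp)
  refine Sim.pre (wp_fill [] (0 : Sharing n 2) hE (by decide) fun p s' _ _ _ _ =>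
    ⟨rfl, fun _ => by simp⟩) fun s₁ ⟨h₁, hs₁⟩ => ?_
  have f₁ : Same 53 s s₁ := hs₁.same (by decide)
  -- `Sim.ascend` wants a step for every natural number, hence the extension by `0` beyond `k`.
  let B : ℕ → Sharing n 2 := fun i => if hi : i < k then bits ⟨i, hi⟩ else 0
  have hB : ltBits a k bits = ltBits a k fun i => B i := by
    congr 1
    funext i
    simp [B]
  have hk : (var 1).eval s₁ = k := by simp [(f₁.env hE).digits]
  rw [hB]
  have := Sim.ascend (I := I) (s := s₁) (G := fun m => ltBits a m fun i => B i) (a₀ := (0 : Sharing n 2))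
    (step := fun m l => do
      let t ← mulShares (B m) l
      pure (if a.testBit m then t else t + B m + l)) rfl (fun m => rfl) (v := 52) (b := var 1)
    (c := times .bits 55 [var 52] 51 [] ;;
      .ite (var 58 / entry 16 [var 52] % .lit 2) (copy 51 [] 28 [])
        (fill 51 [] ((entry 28 [var 20] + entry 55 [var 52, var 20] + entry 51 [var 20]) %
          Modulus.bits.order)))
    (fun l s' => Holds h s' 51 [] l ∧ Same 53 s s') (fun t => ⟨h₁, f₁⟩) fun i hi l s₂ ⟨h₂, f₂⟩ t => ?_
  · rw [hk] at this
    exact this.mono fun _ _ h => h.1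
  · rw [hk] at hi
    have f₃ := f₂.loop (v := 52) (by decide) i t
    have hv := mem_loop s₂ 52 i t
    replace h₂ : Holds h ((s₂.write 52 [] i).tick t) 51 [] l := h₂
    generalize (s₂.write 52 [] i).tick t = s₃ at *
    have hBi : Holds h s₃ 55 [i] (B i) := by
      have := f₃.holds (by decide) (hbits ⟨i, hi⟩)
      simpa [B, hi] using this
    refine Sim.post (sim_times (md := .bits) rfl (f₃.env hE) (by decide) (by decide)
      (Fixed.var (by decide) hv) Fixed.nil hBi h₂) fun z s₄ ⟨h₄, g₄⟩ => ?_
    have f₄ : Same 53 s s₄ := f₃.trans (g₄.mono (by decide))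
    have hE₄ := f₄.env hE
    rw [← g₄ 52 (by decide)] at hv
    replace hBi := g₄.holds (by decide) hBi
    replace h₂ := g₄.holds (by decide) h₂
    -- Bit `i` is read off by dividing by the stored power `2 ^ i`; the table has this entry because
    -- `i < k`.
    have hc : (var 58 / entry 16 [var 52] % .lit 2 : Expr).eval s₄ = 0 ↔ ¬ a.testBit i := by
      simp [hv, hE₄.power i hi, f₄ 58 (by decide), ha, Nat.testBit_eq_decide_div_mod_eq]
    refine Program.wp_ite (fun hne u => ?_) fun he u => ?_
    · rw [Ne, hc, not_not] at hne
      rw [if_pos hne]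
      exact (wp_copy (s := s₄.tick u) (hE₄.frame fun _ _ => rfl) (by decide) (by decide) (by decide)
        Stable.nil Stable.nil h₄).mono fun s₅ ⟨h5, h6, h7⟩ =>
          ⟨h5, h6, f₄.trans (h7.same (hi := 53) (by decide))⟩
    · rw [hc] at he
      rw [if_neg he]
      refine (wp_fill (s := s₄.tick u) [] (z + B i + l) (hE₄.frame fun _ _ => rfl) (by decide)
        fun p s' hA h20 hself hE' => ⟨rfl, fun hp => ?_⟩).mono fun s₅ ⟨h5, h6, h7⟩ =>
          ⟨h5, h6, f₄.trans (h7.same (hi := 53) (by decide))⟩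
      have e1 := h₄ p hp
      have e2 := hBi p hp
      have e3 := hself.trans (h₂ p hp)
      rw [← State.mem_tick s₄ u, ← hA.frame _ (by decide) (by decide)] at e1 e2
      have e4 : s'.mem 52 [] = i := by
        rw [hA.frame _ (by decide) (by decide), State.mem_tick, hv]
      simp only [List.nil_append, List.cons_append] at e1 e2 e3
      rw [eval_mod, Modulus.Has.order_eval (md := .bits) (q := 2) rfl hE']
      apply mod_eq_val
      simp [h20, e1, e2, e3, e4]

end Similarity

/-! ### edaBits and the comparison with the threshold -/

section Comparison

variable {n k d : ℕ} {P : Params k} {I : Finset (Fin n)} {h : Fin n} {s : State}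

/-- An edaBit: the shares of `r` in the array `54`, with the masked value as entry of `h`, and the
shares of its bits in the array `55`. -/
def edaTossing : Program :=
  tossing 54 [] .full ;; .loop 52 (var 1) (tossing 55 [var 52] .bits) ;; dealing 54 [] ;;
  .loop 52 (var 1) (dealing 55 [var 52])

@[simp] theorem tame_edaTossing {lo hi : ℕ} : edaTossing.Tame lo hi ↔ lo ≤ 20 ∧ 55 < hi := by
  simp [edaTossing]
  omega

/-- The simulator knows neither `r` nor its bits. The entry of `h` in array `54` is the masked
value, uniform by `bijective_mask`, and the shares of the bits that the other parties hold are
uniform whatever the bits are. Array `53`, the input of the comparison, is among those that stay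
unchanged. -/
theorem sim_edaTossing [NeZero n] (X : ZMod (2 ^ k)) (hE : Env P d I h s) :
    Sim I (edaBits n k) edaTossing s fun z s' => Holds h s' 54 [] z.1 ∧
      s'.mem 54 [(h : ℕ)] = (X + ∑ p, z.1 p).val ∧
      (∀ m : Fin k, Holds h s' 55 [(m : ℕ)] (z.2 m)) ∧
      ∀ b, b < 20 ∨ b = 53 ∨ 56 ≤ b → s'.mem b = s.mem b := by
  refine (sim_sample_mask (md := .full) rfl hE (by decide) X 1 (by ring)).bind
    fun r s₁ ⟨h₁, h₁', hs₁⟩ => ?_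
  rw [one_mul] at h₁'
  have hE₁ := (hs₁.same (hi := 60) (by decide)).env hE
  refine Sim.bind (R := fun u s' => (∀ m : Fin k, Holds h s' 55 [(m : ℕ)]
      (complete 0 (if (∑ i, r i).val.testBit m then 1 else 0) (u m))) ∧
      ∀ b, b ≠ 20 → b ≠ 52 → b ≠ 55 → s'.mem b = s₁.mem b) ?_ fun u s₂ ⟨h₂, hs₂⟩ => ?_
  · rw [sample_pi]
    refine (Sim.forFin (by simp [hE₁.digits])
      (fun s' => ∀ b, b ≠ 20 → b ≠ 52 → b ≠ 55 → s'.mem b = s₁.mem b)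
      (fun m u s' => Holds h s' 55 [(m : ℕ)]
        (complete 0 (if (∑ i, r i).val.testBit m then 1 else 0) u)) (fun _ _ _ _ _ => rfl)
      fun m s₂ hs₂ t => ?_).mono fun u s' hs' => ⟨hs'.2, hs'.1⟩
    have hs₃ : ∀ b, b ≠ 20 → b ≠ 52 → b ≠ 55 →
        ((s₂.write 52 [] m).tick t).mem b = s₁.mem b := fun b hb hb' hb'' => by
      rw [State.mem_tick, State.mem_write_of_ne _ _ _ hb', hs₂ b hb hb' hb'']
    have hv := mem_loop s₂ 52 m t
    have h55 : ((s₂.write 52 [] m).tick t).mem 55 = s₂.mem 55 := by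
      rw [State.mem_tick, State.mem_write_of_ne _ _ _ (by decide)]
    generalize (s₂.write 52 [] m).tick t = s₃ at *
    refine (sim_sample_complete (md := .bits) (pre := [(m : ℕ)]) rfl
      (hE₁.frame fun b hb => hs₃ b (by omega) (by omega) (by omega)) (by decide)
      (fun s' hA => by simp [hA.frame 52, hv]) 0 _).mono fun u s₄ ⟨h4, hA⟩ =>
      ⟨fun b hb hb' hb'' => ?_, h4, fun j b hj hb => hA.holds_of_ne (pre := [])
        (fun hh => hj.ne (Fin.ext hh)) ?_⟩
    · rw [hA.frame b hb'' hb, hs₃ b hb hb' hb'']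
    · rw [Holds, h55]
      exact hb
  · replace h₁ : Holds h s₂ 54 [] r := fun p hp =>
      (congrFun (hs₂ 54 (by decide) (by decide) (by decide)) _).trans (h₁ p hp)
    have hE₂ := hE₁.frame fun b hb => hs₂ b (by omega) (by omega) (by omega)
    refine (sim_deal hE₂ (by decide) (fun _ _ => rfl) h₁).bind fun _ s₃ hs₃ => ?_
    have hE₃ := hE₂.frame fun b hb => hs₃ b (by omega)
    refine Sim.map (Sim.forFin (by simp [hE₃.digits])
      (fun s' => ∀ b, b ≠ 20 → b ≠ 52 → s'.mem b = s₂.mem b) (fun _ _ _ => True)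
      (fun _ b hb _ => hs₃ b hb) fun m s₄ hs₄ t => ?_) fun _ s' ⟨hs', _⟩ => ?_
    · have hs₅ : ∀ b, b ≠ 20 → b ≠ 52 → ((s₄.write 52 [] m).tick t).mem b = s₂.mem b :=
        fun b hb hb' => by rw [State.mem_tick, State.mem_write_of_ne _ _ _ hb', hs₄ b hb hb']
      have hv := mem_loop s₄ 52 m t
      generalize (s₄.write 52 [] m).tick t = s₅ at *
      refine (sim_deal (pre := [(m : ℕ)]) (hE₂.frame fun b hb => hs₅ b (by omega) (by omega))
        (by decide) (fun s' hs' => by simp [hs' 52, hv]) fun p hp => ?_).mono fun _ s₆ hs₆ =>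
          ⟨fun b hb hb' => (hs₆ b hb).trans (hs₅ b hb hb'), trivial, fun _ _ _ _ => trivial⟩
      rw [hs₅ 55 (by decide) (by decide)]
      exact h₂ m p hp
    · refine ⟨fun p hp => ?_, ?_, fun m p hp => ?_, fun b hb => ?_⟩
      · rw [hs' 54 (by decide) (by decide)]
        exact h₁ p hp
      · rw [hs' 54 (by decide) (by decide), hs₂ 54 (by decide) (by decide) (by decide), h₁']
      · rw [hs' 55 (by decide) (by decide)]
        exact h₂ m p hp
      · rw [hs' b (by omega) (by omega), hs₂ b (by omega) (by omega) (by omega),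
          hs₁.frame b (by omega) (by omega)]

/-- Comparison of the shared value in the array `53` with the public value in the variable `56`,
where the variable `57` predicts the result. -/
def rabbiting : Program :=
  edaTossing ;; opening .full (entry 53 [var 20] + entry 54 [var 20]) (entry 54 [var 17]) ;;
  assign 58 [] (entry 54 [var 17]) ;; comparing ;; copy 59 [] 51 [] ;;
  assign 58 [] ((entry 54 [var 17] + (Modulus.full.order - var 56)) % Modulus.full.order) ;;
  comparing ;;
  opening .bits (entry 59 [var 20] + entry 51 [var 20] +
    less (var 20) (.lit 1) * (.lit 1 + less (var 58) (Modulus.full.order - var 56))) (var 57)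

@[simp] theorem tame_rabbiting {lo hi : ℕ} : rabbiting.Tame lo hi ↔ lo ≤ 20 ∧ 59 < hi := by
  simp [rabbiting]
  omega

theorem wp_assign_var {a : ℕ} {v : Expr} : (assign a [] v).wp s fun s' => s'.out = s.out ∧
    s'.mem a [] = v.eval s ∧ ∀ b, b ≠ a → s'.mem b = s.mem b :=
  Program.wp_assign fun t => ⟨rfl, by simp [State.mem_write], fun b hb => by
    rw [State.mem_tick, State.mem_write_of_ne _ _ _ hb]⟩

/-- The masked value `a` is public and so is `b = a - c`, hence both circuits run on shares. The
final opening needs the outcome itself, which is supplied in variable `57`; `rabbit_identity` shows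
that the shares do sum to it. -/
theorem sim_rabbiting [NeZero n] {x : Sharing n (2 ^ k)} {c : ZMod (2 ^ k)} (hE : Env P d I h s)
    (hx : Holds h s 53 [] x) (hc : s.mem 56 [] = c.val)
    (hβ : s.mem 57 [] = if (∑ p, x p).val < c.val then 1 else 0) :
    Sim I (rabbit x c) rabbiting s fun b s' =>
      b = decide ((∑ p, x p).val < c.val) ∧ Same 60 s s' := by
  -- The disclosed bit is given by correctness and the frame by tameness, so only the messages
  -- remain to be matched.
  refine ((Sim.and_frame (Q := fun _ _ => True) (lo := 20) (hi := 60) ?_ (by simp)).and_ensures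
    (ensures_rabbit x c)).mono fun b s' ⟨⟨_, h2⟩, h3⟩ => ⟨h3, h2⟩
  refine ((sim_edaTossing (∑ p, x p) hE).and_ensures ensures_edaBits).bind
    fun ⟨r, bits⟩ s₁ ⟨⟨hr, hrh, hbits, hs₁⟩, hsum⟩ => ?_
  dsimp only at hr hrh hbits hsum
  have hE₁ := hE.frame fun b hb => hs₁ b (by omega)
  have eX : ∑ p, x p + ∑ p, r p = ∑ p, (x + r) p := by simp [Finset.sum_add_distrib]
  rw [eX] at hrh
  rw [← hs₁ 56 (by omega)] at hc
  rw [← hs₁ 57 (by omega)] at hβ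
  replace hx : Holds h s₁ 53 [] x := fun p hp =>
    (congrFun (hs₁ 53 (by omega)) _).trans (hx p hp)
  clear hs₁ hE
  refine (sim_opening (md := .full) rfl hE₁ (fun p s' hs' h20 hp hE' => ?_)
    fun s' hs' hE' => ?_).bind fun a s₂ ⟨ha, f₂⟩ => ?_
  · have e1 := hx p hp
    have e2 := hr p hp
    rw [List.nil_append, ← hs' _ (by decide) (by decide)] at e1 e2
    simp [h20, e1, e2]
  · rw [← hs' _ (by decide) (by decide)] at hrh
    simp [hE'.honest, hrh]
  replace f₂ : Same 53 s₁ s₂ := f₂.mono (by decide)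
  have hE₂ := f₂.env hE₁
  rw [← f₂ 54 (by decide), ← ha] at hrh
  rw [← f₂ 56 (by decide)] at hc
  rw [← f₂ 57 (by decide)] at hβ
  replace hbits := fun m => f₂.holds (by decide) (hbits m)
  clear f₂ hE₁ hx hr
  refine Sim.pre wp_assign_var fun s₃ ⟨h58, hs₃⟩ => ?_
  have hE₃ := hE₂.frame fun b hb => hs₃ b (by omega)
  replace h58 : s₃.mem 58 [] = a.val := by
    rw [h58]
    simp [hE₂.honest, hrh]
  rw [← hs₃ 54 (by decide)] at hrh
  rw [← hs₃ 56 (by decide)] at hc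
  rw [← hs₃ 57 (by decide)] at hβ
  replace hbits : ∀ m : Fin k, Holds h s₃ 55 [(m : ℕ)] (bits m) := fun m p hp =>
    (congrFun (hs₃ 55 (by decide)) _).trans (hbits m p hp)
  clear hs₃ hE₂
  refine ((sim_comparing hE₃ h58 hbits).and_ensures (ensures_ltBits _ _ _ _ hsum)).bind
    fun w₁ s₄ ⟨⟨h₄, f₄⟩, e₁⟩ => ?_
  refine Sim.pre (wp_copy (f₄.env hE₃) (by decide) (by decide) (by decide) Stable.nil Stable.nil h₄)
    fun s₅ ⟨h₅, hs₅⟩ => ?_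
  have hE₅ := (hs₅.same (hi := 60) (by decide)).env (f₄.env hE₃)
  rw [← f₄ 54 (by decide), ← hs₅.frame 54 (by decide) (by decide)] at hrh
  rw [← f₄ 56 (by decide), ← hs₅.frame 56 (by decide) (by decide)] at hc
  rw [← f₄ 57 (by decide), ← hs₅.frame 57 (by decide) (by decide)] at hβ
  replace hbits := fun m => hs₅.holds (by decide) (by decide) (f₄.holds (by decide) (hbits m))
  clear f₄ hs₅ hE₃ h₄ h58
  refine Sim.pre wp_assign_var fun s₆ ⟨h58, hs₆⟩ => ?_
  have hE₆ := hE₅.frame fun b hb => hs₆ b (by omega)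
  replace h58 : s₆.mem 58 [] = (a - c).val := by
    rw [h58, eval_mod, Modulus.Has.order_eval (md := .full) rfl hE₅]
    apply mod_eq_val
    simp [hE₅.honest, hrh, Modulus.Has.order_eval (md := .full) rfl hE₅, hc, natCast_sub_val,
      sub_eq_add_neg]
  rw [← hs₆ 56 (by decide)] at hc
  rw [← hs₆ 57 (by decide)] at hβ
  replace h₅ : Holds h s₆ 59 [] w₁ := fun p hp =>
    (congrFun (hs₆ 59 (by decide)) _).trans (h₅ p hp)
  replace hbits : ∀ m : Fin k, Holds h s₆ 55 [(m : ℕ)] (bits m) := fun m p hp =>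
    (congrFun (hs₆ 55 (by decide)) _).trans (hbits m p hp)
  clear hs₆ hE₅ hrh
  refine ((sim_comparing hE₆ h58 hbits).and_ensures (ensures_ltBits _ _ _ _ hsum)).bind
    fun w₂ s₇ ⟨⟨h₇, f₇⟩, e₂⟩ => ?_
  have hE₇ := f₇.env hE₆
  rw [← f₇ 56 (by decide)] at hc
  rw [← f₇ 57 (by decide)] at hβ
  rw [← f₇ 58 (by decide)] at h58
  replace h₅ := f₇.holds (by decide) h₅
  refine Sim.map (sim_opening (md := .bits) rfl hE₇ (fun p s' hs' h20 hp hE' => ?_)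
    fun s' hs' hE' => ?_) fun _ _ _ => trivial
  · have d1 := h₅ p hp
    have d2 := h₇ p hp
    rw [List.nil_append, ← hs' _ (by decide) (by decide)] at d1 d2
    rw [← hs' _ (by decide) (by decide)] at hc h58
    rw [Pi.add_apply, Pi.add_apply, pub_apply]
    simp only [eval_add, eval_mul, eval_sub, eval_less, eval_entry, List.map_cons, List.map_nil,
      eval_var, h20, d1, d2, h58, hc, eval_lit, Modulus.Has.order_eval (md := .full) rfl hE',
      Nat.cast_add, ZMod.natCast_zmod_val, Nat.cast_mul, Nat.cast_ite, Nat.cast_one, Nat.cast_zero]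
    split_ifs <;> simp
  -- The predicted bit equals the sum of the final shares, by correctness of both circuits.
  · rw [eval_var, hs' _ (by decide) (by decide), hβ]
    simp only [Nat.mod_eq_of_lt (ZMod.val_lt _)] at e₁ e₂
    simp only [Pi.add_apply, Finset.sum_add_distrib, sum_pub, e₁, e₂, ha]
    rw [rabbit_identity]
    simp

/-- Comparison of the signed value in the array `28` with the threshold, where `e` predicts the
result. -/
def deciding (e : Expr) : Program :=
  fill 53 [] ((entry 28 [var 20] + less (var 20) (.lit 1) * entry 16 [var 1 - .lit 1]) %
    Modulus.full.order) ;;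
  assign 56 [] ((var 10 + entry 16 [var 1 - .lit 1]) % Modulus.full.order) ;;
  assign 57 [] e ;; rabbiting

@[simp] theorem tame_deciding {lo hi : ℕ} {e : Expr} :
    (deciding e).Tame lo hi ↔ e.Small ∧ lo ≤ 20 ∧ 59 < hi := by
  simp only [deciding, tame_seq, tame_fill, tame_assign, tame_rabbiting, small_mod, and_true]
  constructor
  · rintro ⟨h1, h2, ⟨h3, h4⟩, h5⟩
    exact ⟨h4, h5⟩
  · rintro ⟨h1, h2⟩
    refine ⟨?_, ?_, ⟨?_, h1⟩, h2⟩ <;> omega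

/-- The shift `2 ^ (k - 1)` is taken from the table of powers, which has this entry because `0 < k`.
The prediction is read in the midst of the computation, so `e` may not depend on scratch arrays. -/
theorem sim_deciding [NeZero n] {x : Sharing n (2 ^ k)} {e : Expr} (hk : 0 < k)
    (hE : Env P d I h s) (hx : Holds h s 28 [] x)
    (he : ∀ s', Same 60 s s' → e.eval s' = if signedLT (∑ p, x p) P.tau then 1 else 0) :
    Sim I (compareShares x P.tau) (deciding e) s fun b s' =>
      b = signedLT (∑ p, x p) P.tau ∧ Same 60 s s' := by
  have hsum : ∑ p, (x + pub (2 ^ (k - 1)) : Sharing n (2 ^ k)) p = ∑ p, x p + 2 ^ (k - 1) := by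
    simp [Finset.sum_add_distrib]
  refine Sim.pre (wp_fill [] (x + pub (2 ^ (k - 1))) hE (by decide) fun p s' hA h20 hself hE' =>
    ⟨rfl, fun hp => ?_⟩) fun s₁ ⟨h₁, hs₁⟩ => ?_
  · have e1 := hx p hp
    rw [← hA.frame _ (by decide) (by decide), List.nil_append] at e1
    rw [eval_mod, Modulus.Has.order_eval (md := .full) rfl hE']
    apply mod_eq_val
    rw [Pi.add_apply, pub_apply]
    simp [h20, e1, hE'.digits, hE'.power (k - 1) (by omega)]
  have f₁ : Same 60 s s₁ := hs₁.same (by decide)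
  have hE₁ := f₁.env hE
  refine Sim.pre wp_assign_var fun s₂ ⟨h₂, hs₂⟩ => ?_
  have f₂ : Same 60 s s₂ := f₁.trans fun b hb => hs₂ b (by omega)
  replace h₂ : s₂.mem 56 [] = (P.tau + 2 ^ (k - 1)).val := by
    rw [h₂, eval_mod, Modulus.Has.order_eval (md := .full) rfl hE₁]
    apply mod_eq_val
    simp [hE₁.tau, hE₁.digits, hE₁.power (k - 1) (by omega)]
  refine Sim.pre wp_assign_var fun s₃ ⟨h₃, hs₃⟩ => ?_
  have f₃ : Same 60 s s₃ := f₂.trans fun b hb => hs₃ b (by omega)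
  refine (sim_rabbiting (c := P.tau + 2 ^ (k - 1)) (f₃.env hE) (fun p hp => ?_)
    ((congrFun (hs₃ 56 (by decide)) _).trans h₂) ?_).mono fun b s₄ ⟨h₄, f₄⟩ => ⟨?_, f₃.trans f₄⟩
  · rw [hs₃ 53 (by decide), hs₂ 53 (by decide)]
    exact h₁ p hp
  · rw [h₃, he _ f₂, signedLT, hsum]
    simp
  · rw [h₄, signedLT, hsum]

end Comparison

/-! ## Simulation of the protocol -/

/-- The private part of the simulator's memory, where `p₀` is a member of the coalition. -/
structure Known {n k d R : ℕ} (P : Params k) (I : Finset (Fin n))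
    (x : Fin n → Fin R → Fin d → ZMod (2 ^ k)) (p₀ : Fin n) (s : State) : Prop where
  iters : s.mem 3 [] = R
  input : ∀ p ∈ I, ∀ (r : Fin R) (t : Fin d), s.mem 12 [(p : ℕ), (r : ℕ), (t : ℕ)] = (x p r t).val
  model : ∀ p ∈ I, ∀ (r : Fin R) (t : Fin d),
    s.mem 13 [(p : ℕ), (r : ℕ), (t : ℕ)] = (modelClear P (fun i => x i r) p t).val
  rejected : ∀ (r : Fin R) (i j : Fin n), s.mem 14 [(p₀ : ℕ), (r : ℕ), (i : ℕ), (j : ℕ)] =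
    if rejectedClear P (fun i => x i r) i j then 1 else 0
  witness : s.mem 18 [] = p₀

theorem Known.frame {n k d R : ℕ} {P : Params k} {I : Finset (Fin n)}
    {x : Fin n → Fin R → Fin d → ZMod (2 ^ k)} {p₀ : Fin n} {s s' : State}
    (hK : Known P I x p₀ s) (hs : ∀ a < 20, s'.mem a = s.mem a) : Known P I x p₀ s' where
  iters := by rw [hs 3 (by decide), hK.iters]
  input p hp r t := by rw [hs 12 (by decide), hK.input p hp]
  model p hp r t := by rw [hs 13 (by decide), hK.model p hp]
  rejected r i j := by rw [hs 14 (by decide), hK.rejected]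
  witness := by rw [hs 18 (by decide), hK.witness]

/-! ### Sharing of inputs and the contribution of one client -/

section Top

variable {n k d R : ℕ} {P : Params k} {I : Finset (Fin n)} {h : Fin n} {s : State}

/-- Announce the coins of party `var 67` and the messages in which it distributes shares, all of
them in the array `24`. -/
def announcing : Program :=
  .loop 20 (var 0) (.ite (differ (var 20) (var 67))
    (.ite (entry 11 [var 67]) (emitEvent (var 67) (.lit 0) (entry 24 [var 20])) .skip ;;
      .ite (entry 11 [var 20]) (emitEvent (var 20) (var 67 + .lit 2) (entry 24 [var 20])) .skip)
    .skip)

@[simp] theorem tame_announcing {lo hi : ℕ} : announcing.Tame lo hi ↔ lo ≤ 20 ∧ 20 < hi := by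
  simp [announcing]

/-- The number `u j` is seen as a coin if `i` is corrupt and as a message if `j` is; `hu` asks for
it in exactly these cases. -/
theorem wp_announcing {q : ℕ} {u : Sharing n q} {i : Fin n} (hE : Env P d I h s)
    (hi : s.mem 67 [] = i)
    (hu : ∀ j, j ≠ i → (i ∈ I ∨ j ∈ I) → s.mem 24 [(j : ℕ)] = (u j).val) :
    announcing.wp s fun s' => (∀ b, b ≠ 20 → s'.mem b = s.mem b) ∧ s'.out = s.out ++ visible I
      (((List.finRange n).filter (· ≠ i)).flatMap fun j =>
        [⟨i, .coins, (u j).val⟩, ⟨j, .party i, (u j).val⟩]) := by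
  rw [flatMap_filter_ne, visible_flatMap]
  refine wp_emitLoop _ (fun s' => ∀ b, b ≠ 20 → s'.mem b = s.mem b) (by simp [hE.parties])
    (fun _ _ _ => rfl) fun j s' hs' t' => ?_
  have h1 : ∀ b, b ≠ 20 → ((s'.write 20 [] j).tick t').mem b = s.mem b := fun b hb => by
    rw [State.mem_tick, State.mem_write_of_ne _ _ _ hb, hs' b hb]
  have h20 := mem_loop s' 20 j t'
  have ho : ((s'.write 20 [] j).tick t').out = s'.out := rfl
  generalize (s'.write 20 [] j).tick t' = s₁ at *
  have hd := eval_differ s₁ (var 20) (var 67)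
  rw [eval_var, eval_var, h20, h1 67 (by decide), hi] at hd
  refine Program.wp_ite (fun hne t'' => ?_) fun he t'' => Program.wp_skip ⟨h1, ?_⟩
  · have hji : j ≠ i := fun hh => hne (hd.2 (congrArg Fin.val hh))
    have hev : ∀ e : Event n, [e, ⟨j, .party i, (u j).val⟩] = [e] ++ [⟨j, .party i, (u j).val⟩] :=
      fun _ => rfl
    rw [if_pos hji, hev, visible_append, visible_singleton, visible_singleton]
    have key : ∀ (v : ℕ) (p : Fin n) (src : Expr) (S : Source n) (s₂ : State),
        s₂.mem = s₁.mem → s₂.mem v [] = p → (p ∈ I → i ∈ I ∨ j ∈ I) → src.eval s₂ = S.code →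
        (∀ t, src.eval (s₂.tick t) = src.eval s₂) →
        (Program.ite (entry 11 [var v]) (emitEvent (var v) src (entry 24 [var 20])) .skip).wp s₂
          fun s₃ => s₃.mem = s₁.mem ∧ s₃.out = s₂.out ++
            if p ∈ I then Event.code (⟨p, S, (u j).val⟩ : Event n) else [] := by
      intro v p src S s₂ hs₂ hv hp hsrc htick
      have hc : (entry 11 [var v]).eval s₂ = if p ∈ I then 1 else 0 := by
        have := hE.corrupt p
        rw [← h1 11 (by decide), ← hs₂] at this
        simp [hv, this]
      refine Program.wp_ite (fun hne t => ?_) fun he t => Program.wp_skip ⟨hs₂, ?_⟩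
      · have hpI : p ∈ I := by
          by_contra hpI
          simp [hc, hpI] at hne
        refine wp_emitEvent.mono fun s₃ ⟨h3, h4⟩ => ⟨h3.trans hs₂, ?_⟩
        rw [h4, if_pos hpI, htick, hsrc]
        congr 1
        have := hu j hji (hp hpI)
        rw [← h1 24 (by decide), ← hs₂] at this
        rw [← hs₂] at h20
        simp [hv, h20, this, Event.code]
      · have hpI : p ∉ I := by
          intro hpI
          simp [hc, hpI] at he
        simp [hpI]
    have h67 : s₁.mem 67 [] = i := by rw [h1 67 (by decide), hi]
    have k₁ := key 67 i (.lit 0) .coins (s₁.tick t'') rfl h67 Or.inl rfl fun _ => rfl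
    refine Program.wp_seq (k₁.mono fun s₂ ⟨h2, h3⟩ => ?_)
    have k₂ := key 20 j (var 67 + .lit 2) (.party i) s₂ h2 (by rw [h2, h20]) Or.inr
      (by simp [h2, h67, Source.code]) fun t => by simp
    refine k₂.mono fun s₃ ⟨h4, h5⟩ => ⟨fun b hb => by rw [h4, h1 b hb], ?_⟩
    rw [h5, h3, State.out_tick, ho, List.append_assoc]
  · have hji : j = i := Fin.ext (hd.1 he)
    simp [hji, ho, visible]

/-- Party `var 67` shares the coordinate `var 65` of its update in the iteration `var 68`. -/
def sharing : Program :=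
  tossing 24 [] .full ;; announcing ;;
  .ite (entry 11 [var 67])
    (assign 25 [] (entry 12 [var 67, var 68, var 65]) ;; closing .full 67) .skip ;;
  copy 63 [var 67, var 65] 24 []

@[simp] theorem tame_closing {lo hi v : ℕ} {md : Modulus} :
    (closing md v).Tame lo hi ↔ lo ≤ 20 ∧ 24 < hi := by
  simp [closing]
  omega

@[simp] theorem tame_sharing {lo hi : ℕ} : sharing.Tame lo hi ↔ lo ≤ 20 ∧ 63 < hi := by
  simp [sharing]
  omega

/-- The coins of a corrupt sender are drawn as they are, and its own share is completed from its
known input. For an honest sender the shares of the parties other than `h` are uniform and are drawn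
without the input. -/
theorem sim_sharing {x : ZMod (2 ^ k)} {i : Fin n} {t r : ℕ} (hE : Env P d I h s)
    (hi : s.mem 67 [] = i) (ht : s.mem 65 [] = t) (hr : s.mem 68 [] = r)
    (hx : i ∈ I → s.mem 12 [(i : ℕ), r, t] = x.val) :
    Sim I (shareInput i x) sharing s fun z s' => Holds h s' 63 [(i : ℕ), t] z ∧
      (∀ l, (∀ p : Fin n, l ≠ [(i : ℕ), t, (p : ℕ)]) → s'.mem 63 l = s.mem 63 l) ∧
      ∀ b, b < 20 ∨ 26 ≤ b → b ≠ 63 → s'.mem b = s.mem b := by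
  have key : Sim I (sample (Sharing n (2 ^ k))) (tossing 24 [] .full) s fun u s' =>
      (∀ j, j ≠ i → (i ∈ I ∨ j ∈ I) → s'.mem 24 [(j : ℕ)] = (u j).val) ∧
      (i ∉ I → Holds h s' 24 [] (complete i x u)) ∧ Agree n 24 [] s s' := by
    by_cases hiI : i ∈ I
    · exact (sim_sample (md := .full) rfl (pre := []) hE (by decide) fun _ _ => rfl).mono
        fun u s' ⟨h1, h2⟩ => ⟨fun j _ _ => h1 j, fun hh => absurd hiI hh, h2⟩
    · refine (sim_sample_complete (md := .full) rfl (pre := []) hE (by decide) (fun _ _ => rfl)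
        i x).mono fun u s' ⟨h1, h2⟩ => ⟨fun j hj hI => ?_, fun _ => h1, h2⟩
      -- The sender is honest here, so the message is seen only by a corrupt `j`, which differs from
      -- `h`.
      have hj' : j ≠ h := fun hh => hE.honest_notMem (hh ▸ hI.resolve_left hiI)
      have := h1 j hj'
      rwa [complete, Function.update_of_ne hj] at this
  refine key.bind fun u s₁ ⟨h₁, h₁', hA⟩ => ?_
  have f₁ : ∀ b, b < 20 ∨ 26 ≤ b → s₁.mem b = s.mem b := fun b hb =>
    hA.frame b (by omega) (by omega)
  have hE₁ := hE.frame fun b hb => f₁ b (Or.inl hb)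
  refine Sim.bind (R := fun _ s' => ∀ b, b ≠ 20 → s'.mem b = s₁.mem b) (Sim.record
    ((wp_announcing hE₁ (by rw [f₁ 67 (by decide), hi]) h₁).mono fun _ ⟨h1, h2⟩ => ⟨h2, h1⟩))
    fun _ s₂ hs₂ => ?_
  have f₂ : ∀ b, b < 20 ∨ 26 ≤ b → s₂.mem b = s.mem b := fun b hb => by
    rw [hs₂ b (by omega), f₁ b hb]
  have hE₂ := hE.frame fun b hb => f₂ b (Or.inl hb)
  refine Sim.pure (Program.wp_seq (Program.wp.mono (R := fun s₃ => s₃.out = s₂.out ∧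
    Holds h s₃ 24 [] (complete i x u) ∧ ∀ b, b < 20 ∨ 26 ≤ b → s₃.mem b = s.mem b) ?_
    fun s₃ ⟨h3, h4, f₃⟩ => ?_))
  · have hc : (entry 11 [var 67]).eval s₂ = if i ∈ I then 1 else 0 := by
      have := hE₂.corrupt i
      simp [f₂ 67, hi, this]
    refine Program.wp_ite (fun hne t' => ?_) fun he t' => ?_
    · have hiI : i ∈ I := by
        by_contra hiI
        simp [hc, hiI] at hne
      refine Program.wp_seq (wp_assign_var.mono fun s₃ ⟨h3, h4, h5⟩ => ?_)
      have f₃ : ∀ b, b < 20 ∨ 26 ≤ b → s₃.mem b = s.mem b := fun b hb => by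
        rw [h5 b (by omega), State.mem_tick, f₂ b hb]
      refine (wp_closing (md := .full) (x := complete i x u) (i₀ := i) rfl
        (hE.frame fun b hb => f₃ b (Or.inl hb)) (by rw [f₃ 67 (by decide), hi])
        (by decide) (fun p hp => ?_) ?_).mono fun s₄ ⟨h6, h7, h8⟩ =>
          ⟨h6.trans h3, fun p _ => h7 p, fun b hb => ?_⟩
      · rw [h5 24 (by decide), State.mem_tick, hs₂ 24 (by decide), complete,
          Function.update_of_ne hp]
        exact h₁ p hp (Or.inl hiI)
      · rw [h4, sum_complete]
        simp [f₂ 67, f₂ 68, f₂ 65, f₂ 12, hi, ht, hr, hx hiI]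
      · rw [h8 b (by omega) (by omega) (by omega), f₃ b hb]
    · have hiI : i ∉ I := by
        intro hiI
        simp [hc, hiI] at he
      refine Program.wp_skip ⟨rfl, fun p hp => ?_, f₂⟩
      rw [State.mem_tick, State.mem_tick, hs₂ 24 (by decide)]
      exact h₁' hiI p hp
  · refine (wp_copy (hE.frame fun b hb => f₃ b (Or.inl hb)) (by decide) (by decide) (by decide)
      ((Stable.var (v := 67) (i := i) (by decide) (by decide)
        (by rw [f₃ 67 (by decide), hi])).append_var (v := 65) (i := t) (by decide) (by decide)
        (by rw [f₃ 65 (by decide), ht]))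
      Stable.nil h4).mono fun s₄ ⟨h5, h6, h7⟩ => ⟨h5.trans h3, h6, fun l hl => ?_, fun b hb hb' => ?_⟩
    · rw [h7.other l hl, f₃ 63 (by decide)]
    · rw [h7.frame b hb' (by omega), f₃ b hb]

/-- Party `var 66` contributes the vector with the shares `e`. -/
def storing (e : Expr) : Program := .loop 65 (var 2) (fill 64 [var 66, var 65] e)

@[simp] theorem tame_storing {lo hi : ℕ} {e : Expr} : (storing e).Tame lo hi ↔
    (lo ≤ 20 ∧ 65 < hi) ∧ e.Small := by
  simp only [storing, tame_loop, tame_fill, short_var_two, and_true]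
  constructor
  · rintro ⟨h1, h2, h3, h4⟩
    exact ⟨⟨h2.1, h1.2⟩, h4⟩
  · rintro ⟨⟨h1, h2⟩, h3⟩
    exact ⟨by omega, by omega, by omega, h3⟩

/-- Rows of different parties are told apart by the first index: storing for `j` leaves every index
list with another head alone. -/
theorem wp_storing {j : Fin n} {e : Expr} (y : Fin d → Sharing n (2 ^ k)) (hE : Env P d I h s)
    (hj : s.mem 66 [] = j)
    (he : ∀ (t : Fin d) (p : Fin n) (s' : State),
      (∀ b, b ≠ 20 → b ≠ 64 → b ≠ 65 → s'.mem b = s.mem b) → s'.mem 20 [] = p → s'.mem 65 [] = t →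
      p ≠ h → e.eval s' = (y t p).val) :
    (storing e).wp s fun s' => s'.out = s.out ∧
      (∀ t : Fin d, Holds h s' 64 [(j : ℕ), (t : ℕ)] (y t)) ∧
      (∀ l, l.head? ≠ some (j : ℕ) → s'.mem 64 l = s.mem 64 l) ∧
      ∀ b, b ≠ 20 → b ≠ 64 → b ≠ 65 → s'.mem b = s.mem b := by
  refine Program.wp_loop (fun i s' => s'.out = s.out ∧
      (∀ t : Fin d, (t : ℕ) < i → Holds h s' 64 [(j : ℕ), (t : ℕ)] (y t)) ∧
      (∀ l, l.head? ≠ some (j : ℕ) → s'.mem 64 l = s.mem 64 l) ∧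
      ∀ b, b ≠ 20 → b ≠ 64 → b ≠ 65 → s'.mem b = s.mem b)
    (fun _ => ⟨rfl, by simp, fun _ _ => rfl, fun _ _ _ _ => rfl⟩) ?_ ?_
  · intro i hi s₁ ⟨h1, h2, h3, h4⟩ u
    rw [eval_var, hE.dim] at hi
    have f₁ : ∀ b, b ≠ 20 → b ≠ 64 → b ≠ 65 → ((s₁.write 65 [] i).tick u).mem b = s.mem b :=
      fun b hb hb' hb'' => by
        rw [State.mem_tick, State.mem_write_of_ne _ _ _ hb'', h4 b hb hb' hb'']
    have h64 : ((s₁.write 65 [] i).tick u).mem 64 = s₁.mem 64 := by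
      rw [State.mem_tick, State.mem_write_of_ne _ _ _ (by decide)]
    have h65 := mem_loop s₁ 65 i u
    have ho : ((s₁.write 65 [] i).tick u).out = s₁.out := rfl
    generalize (s₁.write 65 [] i).tick u = s₂ at *
    refine (wp_fill [(j : ℕ), i] (y ⟨i, hi⟩) (hE.frame fun b hb => f₁ b (by omega) (by omega)
      (by omega)) (by decide) fun p s' hA h20 _ _ => ⟨?_, fun hp => ?_⟩).mono
      fun s₃ ⟨h5, h6, h7⟩ => ⟨by rw [h5, ho, h1], fun t ht => ?_, fun l hl => ?_,
        fun b hb hb' hb'' => ?_⟩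
    · simp [hA.frame 66, hA.frame 65, f₁ 66, hj, h65]
    · exact he _ p s' (fun b hb hb' hb'' => by rw [hA.frame b hb' hb, f₁ b hb hb' hb'']) h20
        (by rw [hA.frame 65 (by decide) (by decide), h65]) hp
    · by_cases hti : (t : ℕ) = i
      · have : t = ⟨i, hi⟩ := Fin.ext hti
        subst this
        exact h6
      · refine h7.holds_of_ne (pre := [(j : ℕ)]) hti fun p hp => ?_
        rw [h64]
        exact h2 t (by omega) p hp
    · rw [h7.other l fun p hp => hl (by simp [hp]), h64, h3 l hl]
    · rw [h7.frame b hb' hb, f₁ b hb hb' hb'']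
  · intro s₁ ⟨h1, h2, h3, h4⟩
    rw [eval_var, hE.dim] at h2
    exact ⟨h1, fun t => h2 t t.2, h3, h4⟩

/-- The contribution of party `var 66` to the aggregated model of party `var 67` in the iteration
`var 68`. -/
def contributing : Program :=
  .ite (differ (var 66) (var 67))
    (cosining 63 [var 67] 63 [var 66] ;;
      deciding (entry 14 [var 18, var 68, var 67, var 66]) ;;
      .ite (entry 14 [var 18, var 68, var 67, var 66]) (storing (.lit 0))
        (normalizing 63 [var 66] 63 [var 67] ;; storing (entry 50 [var 65, var 20])))
    (storing (.lit 0))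

@[simp] theorem tame_contributing {lo hi : ℕ} : contributing.Tame lo hi ↔ lo ≤ 20 ∧ 65 < hi := by
  simp [contributing]
  omega

/-- The protocol branches on the disclosed bit, the simulator on its copy in array `14`. By
correctness of the cosine and of the comparison they agree, so both sides take the same branch. -/
theorem sim_contributing [NeZero n] (hk : 0 < k) {x : Fin n → Fin R → Fin d → ZMod (2 ^ k)}
    {p₀ i j : Fin n} {r : Fin R} {w : Fin n → Fin d → Sharing n (2 ^ k)}
    (hE : Env P d I h s) (hK : Known P I x p₀ s)
    (hj : s.mem 66 [] = j) (hi : s.mem 67 [] = i) (hr : s.mem 68 [] = r)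
    (hW : ∀ (j : Fin n) (t : Fin d), Holds h s 63 [(j : ℕ), (t : ℕ)] (w j t)) (hw : ∀ j t, ∑ p, w j t p = x j r t) :
    Sim I (contribution P w i j) contributing s fun z s' =>
      (∀ t : Fin d, Holds h s' 64 [(j : ℕ), (t : ℕ)] (z.2 t)) ∧ (j = i → z.2 = 0) ∧
      (∀ l, l.head? ≠ some (j : ℕ) → s'.mem 64 l = s.mem 64 l) ∧
      ∀ b, b < 20 ∨ b = 63 ∨ 66 ≤ b → s'.mem b = s.mem b := by
  have hd := eval_differ s (var 66) (var 67)
  rw [eval_var, eval_var, hj, hi] at hd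
  have store_zero : ∀ s' : State, Same 60 s s' → (storing (.lit 0)).wp s' fun s'' =>
      s''.out = s'.out ∧ (∀ t : Fin d, Holds h s'' 64 [(j : ℕ), (t : ℕ)] (0 : Sharing n (2 ^ k))) ∧
      (∀ l, l.head? ≠ some (j : ℕ) → s''.mem 64 l = s.mem 64 l) ∧
      ∀ b, b < 20 ∨ b = 63 ∨ 66 ≤ b → s''.mem b = s.mem b := fun s' f =>
    (wp_storing 0 (f.env hE) (by rw [f 66 (by decide), hj]) fun t p _ _ _ _ _ => by simp).mono
      fun s'' ⟨h1, h2, h3, h4⟩ => ⟨h1, h2, fun l hl => by rw [h3 l hl, f 64 (by decide)],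
        fun b hb => by rw [h4 b (by omega) (by omega) (by omega), f b (by omega)]⟩
  rw [contribution]
  by_cases hji : j = i
  -- The receiver's own row is set to `0`, so that the later sum may run over all clients.
  · rw [if_pos hji]
    refine Sim.ite_neg (hd.2 (congrArg Fin.val hji)) fun t => Sim.pure ?_
    have hs : Same 60 s (s.tick t) := fun _ _ => rfl
    exact (store_zero _ hs).mono fun s' ⟨h1, h2, h3⟩ => ⟨h1, h2, fun _ => rfl, h3⟩
  · rw [if_neg hji]
    refine Sim.ite_pos (fun hh => hji (Fin.ext (hd.1 hh))) fun t => ?_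
    have f₀ : Same 60 s (s.tick t) := fun _ _ => rfl
    have hflag : ∀ s', Same 60 s s' → (entry 14 [var 18, var 68, var 67, var 66]).eval s' =
        if signedLT (cosineClear P (x i r) (x j r)) P.tau then 1 else 0 := fun s' f => by
      have := hK.rejected r i j
      rw [rejectedClear, if_neg hji] at this
      simp [f 14, f 18, f 68, f 67, f 66, hi, hj, hr, hK.witness, this]
    have hx : ∀ j, (fun t => ∑ p, w j t p) = fun t => x j r t := fun j => funext (hw j)
    refine ((sim_cosining (f₀.env hE) (by decide) (by decide) (Fixed.var (by decide) hi)
      (Fixed.var (by decide) hj) (fun t => hW i t) fun t => hW j t).and_ensures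
      (ensures_cosineShares P _ _)).bind fun c s₁ ⟨⟨h₁, f₁⟩, hc⟩ => ?_
    replace f₁ : Same 60 s s₁ := f₀.trans (f₁.mono (by decide))
    rw [hx, hx] at hc
    refine (sim_deciding hk (f₁.env hE) h₁ fun s' f => ?_).bind fun b s₂ ⟨h₂, f₂⟩ => ?_
    · rw [hflag s' (f₁.trans f), hc]
    replace f₂ := f₁.trans f₂
    rw [hc] at h₂
    have hflag' := hflag s₂ f₂
    rw [← h₂] at hflag'
    cases b with
    | true =>
      refine Sim.ite_pos (by simp [hflag']) fun t => ?_
      rw [if_pos rfl]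
      replace f₂ : Same 60 s (s₂.tick t) := f₂
      exact Sim.pure ((store_zero _ f₂).mono fun s' ⟨h1, h2, h3⟩ => ⟨h1, h2, fun _ => rfl, h3⟩)
    | false =>
      refine Sim.ite_neg (by simp [hflag']) fun t => ?_
      rw [if_neg (by decide)]
      replace f₂ : Same 60 s (s₂.tick t) := f₂
      refine Sim.post (sim_normalizing (f₂.env hE) (by decide) (by decide)
        (Fixed.var (by decide) (by rw [f₂ 66 (by decide), hj]))
        (Fixed.var (by decide) (by rw [f₂ 67 (by decide), hi]))
        (fun t => f₂.holds (by decide) (hW j t)) fun t => f₂.holds (by decide) (hW i t))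
        fun v s₃ ⟨h₃, f₃⟩ => ?_
      replace f₃ : Same 60 s s₃ := f₂.trans (f₃.mono (by decide))
      refine (wp_storing v (f₃.env hE) (by rw [f₃ 66 (by decide), hj])
        fun t p s' hs' h20 h65 hp => ?_).mono fun s' ⟨h1, h2, h3, h4⟩ =>
          ⟨h1, h2, fun hh => absurd hh hji, fun l hl => by rw [h3 l hl, f₃ 64 (by decide)],
            fun b hb => by rw [h4 b (by omega) (by omega) (by omega), f₃ b (by omega)]⟩
      have := h₃ t p hp
      rw [← hs' 50 (by decide) (by decide) (by decide)] at this
      simpa [h20, h65] using this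

end Top

/-! ### Delivery of the models and the loop over the iterations -/

section Top

variable {n k d R : ℕ} {P : Params k} {I : Finset (Fin n)} {h : Fin n} {s : State}

/-- The aggregated coordinate `var 65` is opened to party `var 67`. -/
def delivering : Program :=
  summing 66 (var 0) 62 (entry 64 [var 66, var 65, var 20]) ;;
  fill 24 [] ((var 9 * (entry 62 [var 20] + entry 63 [var 67, var 65, var 20])) %
    Modulus.full.order) ;;
  .ite (entry 11 [var 67]) (assign 25 [] (entry 13 [var 67, var 68, var 65]) ;; closing .full 17)
    .skip ;;
  .ite (entry 11 [var 67]) (.loop 20 (var 0) (.ite (differ (var 20) (var 67))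
    (emitEvent (var 67) (var 20 + .lit 2) (entry 24 [var 20])) .skip)) .skip

@[simp] theorem tame_delivering {lo hi : ℕ} : delivering.Tame lo hi ↔ lo ≤ 20 ∧ 66 < hi := by
  simp [delivering]
  omega

/-- An honest receiver produces nothing visible. For a corrupt one the opened value is its own
output in array `13`, which forces the share of `h`. -/
theorem sim_delivering {i : Fin n} {t : Fin d} {r : ℕ} {w : Fin n → Fin d → Sharing n (2 ^ k)}
    {res : Fin n → Bool × (Fin d → Sharing n (2 ^ k))} (hE : Env P d I h s)
    (ht : s.mem 65 [] = t) (hi : s.mem 67 [] = i) (hr : s.mem 68 [] = r)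
    (hW : ∀ (j : Fin n) (t : Fin d), Holds h s 63 [(j : ℕ), (t : ℕ)] (w j t))
    (hres : ∀ (j : Fin n) (t : Fin d), Holds h s 64 [(j : ℕ), (t : ℕ)] ((res j).2 t))
    (hres' : (res i).2 = 0)
    (hm : i ∈ I → s.mem 13 [(i : ℕ), r, (t : ℕ)] = (∑ p, aggregated P w i res t p).val) :
    Sim I (revealTo i (aggregated P w i res t)) delivering s fun _ s' =>
      ∀ b, b < 20 ∨ 63 ≤ b → b ≠ 66 → s'.mem b = s.mem b := by
  refine Sim.pre (wp_summing (fun j => (res j).2 t) hE (by decide) (by decide) (by decide)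
    (fun s' hE' => by simp [hE'.parties]) fun j p s' hs' h20 h66 hp _ => ?_)
    fun s₁ ⟨h₁, hs₁⟩ => ?_
  · have := hres j t p hp
    rw [← hs' 64 (by decide) (by decide) (by decide)] at this
    simpa [h20, h66, hs' 65, ht] using this
  have f₁ : ∀ b, b < 20 ∨ 63 ≤ b → b ≠ 66 → s₁.mem b = s.mem b :=
    fun b hb hb' => hs₁ b (by omega) (by omega) hb'
  refine Sim.pre (wp_fill [] (aggregated P w i res t)
    (hE.frame fun b hb => f₁ b (by omega) (by omega)) (by decide) fun p s' hA h20 _ hE' =>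
      ⟨rfl, fun hp => ?_⟩) fun s₂ ⟨h₂, hA₂⟩ => ?_
  · rw [eval_mod, Modulus.Has.order_eval (md := .full) rfl hE']
    apply mod_eq_val
    have e1 := h₁ p hp
    have e2 := hW i t p hp
    rw [← hA.frame 62 (by decide) (by decide)] at e1
    rw [← f₁ 63 (by decide) (by decide), ← hA.frame 63 (by decide) (by decide)] at e2
    rw [← f₁ 65 (by decide) (by decide), ← hA.frame 65 (by decide) (by decide)] at ht
    rw [← f₁ 67 (by decide) (by decide), ← hA.frame 67 (by decide) (by decide)] at hi
    simp only [List.nil_append, List.cons_append] at e1 e2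
    -- `hres'` turns the sum over all clients into the sum over `j ≠ i`.
    simp [h20, e1, e2, ht, hi, hE'.invN, aggregated, hres', Finset.sum_apply]
  have f₂ : ∀ b, b < 20 ∨ 63 ≤ b → b ≠ 66 → s₂.mem b = s.mem b :=
    fun b hb hb' => by rw [hA₂.frame b (by omega) (by omega), f₁ b hb hb']
  have hE₂ := hE.frame fun b hb => f₂ b (Or.inl hb) (by omega)
  rw [← f₂ 65 (by decide) (by decide)] at ht
  rw [← f₂ 67 (by decide) (by decide)] at hi
  rw [← f₂ 68 (by decide) (by decide)] at hr
  rw [← f₂ 13 (by decide) (by decide)] at hm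
  have hc : (entry 11 [var 67]).eval s₂ = if i ∈ I then 1 else 0 := by
    simp [hi, hE₂.corrupt i]
  refine Sim.map (m := record _) (R := fun _ s' => ∀ b, b < 20 ∨ 63 ≤ b → b ≠ 66 →
    s'.mem b = s.mem b) (Sim.record ?_) fun _ _ h => h
  refine Program.wp_seq (Program.wp.mono (R := fun s₃ => s₃.out = s₂.out ∧
    (i ∈ I → ∀ p : Fin n, s₃.mem 24 [(p : ℕ)] = (aggregated P w i res t p).val) ∧
      ∀ b, b < 20 ∨ 63 ≤ b → s₃.mem b = s₂.mem b) ?_ fun s₃ ⟨h3, h4, f₃⟩ => ?_)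
  · refine Program.wp_ite (fun hne u => ?_) fun he u => ?_
    · have hiI : i ∈ I := by
        by_contra hiI
        simp [hc, hiI] at hne
      refine Program.wp_seq (wp_assign_var.mono fun s₃ ⟨h3, h4, h5⟩ => ?_)
      refine (wp_closing (md := .full) (x := aggregated P w i res t) (i₀ := h) rfl
        (hE₂.frame fun b hb => h5 b (by omega)) (by rw [h5 17 (by decide)]; exact hE₂.honest)
        (by decide) (fun p hp => ?_) ?_).mono fun s₄ ⟨h6, h7, h8⟩ =>
          ⟨h6.trans h3, fun _ => h7, fun b hb => ?_⟩
      · rw [h5 24 (by decide)]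
        exact h₂ p hp
      · rw [h4, ← hm hiI]
        simp [hi, hr, ht]
      · rw [h8 b (by omega) (by omega) (by omega), h5 b (by omega), State.mem_tick]
    · have hiI : i ∉ I := by
        intro hiI
        simp [hc, hiI] at he
      exact Program.wp_skip ⟨rfl, fun hh => absurd hh hiI, fun _ _ => rfl⟩
  · have hE₃ := hE₂.frame fun b hb => f₃ b (Or.inl hb)
    by_cases hiI : i ∈ I
    · refine (wp_receive hE₃ (by decide) i (by rw [f₃ 67 (by decide), hi]) (h4 hiI)).mono
        fun s₄ ⟨h5, h6⟩ => ⟨by rw [h6, h3], fun b hb hb' => ?_⟩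
      rw [h5 b (by omega), f₃ b hb, f₂ b hb hb']
    · have hvis : visible I (((List.finRange n).filter (· ≠ i)).map fun j =>
          (⟨i, .party j, (aggregated P w i res t j).val⟩ : Event n)) = [] := by
        simp [visible, hiI]
      rw [hvis]
      refine Program.wp_ite (fun hne _ => ?_) fun _ u => Program.wp_skip
        ⟨by simp [h3], fun b hb hb' => (f₃ b hb).trans (f₂ b hb hb')⟩
      have hc' : (entry 11 [var 67]).eval s₃ = 0 := by
        have := hE₃.corrupt i
        simp [f₃ 67, hi, this, hiI]
      exact absurd hc' hne

/-- Aggregation for party `var 67` in the iteration `var 68`. -/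
def aggregating : Program :=
  .loop 66 (var 0) contributing ;; .loop 65 (var 2) delivering

@[simp] theorem tame_aggregating {lo hi : ℕ} : aggregating.Tame lo hi ↔ lo ≤ 20 ∧ 66 < hi := by
  simp [aggregating]
  omega

/-- Simulation supplies shares of the contributions, correctness their sums. By `sum_aggregated` the
opened coordinates are then those of the prescribed model. -/
theorem sim_aggregating [NeZero n] (hk : 0 < k) {x : Fin n → Fin R → Fin d → ZMod (2 ^ k)}
    {p₀ i : Fin n} {r : Fin R} {w : Fin n → Fin d → Sharing n (2 ^ k)}
    (hE : Env P d I h s) (hK : Known P I x p₀ s) (hi : s.mem 67 [] = i) (hr : s.mem 68 [] = r)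
    (hW : ∀ (j : Fin n) (t : Fin d), Holds h s 63 [(j : ℕ), (t : ℕ)] (w j t))
    (hw : ∀ j t, ∑ p, w j t p = x j r t) :
    Sim I (aggregate P w i) aggregating s fun _ s' =>
      ∀ b, b < 20 ∨ b = 63 ∨ 67 ≤ b → s'.mem b = s.mem b := by
  let J : State → Prop := fun s' => ∀ b, b < 20 ∨ b = 63 ∨ 67 ≤ b → s'.mem b = s.mem b
  refine Sim.bind (m := forFin (contribution P w i)) (R := fun res s' =>
    (∀ j, (res j).1 = rejectedClear P (fun i => x i r) i j ∧ (j ≠ i → ∀ t, ∑ p, (res j).2 t p =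
      if rejectedClear P (fun i => x i r) i j then 0 else
        normalizeClear P (x j r) (x i r) t)) ∧
    (∀ (j : Fin n) (t : Fin d), Holds h s' 64 [(j : ℕ), (t : ℕ)] ((res j).2 t)) ∧
    (res i).2 = 0 ∧ J s') ?_ fun res s₁ ⟨h₁, h₂, h₃, f₁⟩ => ?_
  · refine ((Sim.forFin (by simp [hE.parties]) J (fun j z s' =>
      (∀ t : Fin d, Holds h s' 64 [(j : ℕ), (t : ℕ)] (z.2 t)) ∧ (j = i → z.2 = 0))
      (fun _ _ _ => rfl) fun j s₁ f₁ t => ?_).and_ensures (Ensures.forFin fun j =>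
        ensures_contribution P w i j (fun i => x i r) hw)).mono fun res s' ⟨⟨hJ, hR⟩, hres⟩ =>
          ⟨hres, fun j => (hR j).1, (hR i).2 rfl, hJ⟩
    have f₂ : J ((s₁.write 66 [] j).tick t) := fun b hb => by
      rw [State.mem_tick, State.mem_write_of_ne _ _ _ (by omega), f₁ b hb]
    have hj := mem_loop s₁ 66 j t
    have h64 : ((s₁.write 66 [] j).tick t).mem 64 = s₁.mem 64 := by
      rw [State.mem_tick, State.mem_write_of_ne _ _ _ (by decide)]
    generalize (s₁.write 66 [] j).tick t = s₂ at *
    refine (sim_contributing hk (hE.frame fun b hb => f₂ b (Or.inl hb))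
      (hK.frame fun b hb => f₂ b (Or.inl hb)) hj (by rw [f₂ 67 (by decide), hi])
      (by rw [f₂ 68 (by decide), hr]) (fun j t p hp => ?_) hw).mono fun z s₃ ⟨h3, h4, h5, h6⟩ =>
        ⟨fun b hb => by rw [h6 b (by omega), f₂ b hb], ⟨h3, h4⟩, fun j' z' hj' ⟨h7, h8⟩ =>
          ⟨fun t p hp => ?_, h8⟩⟩
    · rw [f₂ 63 (by decide)]
      exact hW j t p hp
    · rw [h5 _ (by simpa using (Fin.lt_def.1 hj').ne), h64]
      exact h7 t p hp
  · have hE₁ := hE.frame fun b hb => f₁ b (Or.inl hb)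
    have hK₁ := hK.frame fun b hb => f₁ b (Or.inl hb)
    -- The contributions in array `64` are needed for every coordinate, so the invariant preserves
    -- them.
    refine Sim.map (m := forFin fun t => revealTo i (aggregated P w i res t))
      (R := fun _ s' => J s') ((Sim.forFin (by simp [hE₁.dim])
      (fun s' => J s' ∧ s'.mem 64 = s₁.mem 64) (fun _ _ _ => True) (fun _ => ⟨f₁, rfl⟩)
      fun t s₂ ⟨f₂, h64⟩ u => ?_).mono fun _ _ h => h.1.1) fun _ _ h => h
    have f₃ : J ((s₂.write 65 [] t).tick u) := fun b hb => by
      rw [State.mem_tick, State.mem_write_of_ne _ _ _ (by omega), f₂ b hb]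
    have h65 := mem_loop s₂ 65 t u
    have h64' : ((s₂.write 65 [] t).tick u).mem 64 = s₁.mem 64 := by
      rw [State.mem_tick, State.mem_write_of_ne _ _ _ (by decide), h64]
    generalize (s₂.write 65 [] t).tick u = s₃ at *
    have hK₃ := hK.frame fun b hb => f₃ b (Or.inl hb)
    refine (sim_delivering (r := r) (hE.frame fun b hb => f₃ b (Or.inl hb)) h65
      (by rw [f₃ 67 (by decide), hi]) (by rw [f₃ 68 (by decide), hr]) (fun j t p hp => ?_)
      (fun j t p hp => ?_) h₃ fun hiI => ?_).mono fun _ s₄ h4 =>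
        ⟨⟨fun b hb => ?_, ?_⟩, trivial, fun _ _ _ _ => trivial⟩
    · rw [f₃ 63 (by decide)]
      exact hW j t p hp
    · rw [h64']
      exact h₂ j t p hp
    · rw [hK₃.model i hiI, sum_aggregated P w i (fun i => x i r) hw res h₁]
    · rw [h4 b (by omega) (by omega), f₃ b hb]
    · rw [h4 64 (by decide) (by decide), h64']

/-- The messages of all iterations. -/
def iterating : Program :=
  .loop 68 (var 3) (.loop 67 (var 0) (.loop 65 (var 2) sharing) ;; .loop 67 (var 0) aggregating)

@[simp] theorem tame_iterating {lo hi : ℕ} : iterating.Tame lo hi ↔ lo ≤ 20 ∧ 68 < hi := by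
  simp [iterating]
  omega

/-- Every iteration shares its updates afresh, so nothing but the read-only arrays below `20` has to
survive from one iteration to the next. -/
theorem sim_iterating [NeZero n] (hk : 0 < k) {x : Fin n → Fin R → Fin d → ZMod (2 ^ k)}
    {p₀ : Fin n} (hE : Env P d I h s) (hK : Known P I x p₀ s) :
    Sim I (forFin fun r => iteration P fun i => x i r) iterating s fun _ _ => True := by
  refine (Sim.forFin (by simp [hK.iters]) (fun s' => ∀ b < 20, s'.mem b = s.mem b)
    (fun _ _ _ => True) (fun _ _ _ => rfl) fun r s₁ f₁ u => ?_).mono fun _ _ _ => trivial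
  have f₂ : ∀ b < 20, ((s₁.write 68 [] r).tick u).mem b = s.mem b := fun b hb => by
    rw [State.mem_tick, State.mem_write_of_ne _ _ _ (by omega), f₁ b hb]
  have hr := mem_loop s₁ 68 r u
  generalize (s₁.write 68 [] r).tick u = s₂ at *
  have hE₂ := hE.frame f₂
  have hK₂ := hK.frame f₂
  refine Sim.bind (R := fun w s' => (∀ j t, ∑ p, w j t p = x j r t) ∧
    (∀ (j : Fin n) (t : Fin d), Holds h s' 63 [(j : ℕ), (t : ℕ)] (w j t)) ∧
    ∀ b, b < 20 ∨ b = 68 → s'.mem b = s₂.mem b) ?_ fun w s₃ ⟨h₁, h₂, f₃⟩ => ?_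
  · refine ((Sim.forFin (by simp [hE₂.parties]) (fun s' => ∀ b, b < 20 ∨ b = 68 →
      s'.mem b = s₂.mem b) (fun i w s' => ∀ t : Fin d, Holds h s' 63 [(i : ℕ), (t : ℕ)] (w t))
      (fun _ _ _ => rfl) fun i s₃ f₃ u => ?_).and_ensures (Ensures.forFin fun i =>
        Ensures.forFin (Q := fun t z => ∑ p, z p = x i r t) fun t =>
          (Ensures.trivial _).bind fun u _ => (Ensures.trivial _).bind fun _ _ =>
            Ensures.pure (sum_complete _ _ _))).mono fun w s' ⟨⟨hJ, hR⟩, hw⟩ => ⟨hw, hR, hJ⟩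
    have f₄ : ∀ b, b < 20 ∨ b = 68 → ((s₃.write 67 [] i).tick u).mem b = s₂.mem b :=
      fun b hb => by
        rw [State.mem_tick, State.mem_write_of_ne _ _ _ (by omega), f₃ b hb]
    have hi := mem_loop s₃ 67 i u
    have h63 : ((s₃.write 67 [] i).tick u).mem 63 = s₃.mem 63 := by
      rw [State.mem_tick, State.mem_write_of_ne _ _ _ (by decide)]
    generalize (s₃.write 67 [] i).tick u = s₄ at *
    have hE₄ := hE₂.frame fun b hb => f₄ b (Or.inl hb)
    refine (Sim.forFin (by simp [hE₄.dim]) (fun s' => (∀ b, b < 20 ∨ b = 67 ∨ b = 68 →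
      s'.mem b = s₄.mem b) ∧ ∀ l, l.head? ≠ some (i : ℕ) → s'.mem 63 l = s₄.mem 63 l)
      (fun t z s' => Holds h s' 63 [(i : ℕ), (t : ℕ)] z) (fun _ => ⟨fun _ _ => rfl, fun _ _ => rfl⟩)
      fun t s₅ ⟨f₅, g₅⟩ u => ?_).mono fun w s' ⟨⟨h3, h4⟩, h5⟩ =>
        ⟨fun b hb => by rw [h3 b (by omega), f₄ b hb], h5, fun j w' hj hw' t p hp => ?_⟩
    · have f₆ : ∀ b, b < 20 ∨ b = 67 ∨ b = 68 →
          ((s₅.write 65 [] t).tick u).mem b = s₄.mem b := fun b hb => by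
        rw [State.mem_tick, State.mem_write_of_ne _ _ _ (by omega), f₅ b hb]
      have ht := mem_loop s₅ 65 t u
      have h63' : ((s₅.write 65 [] t).tick u).mem 63 = s₅.mem 63 := by
        rw [State.mem_tick, State.mem_write_of_ne _ _ _ (by decide)]
      generalize (s₅.write 65 [] t).tick u = s₆ at *
      refine (sim_sharing (r := r) (hE₄.frame fun b hb => f₆ b (Or.inl hb))
        (by rw [f₆ 67 (by decide), hi]) ht (by rw [f₆ 68 (by decide), f₄ 68 (by decide), hr])
        fun hiI => ?_).mono fun z s₇ ⟨h3, h4, h5⟩ => ⟨⟨fun b hb => ?_, fun l hl => ?_⟩, h3,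
          fun j z' hj hz' p hp => ?_⟩
      · rw [f₆ 12 (by decide), f₄ 12 (by decide), hK₂.input i hiI]
      · rw [h5 b (by omega) (by omega), f₆ b hb]
      · rw [h4 l fun p hp => hl (by simp [hp]), h63', g₅ l hl]
      · rw [h4 _ fun p' hp' => ?_, h63']
        · exact hz' p hp
        · exact (Fin.lt_def.1 hj).ne (by simpa using (List.cons.inj (List.cons.inj hp').2).1)
    · rw [h4 _ (by simpa using (Fin.lt_def.1 hj).ne), h63]
      exact hw' t p hp
  · have hE₃ := hE₂.frame fun b hb => f₃ b (Or.inl hb)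
    refine (Sim.forFin (by simp [hE₃.parties]) (fun s' => ∀ b, b < 20 ∨ b = 63 ∨ b = 68 →
      s'.mem b = s₃.mem b) (fun _ _ _ => True) (fun _ _ _ => rfl) fun i s₄ f₄ u => ?_).mono
      fun _ s' ⟨h3, _⟩ => ⟨fun b hb => by rw [h3 b (Or.inl hb), f₃ b (Or.inl hb), f₂ b hb],
        trivial, fun _ _ _ _ => trivial⟩
    have f₅ : ∀ b, b < 20 ∨ b = 63 ∨ b = 68 → ((s₄.write 67 [] i).tick u).mem b = s₃.mem b :=
      fun b hb => by
        rw [State.mem_tick, State.mem_write_of_ne _ _ _ (by omega), f₄ b hb]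
    have hi := mem_loop s₄ 67 i u
    generalize (s₄.write 67 [] i).tick u = s₅ at *
    have f₆ : ∀ b < 20, s₅.mem b = s₂.mem b := fun b hb => by
      rw [f₅ b (Or.inl hb), f₃ b (Or.inl hb)]
    refine (sim_aggregating hk (hE₂.frame f₆) (hK₂.frame f₆) hi
      (by rw [f₅ 68 (by decide), f₃ 68 (by decide), hr]) (fun j t p hp => ?_) h₁).mono
      fun _ s₆ h6 => ⟨fun b hb => ?_, trivial, fun _ _ _ _ => trivial⟩
    · rw [f₅ 63 (by decide)]
      exact h₂ j t p hp
    · rw [h6 b (by omega), f₅ b hb]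

end Top

/-! ## The simulator -/

/-- A prefix of the program without counterpart in the protocol. Unlike in `Sim.pre`, it may write
to the tape, as the report of the inputs does. -/
theorem Couple.of_wp {α : Type} {p : PMF α} {c₁ c₂ : Program} {s : State} {R : α → State → Prop}
    (h : c₁.wp s fun s' => Couple p (c₂.exec s') R) : Couple p ((Program.seq c₁ c₂).exec s) R := by
  have e : p = (PMF.pure ()).bind fun _ => p :=
    (PMF.pure_bind () fun _ => p).symm
  rw [e]
  exact Couple.bind (Couple.pure_left (R := fun _ s' => Couple p (c₂.exec s') R) h) fun _ _ h => h

/-- Compute the powers of `2` up to the modulus. -/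
def doubling : Program :=
  assign 15 [] (.lit 1) ;;
  .loop 20 (var 1) (assign 16 [var 20] (var 15) ;; assign 15 [] (var 15 + var 15))

theorem exists_assign_steps_le (a : ℕ) (l : List Expr) (v : Expr) :
    ∃ C, ∀ N s, Bounded N s → (assign a l v).wp s fun s' => ∃ t ≤ C * (N + 2),
      s' = (s.write a (l.map fun e => e.eval s) (v.eval s)).tick t := by
  obtain ⟨C₁, h₁⟩ := exists_cost_le_of_index fun i : Fin l.length => l[i]
  obtain ⟨C₂, h₂⟩ := v.exists_cost_le
  refine ⟨1 + C₁ + C₂, fun N s hs s' hs' =>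
    ⟨1 + ∑ i : Fin l.length, l[i].cost s + v.cost s, ?_, ?_⟩⟩
  · have := h₁ N s hs
    have := (h₂ N s hs).1
    rw [add_mul, add_mul]
    omega
  · rw [(PMF.mem_support_pure_iff _ _).1 hs', ofFn_eval]

/-- `Program.Tame.exists_steps_le` does not apply: array `15` is written, sums are stored unreduced,
and `Bounded` fails until array `15` is nonzero. So the invariant and the cost are tracked by hand,
and `Bounded` is established for what follows. -/
theorem exists_doubling_steps_le : ∃ T : Polynomial ℕ, ∀ N k s, 1 ≤ N →
    (∀ a l, (s.mem a l).size ≤ N + 2) → (∀ a < 6, s.mem a [] ≤ N) → s.mem 1 [] = k →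
    doubling.wp s fun s' => (Bounded N s' ∧ s'.steps ≤ s.steps + T.eval N) ∧ s'.out = s.out ∧
      s'.mem 15 [] = 2 ^ k ∧ (∀ m < k, s'.mem 16 [m] = 2 ^ m) ∧
      ∀ b, b ≠ 15 → b ≠ 16 → b ≠ 20 → s'.mem b = s.mem b := by
  obtain ⟨C₁, h₁⟩ := exists_assign_steps_le 16 [var 20] (var 15)
  obtain ⟨C₂, h₂⟩ := exists_assign_steps_le 15 [] (var 15 + var 15)
  obtain ⟨C₃, h₃⟩ := (var 1).exists_cost_le
  refine ⟨5 + Polynomial.C C₃ * (Polynomial.X + 2) + Polynomial.X *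
    (1 + Polynomial.X + Polynomial.C (C₁ + C₂) * (Polynomial.X + 2)), ?_⟩
  intro N k s hN hsize hparam hk
  have hkN : k ≤ N := hk ▸ hparam 1 (by decide)
  have hwrite : ∀ s l v, Bounded N s → v ≠ 0 → v.size ≤ N + 2 → Bounded N (s.write 15 l v) := by
    intro s l v hs hv hv'
    refine ⟨hN, fun a l' => ?_, fun a ha => ?_, ?_⟩
    · rw [State.mem_write]
      split_ifs
      exacts [hv', hs.size _ _]
    · rw [State.mem_write_of_ne _ _ _ (by omega)]
      exact hs.param a ha
    · rw [State.mem_write]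
      split_ifs
      exacts [hv, hs.modulus]
  -- A power `2 ^ (i + 1)` has `i + 2` digits, which the margin in `Bounded` covers.
  have hsucc : ∀ i, i ≤ N → (2 ^ (i + 1)).size ≤ N + 2 := fun i hi => by
    rw [Nat.size_pow]
    omega
  refine Program.wp_seq fun s₁ hs₁ => ?_
  -- One step for the assignment and `1 + 1` for the literal.
  have e₁ : s₁ = (s.write 15 [] 1).tick 3 := (PMF.mem_support_pure_iff _ _).1 hs₁
  have hB₁ : Bounded N s₁ := by
    rw [e₁]
    refine Bounded.tick ⟨hN, fun a l' => ?_, fun a ha => ?_, ?_⟩ _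
    · rw [State.mem_write]
      split_ifs
      · simp
      · exact hsize _ _
    · rw [State.mem_write_of_ne _ _ _ (by omega)]
      exact hparam a ha
    · simp [State.mem_write]
  have hk₁ : (var 1).eval s₁ = k := by simp [e₁, State.mem_write, hk]
  have hs₁ : ∀ b, b ≠ 15 → b ≠ 16 → b ≠ 20 → s₁.mem b = s.mem b := fun b hb _ _ => by
    rw [e₁, State.mem_tick, State.mem_write_of_ne _ _ _ hb]
  have ho₁ : s₁.out = s.out := by rw [e₁]; rfl
  have hst₁ : s₁.steps = s.steps + 3 := by rw [e₁]; rfl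
  have hone : s₁.mem 15 [] = 2 ^ 0 := by simp [e₁, State.mem_write]
  clear e₁
  have hcost := (h₃ N s₁ hB₁).1
  refine Program.wp_loop_steps (fun i s' => Bounded N s' ∧ s'.steps ≤ s.steps +
    (4 + C₃ * (N + 2) + i * (1 + N + (C₁ + C₂) * (N + 2))) ∧ s'.out = s.out ∧
      s'.mem 15 [] = 2 ^ i ∧ (∀ m < i, s'.mem 16 [m] = 2 ^ m) ∧
      ∀ b, b ≠ 15 → b ≠ 16 → b ≠ 20 → s'.mem b = s.mem b)
    ⟨hB₁.tick _, ?_, ho₁, hone, by simp, hs₁⟩ ?_ ?_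
  · simp only [State.tick, hst₁]
    omega
  · rw [hk₁]
    intro i hi s' ⟨hB, hst, ho, h15, h16, hs'⟩
    have hi' := size_le_self i
    have hB' : Bounded N ((s'.write 20 [] i).tick (1 + i.size)) :=
      (hB.write (by decide) _ (by omega)).tick _
    refine Program.wp_seq ((h₁ N _ hB').mono ?_)
    rintro _ ⟨t₁, ht₁, rfl⟩
    have hB'' := (hB'.write (a := 16) (by decide) ([var 20].map fun e =>
      e.eval ((s'.write 20 [] i).tick (1 + i.size))) (small_var 15 N _ hB')).tick t₁
    refine (h₂ N _ hB'').mono ?_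
    rintro _ ⟨t₂, ht₂, rfl⟩
    have hv : ((s'.write 20 [] i).tick (1 + i.size)).mem 15 [] = 2 ^ i := by
      simp [State.mem_write, h15]
    have h20 := mem_loop s' 20 i (1 + i.size)
    have hdouble : 2 ^ i + 2 ^ i = 2 ^ (i + 1) := by ring
    simp only [List.map_cons, List.map_nil, eval_var, eval_add, h20, hv, State.mem_tick,
      State.mem_write_of_ne _ _ _ (by decide : (15 : ℕ) ≠ 16)] at hB'' ⊢
    simp only [hdouble]
    refine ⟨(hwrite _ _ _ hB'' (by positivity) (hsucc i (by omega))).tick _, ?_, ho, ?_, ?_, ?_⟩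
    · simp only [State.tick, State.write]
      rw [add_mul i 1, one_mul, add_mul C₁ C₂]
      rw [add_mul C₁ C₂] at hst
      omega
    · simp [State.mem_write]
    · intro m hm
      rcases Nat.lt_succ_iff_lt_or_eq.1 hm with hm | rfl
      · simp [State.mem_write, h16 m hm, hm.ne]
      · simp [State.mem_write]
    · intro b hb hb' hb''
      rw [State.mem_write_of_ne _ _ _ hb, State.mem_tick, State.mem_write_of_ne _ _ _ hb', State.mem_tick, State.mem_write_of_ne _ _ _ hb'',
        hs' b hb hb' hb'']
  · rw [hk₁]
    rintro s' ⟨hB, hst, ho, h15, h16, hs'⟩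
    refine ⟨⟨hB, hst.trans ?_⟩, ho, h15, h16, hs'⟩
    have := Nat.mul_le_mul_right (1 + N + (C₁ + C₂) * (N + 2)) hkN
    simp only [Polynomial.eval_add, Polynomial.eval_mul, Polynomial.eval_C, Polynomial.eval_X,
      Polynomial.eval_one, Polynomial.eval_ofNat]
    omega

/-! ### Assembly of the simulator -/

section Simulator

variable {n k d R : ℕ} {P : Params k} {I : Finset (Fin n)} {h : Fin n} {s : State}

/-- Look for a party outside of the coalition and for a party inside; the variable `19` tells
whether the latter exists. -/
def searching : Program :=
  .loop 20 (var 0) (.ite (entry 11 [var 20]) (assign 18 [] (var 20) ;; assign 19 [] (.lit 1))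
    (assign 17 [] (var 20)))

/-- As `I` is not everything, an honest party is met, and the last one met stays in variable `17`.
Variable `19` remains `0` precisely for the empty coalition. -/
theorem wp_searching (hI : I ≠ Finset.univ) (hn : s.mem 0 [] = n)
    (hc : ∀ p : Fin n, s.mem 11 [(p : ℕ)] = if p ∈ I then 1 else 0) (hs : s.mem 19 [] = 0) :
    searching.wp s fun s' => s'.out = s.out ∧ (∃ h, h ∉ I ∧ s'.mem 17 [] = h) ∧
      (s'.mem 19 [] ≠ 0 → ∃ p₀ ∈ I, s'.mem 18 [] = p₀) ∧ (∀ p ∈ I, s'.mem 19 [] ≠ 0) ∧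
      ∀ b < 17, s'.mem b = s.mem b := by
  refine Program.wp_loop (fun i s' => s'.out = s.out ∧
      (∀ p : Fin n, (p : ℕ) < i → p ∉ I → ∃ h, h ∉ I ∧ s'.mem 17 [] = h) ∧
      (s'.mem 19 [] ≠ 0 → ∃ p₀ ∈ I, s'.mem 18 [] = p₀) ∧
      (∀ p ∈ I, (p : ℕ) < i → s'.mem 19 [] ≠ 0) ∧ ∀ b < 17, s'.mem b = s.mem b)
    (fun _ => ⟨rfl, by simp, by simp [hs], by simp, fun _ _ => rfl⟩) ?_ ?_
  · intro i hi s₁ ⟨h1, h2, h3, h4, h5⟩ t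
    rw [eval_var, hn] at hi
    have hs₁ : ∀ b, b ≠ 20 → ((s₁.write 20 [] i).tick t).mem b = s₁.mem b := fun b hb => by
      rw [State.mem_tick, State.mem_write_of_ne _ _ _ hb]
    have h20 := mem_loop s₁ 20 i t
    have ho : ((s₁.write 20 [] i).tick t).out = s₁.out := rfl
    generalize (s₁.write 20 [] i).tick t = s₂ at *
    have hce : (entry 11 [var 20]).eval s₂ = if (⟨i, hi⟩ : Fin n) ∈ I then 1 else 0 := by
      have := hc ⟨i, hi⟩
      simp only [eval_entry, List.map_cons, List.map_nil, eval_var, h20, hs₁ 11 (by decide),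
        h5 11 (by decide)]
      exact this
    refine Program.wp_ite (fun hne u => ?_) fun he u => ?_
    · have hiI : (⟨i, hi⟩ : Fin n) ∈ I := by
        by_contra hiI
        simp [hce, hiI] at hne
      refine Program.wp_seq (wp_assign_var.mono fun s₃ ⟨h6, h7, h8⟩ =>
        wp_assign_var.mono fun s₄ ⟨h9, h10, h11⟩ => ?_)
      rw [eval_lit] at h10
      refine ⟨by rw [h9, h6, State.out_tick, ho, h1], fun p hp hpI => ?_, fun _ =>
        ⟨⟨i, hi⟩, hiI, ?_⟩, fun _ _ _ => by simp [h10], fun b hb => ?_⟩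
      · have hpi : (p : ℕ) ≠ i := fun hh => hpI ((Fin.ext hh : p = ⟨i, hi⟩) ▸ hiI)
        rw [h11 17 (by decide), h8 17 (by decide), State.mem_tick, hs₁ 17 (by decide)]
        exact h2 p (by omega) hpI
      · rw [h11 18 (by decide), h7]
        simp [h20]
      · rw [h11 b (by omega), h8 b (by omega), State.mem_tick, hs₁ b (by omega), h5 b hb]
    · have hiI : (⟨i, hi⟩ : Fin n) ∉ I := by
        intro hiI
        simp [hce, hiI] at he
      refine wp_assign_var.mono fun s₃ ⟨h6, h7, h8⟩ => ?_
      have e : ∀ b, b ≠ 17 → b ≠ 20 → s₃.mem b = s₁.mem b := fun b hb hb' => by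
        rw [h8 b hb, State.mem_tick, hs₁ b hb']
      refine ⟨by rw [h6, State.out_tick, ho, h1], fun _ _ _ => ⟨⟨i, hi⟩, hiI, by simp [h7, h20]⟩,
        ?_, fun p hp hpi => ?_, fun b hb => by rw [e b (by omega) (by omega), h5 b hb]⟩
      · rw [e 19 (by decide) (by decide), e 18 (by decide) (by decide)]
        exact h3
      · have hpi' : (p : ℕ) ≠ i := fun hh => hiI ((Fin.ext hh : p = ⟨i, hi⟩) ▸ hp)
        rw [e 19 (by decide) (by decide)]
        exact h4 p hp (by omega)
  · intro s₁ ⟨h1, h2, h3, h4, h5⟩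
    rw [eval_var, hn] at h2 h4
    obtain ⟨p, hp⟩ : ∃ p, p ∉ I := by
      by_contra! hI'
      exact hI (Finset.eq_univ_iff_forall.2 hI')
    exact ⟨h1, h2 p p.2 hp, h3, fun p hp => h4 p hp p.2, h5⟩

/-- Announce the inputs of the coalition. -/
def reporting : Program :=
  .loop 20 (var 0) (.loop 21 (var 3) (.loop 22 (var 2)
    (.ite (entry 11 [var 20]) (.emit (entry 12 [var 20, var 21, var 22])) .skip)))

/-- The nesting of the loops reproduces the order of the inputs in `View.encode`. -/
theorem wp_reporting {x : Fin n → Fin R → Fin d → ZMod (2 ^ k)} {p₀ : Fin n} (hE : Env P d I h s)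
    (hK : Known P I x p₀ s) : reporting.wp s fun s' => (∀ b < 20, s'.mem b = s.mem b) ∧
      s'.out = s.out ++ (List.finRange n).flatMap fun p => (List.finRange R).flatMap fun r =>
        (List.finRange d).flatMap fun t => if p ∈ I then [(x p r t).val] else [] := by
  have frame : ∀ {v i t : ℕ} {s' : State}, 20 ≤ v → ((s'.write v [] i).tick t).mem v [] = i ∧
      ((s'.write v [] i).tick t).out = s'.out ∧
      ∀ b, b ≠ v → ((s'.write v [] i).tick t).mem b = s'.mem b := fun {v i t s'} hv =>
    ⟨mem_loop _ _ _ _, rfl, fun b hb => by rw [State.mem_tick, State.mem_write_of_ne _ _ _ hb]⟩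
  refine wp_emitLoop _ (fun s' => ∀ b < 20, s'.mem b = s.mem b) (by simp [hE.parties])
    (fun _ _ _ => rfl) fun p s₁ f₁ t₁ => ?_
  obtain ⟨e1, e2, e3⟩ := frame (v := 20) (i := p) (t := t₁) (s' := s₁) le_rfl
  generalize (s₁.write 20 [] p).tick t₁ = s₂ at *
  have hK₂ := hK.frame (s' := s₂) fun b hb => by rw [e3 b (by omega), f₁ b hb]
  refine (wp_emitLoop (fun r : Fin R => (List.finRange d).flatMap fun t =>
    if p ∈ I then [(x p r t).val] else []) (fun s' => ∀ b, b ≠ 21 → b ≠ 22 → s'.mem b = s₂.mem b)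
    (by simp [hK₂.iters]) (fun _ _ _ _ => rfl) fun r s₃ f₃ t₃ => ?_).mono fun s' ⟨h1, h2⟩ =>
      ⟨fun b hb => by rw [h1 b (by omega) (by omega), e3 b (by omega), f₁ b hb], by rw [h2, e2]⟩
  obtain ⟨e4, e5, e6⟩ := frame (v := 21) (i := r) (t := t₃) (s' := s₃) (by decide)
  generalize (s₃.write 21 [] r).tick t₃ = s₄ at *
  have hE₄ := hE.frame (s' := s₄) fun b hb => by
    rw [e6 b (by omega), f₃ b (by omega) (by omega), e3 b (by omega), f₁ b hb]
  refine (wp_emitLoop (fun t : Fin d => if p ∈ I then [(x p r t).val] else []) (fun s' => ∀ b, b ≠ 22 → s'.mem b = s₄.mem b)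
    (by simp [hE₄.dim]) (fun _ _ _ => rfl) fun t s₅ f₅ t₅ => ?_).mono fun s' ⟨h1, h2⟩ =>
      ⟨fun b hb hb' => by rw [h1 b hb', e6 b hb, f₃ b hb hb'], by rw [h2, e5]⟩
  obtain ⟨e7, e8, e9⟩ := frame (v := 22) (i := t) (t := t₅) (s' := s₅) (by decide)
  generalize (s₅.write 22 [] t).tick t₅ = s₆ at *
  have f₆ : ∀ b < 20, s₆.mem b = s.mem b := fun b hb => by
    rw [e9 b (by omega), f₅ b (by omega), e6 b (by omega), f₃ b (by omega) (by omega),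
      e3 b (by omega), f₁ b hb]
  have h20 : s₆.mem 20 [] = p := by
    rw [e9 20 (by decide), f₅ 20 (by decide), e6 20 (by decide), f₃ 20 (by decide) (by decide), e1]
  have h21 : s₆.mem 21 [] = r := by rw [e9 21 (by decide), f₅ 21 (by decide), e4]
  have hc : (entry 11 [var 20]).eval s₆ = if p ∈ I then 1 else 0 := by
    simp [h20, (hE.frame f₆).corrupt p]
  refine Program.wp_ite (fun hne u => Program.wp_emit fun u' => ⟨fun b hb => ?_, ?_⟩)
    fun he u => Program.wp_skip ⟨fun b hb => ?_, ?_⟩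
  · exact (e9 b hb).trans (f₅ b hb)
  · have hp : p ∈ I := by
      by_contra hp
      simp [hc, hp] at hne
    rw [if_pos hp, ← (hK.frame f₆).input p hp r t]
    simp [State.tick, h20, h21, e7, e8]
  · exact (e9 b hb).trans (f₅ b hb)
  · have hp : p ∉ I := by
      intro hp
      simp [hc, hp] at he
    simp [hp, e8]

/-- The part of the simulator that starts from the table of powers of `2`. -/
def acting : Program := searching ;; .ite (var 19) (reporting ;; iterating) .skip

/-- The parameters and the arrays `15` and `16` are out of reach, so one syntactic check yields the
time bound for all of `acting`. -/
theorem tame_acting : acting.Tame 17 69 := by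
  simp [acting, searching, reporting]

/-- The simulator. -/
def simulator : Program := doubling ;; acting

theorem size_simInput_le [NeZero n] (xI : I → Fin R → Fin d → ZMod (2 ^ k))
    (fI : I → Output n k d R) (a : ℕ) (l : List ℕ) : ((simInput P I xI fI).mem a l).size ≤
      n + k + d + R + P.invIters + P.sqrtIters + 2 := by
  have h1 := size_le_self n
  have h2 := size_le_self k
  have h3 := size_le_self d
  have h4 := size_le_self R
  have h5 := size_le_self P.invIters
  have h6 := size_le_self P.sqrtIters
  have hv : ∀ z : ZMod (2 ^ k), z.val.size ≤ k := fun z => size_lt_of_lt z.val_lt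
  have hb : ∀ c : Prop, [Decidable c] → (if c then 1 else 0 : ℕ).size ≤ 1 := fun c _ => by
    split_ifs <;> simp
  have hz : ∀ (c : Prop) [Decidable c] (f : c → ℕ) (N : ℕ), (∀ h, (f h).size ≤ N) →
      (if h : c then f h else 0).size ≤ N := fun c _ f N hf => by
    split_ifs
    exacts [hf _, by simp]
  unfold simInput
  dsimp only
  split
  · omega
  · omega
  · omega
  · omega
  · omega
  · omega
  · have := hv P.cInv
    omega
  · have := hv P.guess
    omega
  · have := hv P.half
    omega
  · have := hv P.invN
    omega
  · have := hv P.tau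
    omega
  · exact (hb _).trans (by omega)
  · exact (hz _ _ k fun _ => hv _).trans (by omega)
  · exact (hz _ _ k fun _ => hv _).trans (by omega)
  · exact (hz _ _ 1 fun _ => hb _).trans (by omega)
  · simp

theorem simInput_param_le (xI : I → Fin R → Fin d → ZMod (2 ^ k)) (fI : I → Output n k d R) :
    ∀ a < 6, (simInput P I xI fI).mem a [] ≤ n + k + d + R + P.invIters + P.sqrtIters := by
  intro a ha
  interval_cases a <;> simp only [simInput] <;> omega

/-- The bound rests on the sizes of the stored numbers only, so `xI` and `fI` need not fit together.
-/
theorem exists_simulator_steps_le : ∃ T : Polynomial ℕ, ∀ (n k d R : ℕ) [NeZero n] (P : Params k)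
    (I : Finset (Fin n)) (xI : I → Fin R → Fin d → ZMod (2 ^ k)) (fI : I → Output n k d R),
    simulator.wp (simInput P I xI fI) fun s =>
      s.steps ≤ T.eval (n + k + d + R + P.invIters + P.sqrtIters) := by
  obtain ⟨T₁, h₁⟩ := exists_doubling_steps_le
  obtain ⟨T₂, h₂⟩ := tame_acting.exists_steps_le (by decide)
  refine ⟨T₁ + T₂, fun n k d R _ P I xI fI => Program.wp_seq ((h₁ _ k _ ?_ (size_simInput_le xI fI)
    (simInput_param_le xI fI) rfl).mono fun s₁ ⟨⟨hB, hs₁⟩, _⟩ => (h₂ _ s₁ hB).mono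
      fun s₂ ⟨_, hs₂⟩ => hs₂.trans ?_)⟩
  · have := NeZero.pos n
    omega
  · rw [Polynomial.eval_add]
    have : (simInput P I xI fI).steps = 0 := rfl
    omega

theorem encode_empty (x : (∅ : Finset (Fin n)) → Fin R → Fin d → ZMod (2 ^ k))
    (es : List (Event n)) : (⟨x, es.filter fun e => e.owner ∈ (∅ : Finset (Fin n))⟩ :
      View n k d R ∅).encode = [] := by
  simp [View.encode]

/-- The preparatory phases establish `Env` and, for a nonempty coalition, `Known`; then
`sim_iterating` couples the messages. An empty coalition sees nothing, so the simulator writes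
nothing and any coupling will do. -/
theorem couple_protocol [NeZero n] (hk : 0 < k) (hI : I ≠ Finset.univ)
    (x : Fin n → Fin R → Fin d → ZMod (2 ^ k)) :
    Couple (protocol P x) (simulator.exec
      (simInput P I (fun p => x p) fun p => functionality P x p)) fun o s =>
        (⟨fun p => x p, o.2.filter fun e => e.owner ∈ I⟩ : View n k d R I).encode = s.out := by
  obtain ⟨T₁, h₁⟩ := exists_doubling_steps_le
  set s₀ := simInput P I (fun p => x p) fun p => functionality P x p with hs₀
  refine Couple.of_wp ((h₁ (n + k + d + R + P.invIters + P.sqrtIters) k s₀ (by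
    have := NeZero.pos n
    omega) (size_simInput_le _ _) (simInput_param_le _ _) rfl).mono
    fun s₁ ⟨_, ho₁, h15, h16, f₁⟩ => ?_)
  have hcorrupt : ∀ p : Fin n, s₁.mem 11 [(p : ℕ)] = if p ∈ I then 1 else 0 := fun p => by
    rw [f₁ 11 (by decide) (by decide) (by decide), hs₀]
    simp [simInput]
  refine Couple.of_wp ((wp_searching hI (by rw [f₁ 0 (by decide) (by decide) (by decide)]; rfl)
    hcorrupt (by rw [f₁ 19 (by decide) (by decide) (by decide)]; rfl)).mono
    fun s₂ ⟨ho₂, ⟨h, hh, h17⟩, h18, h19, f₂⟩ => ?_)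
  have f : ∀ b < 15, s₂.mem b = s₀.mem b := fun b hb => by
    rw [f₂ b (by omega), f₁ b (by omega) (by omega) (by omega)]
  have ho : s₂.out = [] := by rw [ho₂, ho₁]; rfl
  have hE : Env P d I h s₂ := {
    parties := by rw [f 0 (by decide)]; rfl
    digits := by rw [f 1 (by decide)]; rfl
    dim := by rw [f 2 (by decide)]; rfl
    invIters := by rw [f 4 (by decide)]; rfl
    sqrtIters := by rw [f 5 (by decide)]; rfl
    cInv := by rw [f 6 (by decide)]; rfl
    guess := by rw [f 7 (by decide)]; rfl
    half := by rw [f 8 (by decide)]; rfl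
    invN := by rw [f 9 (by decide)]; rfl
    tau := by rw [f 10 (by decide)]; rfl
    corrupt := fun p => by rw [f₂ 11 (by decide), hcorrupt]
    order := by rw [f₂ 15 (by decide), h15]
    power := fun m hm => by rw [f₂ 16 (by decide), h16 m hm]
    honest := h17
    honest_notMem := hh }
  rw [Program.exec]
  split_ifs with hflag
  · rw [eval_var] at hflag
    obtain ⟨p₀, hp₀, h18⟩ := h18 hflag
    have hK : Known P I x p₀ s₂ := {
      iters := by rw [f 3 (by decide)]; rfl
      input := fun p hp r t => by
        rw [f 12 (by decide), hs₀]
        simp [simInput, hp]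
      model := fun p hp r t => by
        rw [f 13 (by decide), hs₀]
        simp [simInput, hp, functionality]
      -- Every client learns all comparison bits, so the output of the single member `p₀` supplies
      -- them.
      rejected := fun r i j => by
        rw [f 14 (by decide), hs₀]
        simp [simInput, hp₀, functionality]
        congr
      witness := h18 }
    generalize 1 + (var 19).cost s₂ = t
    replace hE : Env P d I h (s₂.tick t) := hE.frame fun _ _ => rfl
    replace hK : Known P I x p₀ (s₂.tick t) := hK.frame fun _ _ => rfl
    refine Couple.of_wp ((wp_reporting hE hK).mono fun s₃ ⟨f₃, ho₃⟩ => ?_)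
    have hsim : Sim I (do
        let res ← forFin fun r => iteration P fun i => x i r
        pure fun p => ⟨fun r => (res r p).1, fun r i => (res r i).2⟩ :
          Prot n (Fin n → Output n k d R)) iterating s₃ fun _ _ => True :=
      Sim.map (sim_iterating hk (hE.frame f₃) (hK.frame f₃)) fun _ _ _ => trivial
    -- The reported inputs form the base to which the simulated messages are appended.
    refine (hsim s₃.out [] (by simp [visible])).mono fun o s' ⟨h1, _⟩ => ?_
    rw [h1, ho₃, State.out_tick, ho, List.nil_append]
    rfl
  · have hI' : I = ∅ := by
      by_contra hne
      obtain ⟨p, hp⟩ := Finset.nonempty_iff_ne_empty.2 hne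
      exact h19 p hp (by simpa using hflag)
    subst hI'
    refine (Couple.prod _ _).mono fun o s' ⟨_, hs'⟩ => ?_
    rw [encode_empty, (PMF.mem_support_pure_iff _ _).1 hs']
    exact ho.symm

end Simulator

end SecureDL

end

theorem theorem2 :
    -- the protocol computes the functionality
    (∀ (n k d R : ℕ) [NeZero n], 0 < k →
      ∀ (P : SecureDL.Params k) (x : Fin n → Fin R → Fin d → ZMod (2 ^ k)),
        ∀ o ∈ (SecureDL.protocol P x).support, o.1 = SecureDL.functionality P x) ∧
    -- one probabilistic polynomial-time simulator for all coalitions that spare a party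
    (∃ (S : SecureDL.Program) (T : Polynomial ℕ),
      ∀ (n k d R : ℕ) [NeZero n], 0 < k →
        ∀ (P : SecureDL.Params k) (I : Finset (Fin n)), I ≠ Finset.univ →
          (∀ (xI : I → Fin R → Fin d → ZMod (2 ^ k)) (fI : I → SecureDL.Output n k d R),
            ∀ s ∈ (S.exec (SecureDL.simInput P I xI fI)).support,
              s.steps ≤ T.eval (n + k + d + R + P.invIters + P.sqrtIters)) ∧
          (∀ x : Fin n → Fin R → Fin d → ZMod (2 ^ k),
            (S.exec (SecureDL.simInput P I (fun p => x p)
                (fun p => SecureDL.functionality P x p))).map SecureDL.State.out =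
              (SecureDL.viewDist P I x).map SecureDL.View.encode)) := by
  obtain ⟨T, hT⟩ := SecureDL.exists_simulator_steps_le
  refine ⟨fun n k d R _ _ => SecureDL.protocol_correct, SecureDL.simulator, T,
    fun n k d R _ hk P I hI => ⟨hT n k d R P I, fun x => ?_⟩⟩
  rw [SecureDL.viewDist, PMF.map_comp]
  exact ((SecureDL.couple_protocol hk hI x).map_eq fun _ _ h => h).symm
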